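/- Let $k\ge l\ge m\ge 1$ be integers with $l\ge 2$, put $n=k+l+m$, and let $G/H=SO(n)/SO(k)\times SO(l)\times SO(m)$, with $H$ embedded block-diagonally. Let $\mathfrak p$ be the space of skew-symmetric $n\times n$ matrices whose diagonal blocks of sizes $k,l,m$ vanish; it is the orthogonal complement of the Lie algebra of $H$ in $\mathfrak{so}(n)$ with respect to $\langle X,Y\rangle=-(n-2)\operatorname{tr}(XY)$ (the negative of the Killing form), and $\mathfrak p=\mathfrak p_1\oplus\mathfrak p_2\oplus\mathfrak p_3$, where $\mathfrak p_1,\mathfrak p_2,\mathfrak p_3$ consist of the matrices supported in the off-diagonal blocks of type $k\times l$, $k\times m$, $l\times m$ (and their transposes). $G$-invariant Riemannian metrics on $G/H$ are identified with $\operatorname{Ad}(H)$-invariant inner products on $\mathfrak p$; the three-parameter family consists of the metrics $$x_1\langle\cdot,\cdot\rangle|_{\mathfrak p_1}+x_2\langle\cdot,\cdot\rangle|_{\mathfrak p_2}+x_3\langle\cdot,\cdot\rangle|_{\mathfrak p_3},\qquad x_1,x_2,x_3>0.$$ Metrics are counted up to homothety, i.e. up to multiplication by a positive constant. Then: 1.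 If $m>\sqrt{2k+2l-4}$, there are exactly $4$ Einstein metrics in the three-parameter family, and exactly $4$ invariant Einstein metrics on $G/H$ altogether. 2. If $m<\sqrt{k+l}$, there are exactly $2$ Einstein metrics in the three-parameter family; if moreover at most one of $k,l,m$ equals $2$, there are exactly $2$ invariant Einstein metrics on $G/H$ altogether. -/

import Mathlib

/-! ## Local Riemannian geometry in coordinates

A Riemannian metric on an open subset of `ℝ^T` is a matrix-valued function `g`. -/

namespace LocalRiemannian

open scoped Matrix

variable {T : Type} [Fintype T] [DecidableEq T]

/-- The partial derivative of `f` at `x` in the direction of the coordinate `a`. -/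
noncomputable def partialDeriv (a : T) (f : (T → ℝ) → ℝ) (x : T → ℝ) : ℝ :=
  fderiv ℝ f x (Pi.single a 1)

/-- The Christoffel symbols
`Γ^c_{ab} = ½ ∑_d g^{cd} (∂_a g_{db} + ∂_b g_{da} - ∂_d g_{ab})` of the Levi-Civita connection. -/
noncomputable def christoffel (g : (T → ℝ) → Matrix T T ℝ) (c a b : T) (x : T → ℝ) : ℝ :=
  (1 / 2) * ∑ d, (g x)⁻¹ c d *
    (partialDeriv a (fun y => g y d b) x + partialDeriv b (fun y => g y d a) x
      - partialDeriv d (fun y => g y a b) x)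

/-- The Ricci tensor
`Ric_{ab} = ∑_c (∂_c Γ^c_{ab} - ∂_b Γ^c_{ac} + ∑_d (Γ^c_{cd} Γ^d_{ab} - Γ^c_{bd} Γ^d_{ac}))`. -/
noncomputable def ricci (g : (T → ℝ) → Matrix T T ℝ) (x : T → ℝ) : Matrix T T ℝ :=
  Matrix.of fun a b => ∑ c,
    (partialDeriv c (christoffel g c a b) x - partialDeriv b (christoffel g c a c) x
      + ∑ d, (christoffel g c c d x * christoffel g d a b x
        - christoffel g c b d x * christoffel g d a c x))

end LocalRiemannian

/-! ## The homogeneous space `SO(k+l+m) / SO(k) × SO(l) × SO(m)` -/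

namespace WallachSO

open scoped Matrix ContDiff

/-- The `k + l + m` rows and columns, split into three blocks. -/
abbrev Idx (k l m : ℕ) : Type := Fin k ⊕ Fin l ⊕ Fin m

/-- The real square matrices of size `k + l + m`. -/
abbrev Mat (k l m : ℕ) : Type := Matrix (Idx k l m) (Idx k l m) ℝ

/-- The number of the block that an index belongs to. -/
def blk {k l m : ℕ} : Idx k l m → Fin 3 :=
  Sum.elim (fun _ => 0) (Sum.elim (fun _ => 1) (fun _ => 2))

/-- The group `G = SO(k+l+m)`. -/
abbrev G (k l m : ℕ) : Submonoid (Mat k l m) :=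
  Matrix.specialOrthogonalGroup (Idx k l m) ℝ

/-- The matrix with diagonal blocks `A`, `B`, `C`. -/
def diagBlocks {k l m : ℕ} (A : Matrix (Fin k) (Fin k) ℝ) (B : Matrix (Fin l) (Fin l) ℝ)
    (C : Matrix (Fin m) (Fin m) ℝ) : Mat k l m :=
  Matrix.fromBlocks A 0 0 (Matrix.fromBlocks B 0 0 C)

/-- The subgroup `H = SO(k) × SO(l) × SO(m)` of block diagonal matrices in `SO(k+l+m)`. -/
def H (k l m : ℕ) : Set (Mat k l m) :=
  {h | ∃ A ∈ Matrix.specialOrthogonalGroup (Fin k) ℝ,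
      ∃ B ∈ Matrix.specialOrthogonalGroup (Fin l) ℝ,
      ∃ C ∈ Matrix.specialOrthogonalGroup (Fin m) ℝ, h = diagBlocks A B C}

/-- The isotropy module `𝔭`: the skew-symmetric matrices whose diagonal blocks vanish. It is the
orthogonal complement of `𝔥 = so(k) ⊕ so(l) ⊕ so(m)` in `so(k+l+m)` with respect to the Killing
form, and it is the tangent space of `G/H` at `eH`. -/
def 𝔭 (k l m : ℕ) : Submodule ℝ (Mat k l m) where
  carrier := {X | Xᵀ = -X ∧ ∀ i j, blk i = blk j → X i j = 0}
  zero_mem' := by simp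
  add_mem' := by
    rintro X Y ⟨hX, hX'⟩ ⟨hY, hY'⟩
    refine ⟨by rw [Matrix.transpose_add, hX, hY]; abel, fun i j hij => ?_⟩
    rw [Matrix.add_apply, hX' i j hij, hY' i j hij, add_zero]
  smul_mem' := by
    rintro c X ⟨hX, hX'⟩
    refine ⟨by rw [Matrix.transpose_smul, hX, smul_neg], fun i j hij => ?_⟩
    rw [Matrix.smul_apply, hX' i j hij, smul_zero]

/-- The projection of `so(k+l+m) = 𝔥 ⊕ 𝔭` onto `𝔭` along `𝔥`, extended to all matrices by first
taking the skew-symmetric part. -/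
noncomputable def proj (k l m : ℕ) : Mat k l m →ₗ[ℝ] 𝔭 k l m where
  toFun A := ⟨Matrix.of fun i j => if blk i = blk j then 0 else (A i j - A j i) / 2, by
    refine ⟨?_, fun i j hij => by simp [hij]⟩
    ext i j
    by_cases hij : blk i = blk j
    · simp [hij]
    · simp [hij, Ne.symm hij]
      ring⟩
  map_add' A B := by
    ext i j
    by_cases hij : blk i = blk j
    · simp [hij]
    · simp [hij]
      ring
  map_smul' c A := by
    ext i j
    by_cases hij : blk i = blk j
    · simp [hij]
    · simp [hij]
      ring

/-- `Ad(H)`-invariant inner products on `𝔭`, that is, `G`-invariant Riemannian metrics on `G/H`.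
The clause on `X'` and `Y'` says that `B (Ad h X) (Ad h Y) = B X Y`, as `hᵀ = h⁻¹`. -/
structure IsInvariantMetric {k l m : ℕ} (B : LinearMap.BilinForm ℝ (𝔭 k l m)) : Prop where
  symm : ∀ X Y, B X Y = B Y X
  pos : ∀ X, X ≠ 0 → 0 < B X X
  invariant : ∀ h ∈ H k l m, ∀ X Y X' Y' : 𝔭 k l m,
    (X' : Mat k l m) = h * (X : Mat k l m) * hᵀ →
    (Y' : Mat k l m) = h * (Y : Mat k l m) * hᵀ → B X' Y' = B X Y

/-- The standard inner product `⟨X, Y⟩ = -Killing(X, Y) = -(k+l+m-2) tr(XY)` of `so(k+l+m)`. -/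
noncomputable def standardInner {k l m : ℕ} (X Y : Mat k l m) : ℝ :=
  -(((k + l + m : ℕ) : ℝ) - 2) * (X * Y).trace

/-- The component of a matrix in the off-diagonal blocks `(s, t)` and `(t, s)`. On `𝔭` these are
the projections onto the three modules `𝔭₁`, `𝔭₂`, `𝔭₃`. -/
def component {k l m : ℕ} (s t : Fin 3) (X : Mat k l m) : Mat k l m :=
  Matrix.of fun i j =>
    if (blk i = s ∧ blk j = t) ∨ (blk i = t ∧ blk j = s) then X i j else 0

/-- Membership in the three-parameter family
`x₁ ⟨·,·⟩|𝔭₁ + x₂ ⟨·,·⟩|𝔭₂ + x₃ ⟨·,·⟩|𝔭₃` with `x₁, x₂, x₃ > 0`. -/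
def IsThreeParameter {k l m : ℕ} (B : LinearMap.BilinForm ℝ (𝔭 k l m)) : Prop :=
  ∃ x₁ x₂ x₃ : ℝ, 0 < x₁ ∧ 0 < x₂ ∧ 0 < x₃ ∧ ∀ X Y : 𝔭 k l m,
    B X Y = x₁ * standardInner (component 0 1 (X : Mat k l m)) (component 0 1 (Y : Mat k l m))
      + x₂ * standardInner (component 0 2 (X : Mat k l m)) (component 0 2 (Y : Mat k l m))
      + x₃ * standardInner (component 1 2 (X : Mat k l m)) (component 1 2 (Y : Mat k l m))

/-- Indices of local coordinates on `G/H`, which has dimension `kl + km + lm`. -/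
abbrev Coord (k l m : ℕ) : Type := (Fin k × Fin l) ⊕ (Fin k × Fin m) ⊕ (Fin l × Fin m)

/-- The derivative of a matrix-valued function at `x` in the direction `v`. -/
noncomputable def matDeriv {k l m : ℕ} (φ : (Coord k l m → ℝ) → Mat k l m)
    (x v : Coord k l m → ℝ) : Mat k l m :=
  Matrix.of fun i j => fderiv ℝ (fun y => φ y i j) x v

/-- The derivative at `x`, in the direction `v`, of the map `y ↦ φ(y) H` to `G/H`, where `φ` takes
values in `G`. The tangent space of `G/H` at `φ(x) H` is identified with `𝔭` through the
translation by `φ(x)`, so the derivative is the `𝔭`-part of `φ(x)⁻¹ dφ_x(v)`. -/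
noncomputable def cosetDeriv {k l m : ℕ} (φ : (Coord k l m → ℝ) → Mat k l m)
    (x v : Coord k l m → ℝ) : 𝔭 k l m :=
  proj k l m ((φ x)ᵀ * matDeriv φ x v)

/-- `φ : U → G` is smooth and `x ↦ φ(x) H` is a local diffeomorphism from the open set `U` to
`G/H`, that is, its derivative is bijective at every point. -/
structure IsLocalParametrization {k l m : ℕ} (U : Set (Coord k l m → ℝ))
    (φ : (Coord k l m → ℝ) → Mat k l m) : Prop where
  isOpen : IsOpen U
  mem : ∀ x ∈ U, φ x ∈ G k l m
  smooth : ∀ i j, ContDiffOn ℝ ∞ (fun x => φ x i j) U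
  bijective : ∀ x ∈ U, Function.Bijective (cosetDeriv φ x)

/-- The invariant metric on `G/H` given by `B`, in the local coordinates given by `φ`. -/
noncomputable def localMetric {k l m : ℕ} (B : LinearMap.BilinForm ℝ (𝔭 k l m))
    (φ : (Coord k l m → ℝ) → Mat k l m) (x : Coord k l m → ℝ) :
    Matrix (Coord k l m) (Coord k l m) ℝ :=
  Matrix.of fun a b => B (cosetDeriv φ x (Pi.single a 1)) (cosetDeriv φ x (Pi.single b 1))

/-- The invariant metric on `G/H` given by `B` is Einstein: `Ric = c g` on all of `G/H` for some
real constant `c`. -/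
def IsEinstein {k l m : ℕ} (B : LinearMap.BilinForm ℝ (𝔭 k l m)) : Prop :=
  ∃ c : ℝ, ∀ (U : Set (Coord k l m → ℝ)) (φ : (Coord k l m → ℝ) → Mat k l m),
    IsLocalParametrization U φ →
      ∀ x ∈ U, LocalRiemannian.ricci (localMetric B φ) x = c • localMetric B φ x

/-- All invariant Einstein metrics on `SO(k+l+m) / SO(k) × SO(l) × SO(m)`. -/
def invariantEinsteinMetrics (k l m : ℕ) : Set (LinearMap.BilinForm ℝ (𝔭 k l m)) :=
  {B | IsInvariantMetric B ∧ IsEinstein B}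

/-- The invariant Einstein metrics in the three-parameter family. -/
def threeParameterEinsteinMetrics (k l m : ℕ) : Set (LinearMap.BilinForm ℝ (𝔭 k l m)) :=
  {B | IsInvariantMetric B ∧ IsThreeParameter B ∧ IsEinstein B}

/-- Two metrics are identified if one is a positive constant multiple of the other. -/
def homothety {k l m : ℕ} (S : Set (LinearMap.BilinForm ℝ (𝔭 k l m))) : Setoid S where
  r B B' := ∃ c : ℝ, 0 < c ∧
    (B' : LinearMap.BilinForm ℝ (𝔭 k l m)) = c • (B : LinearMap.BilinForm ℝ (𝔭 k l m))
  iseqv :=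
    { refl := fun B => ⟨1, one_pos, (one_smul ℝ _).symm⟩
      symm := by
        rintro B B' ⟨c, hc, h⟩
        exact ⟨c⁻¹, inv_pos.mpr hc, by rw [h, smul_smul, inv_mul_cancel₀ hc.ne', one_smul]⟩
      trans := by
        rintro B B' B'' ⟨c, hc, h⟩ ⟨d, hd, h'⟩
        exact ⟨d * c, mul_pos hd hc, by rw [h', h, smul_smul]⟩ }

/-- The number of metrics in `S` up to homothety (a positive value entails finiteness). -/
noncomputable def numUpToHomothety {k l m : ℕ}
    (S : Set (LinearMap.BilinForm ℝ (𝔭 k l m))) : ℕ :=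
  Nat.card (Quotient (homothety S))

end WallachSO

/-!
Einstein metrics on `SO(k+l+m) / SO(k) × SO(l) × SO(m)`, counted up to homothety.

*From geometry to algebra.* A local parametrization `φ : U → G` pulls the Maurer–Cartan form back to
`ω = φ⁻¹ dφ`, and the `𝔭`-part of `ω` is a coframe in which an invariant metric has constant
coefficients. For a metric that scales the block `(r, s)` of `𝔭` by `x_rs`, the Levi-Civita
connection in this frame is `leviCivita` applied to `ω`, an operator given by Koszul's formula which
also accounts for the `𝔥`-part of `ω` if `x_rr = 0` by convention. Metricity (`leviCivita_skew`),
vanishing torsion (`leviCivita_sub`) and the Maurer–Cartan equation turn the coordinate expression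
of the Ricci tensor into a trace of an algebraic curvature operator (`ricci_eq_of_frame`,
`sum_curvature`), so that the Ricci tensor is again diagonal (`ricci_localMetric_diagForm`). Since
the Cayley transform provides a parametrization (`exists_isLocalParametrization`), a metric of the
three-parameter family is Einstein if and only if its parameters solve two quadratic equations
(`isEinstein_familyMetric_iff`).

*All invariant metrics.* Rotations by right angles in the coordinate planes of a block permute the
standard basis of `𝔭` up to signs. If at most one block has size two, then invariance under them and
their squares makes this basis orthogonal, with equal norms within each summand
(`isThreeParameter_of_isInvariantMetric`).

*Counting.* Up to homothety one parameter is `1`; the other two, `x` and `y`, form `solutionSet`,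
where `α`, `β`, `γ` are the sizes of the index blocks that do not occur in the three summands. If
`α < β`, then `p = x - y` determines `x + y`, and the solutions are the roots of `quartic` in an
admissible range (`ncard_solutionSet`). At the ends of this range the sign of the quartic is known,
which yields one negative and at least one positive root. Each summand can be chosen for the
normalization, and the number of positive roots is found as follows.

* If `2 k + 2 l - 4 < m²` and `l < k`, the quartic has two more sign changes at explicit points, so
  that it has its maximal number of four roots (`ncard_solutionSet_of_four`).
* If `m² < k + l` and `k` is at least `l² - 2 l`, the quartic divided by `p` is increasing for
  `p > 0` (`ncard_solutionSet_of_large`).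
* If `m² < k + l` and `l < k < l² - 2 l`, the quartic is expanded in powers of
  `(l + k) p - (k - l)`; the coefficients show that there are no positive roots where this quantity
  is nonpositive, and only one where it is positive (`ncard_solutionSet_of_small`).
* If `α = β`, one of the equations factors and the system is solved explicitly
  (`ncard_solutionSet_self_eq_four`, `ncard_solutionSet_self_eq_two_of_lt`,
  `ncard_solutionSet_self_eq_two_of_gt`).
-/


set_option linter.unusedSectionVars false

namespace LocalRiemannian

open scoped Matrix ContDiff

variable {T : Type} [Fintype T] [DecidableEq T]

/-! ### Matrix-valued functions -/

/-- All entries of the matrix-valued function `M` are smooth on `U`. -/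
def SmoothOn {I J : Type} (M : (T → ℝ) → Matrix I J ℝ) (U : Set (T → ℝ)) : Prop :=
  ∀ i j, ContDiffOn ℝ ∞ (fun x => M x i j) U

/-- The entrywise partial derivative of a matrix-valued function. -/
noncomputable def matPartial {I J : Type} (a : T) (M : (T → ℝ) → Matrix I J ℝ) (x : T → ℝ) :
    Matrix I J ℝ :=
  Matrix.of fun i j => partialDeriv a (fun y => M y i j) x

section Calculus

variable {U : Set (T → ℝ)} {x : T → ℝ}

theorem partialDeriv_congr {f g : (T → ℝ) → ℝ} (hU : IsOpen U) (h : ∀ y ∈ U, f y = g y)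
    (hx : x ∈ U) (a : T) : partialDeriv a f x = partialDeriv a g x := by
  have : f =ᶠ[nhds x] g := Filter.eventuallyEq_of_mem (hU.mem_nhds hx) h
  rw [partialDeriv, partialDeriv, this.fderiv_eq]

theorem partialDeriv_sum {ι : Type*} (s : Finset ι) {f : ι → (T → ℝ) → ℝ}
    (h : ∀ i ∈ s, DifferentiableAt ℝ (f i) x) (a : T) :
    partialDeriv a (fun y => ∑ i ∈ s, f i y) x = ∑ i ∈ s, partialDeriv a (f i) x := by
  simp only [partialDeriv]
  rw [fderiv_fun_sum h]
  simp

theorem partialDeriv_mul {f g : (T → ℝ) → ℝ} (hf : DifferentiableAt ℝ f x)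
    (hg : DifferentiableAt ℝ g x) (a : T) :
    partialDeriv a (fun y => f y * g y) x
      = partialDeriv a f x * g x + f x * partialDeriv a g x := by
  simp only [partialDeriv]
  rw [fderiv_fun_mul hf hg]
  simp
  ring

theorem partialDeriv_const (c : ℝ) (a : T) : partialDeriv a (fun _ => c) x = 0 := by
  simp [partialDeriv]

theorem contDiffOn_partialDeriv {f : (T → ℝ) → ℝ} (hU : IsOpen U) (hf : ContDiffOn ℝ ∞ f U)
    (a : T) : ContDiffOn ℝ ∞ (partialDeriv a f) U := by
  have h := hf.fderiv_of_isOpen hU (m := ∞) (by simp)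
  exact h.clm_apply contDiffOn_const

theorem differentiableAt_of_contDiffOn {f : (T → ℝ) → ℝ} (hU : IsOpen U)
    (hf : ContDiffOn ℝ ∞ f U) (hx : x ∈ U) : DifferentiableAt ℝ f x :=
  (hf.contDiffAt (hU.mem_nhds hx)).differentiableAt (by simp)

theorem partialDeriv_comm {f : (T → ℝ) → ℝ} (hU : IsOpen U) (hf : ContDiffOn ℝ ∞ f U)
    (hx : x ∈ U) (a b : T) :
    partialDeriv a (partialDeriv b f) x = partialDeriv b (partialDeriv a f) x := by
  have hc : ContDiffAt ℝ ∞ f x := hf.contDiffAt (hU.mem_nhds hx)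
  have hs : IsSymmSndFDerivAt ℝ f x := hc.isSymmSndFDerivAt (by simp; norm_cast)
  have hd : DifferentiableAt ℝ (fderiv ℝ f) x :=
    (hc.fderiv_right (m := ∞) (by simp)).differentiableAt (by simp)
  have key : ∀ c d : T, partialDeriv c (partialDeriv d f) x
      = fderiv ℝ (fderiv ℝ f) x (Pi.single c 1) (Pi.single d 1) := by
    intro c d
    have : partialDeriv d f = fun y => fderiv ℝ f y (Pi.single d 1) := rfl
    rw [this, partialDeriv, fderiv_clm_apply hd (differentiableAt_const _)]
    simp
  rw [key, key, hs.eq]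

variable {I J K : Type}

theorem SmoothOn.differentiableAt {M : (T → ℝ) → Matrix I J ℝ} (hM : SmoothOn M U)
    (hU : IsOpen U) (hx : x ∈ U) (i : I) (j : J) : DifferentiableAt ℝ (fun y => M y i j) x :=
  differentiableAt_of_contDiffOn hU (hM i j) hx

theorem SmoothOn.mul [Fintype J] {M : (T → ℝ) → Matrix I J ℝ} {P : (T → ℝ) → Matrix J K ℝ}
    (hM : SmoothOn M U) (hP : SmoothOn P U) : SmoothOn (fun x => M x * P x) U := by
  intro i j
  simp only [Matrix.mul_apply]
  exact ContDiffOn.sum fun q _ => (hM i q).mul (hP q j)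

theorem SmoothOn.add {M P : (T → ℝ) → Matrix I J ℝ}
    (hM : SmoothOn M U) (hP : SmoothOn P U) : SmoothOn (fun x => M x + P x) U :=
  fun i j => (hM i j).add (hP i j)

theorem SmoothOn.transpose {M : (T → ℝ) → Matrix I J ℝ} (hM : SmoothOn M U) :
    SmoothOn (fun x => (M x)ᵀ) U :=
  fun i j => hM j i

theorem SmoothOn.matPartial {M : (T → ℝ) → Matrix I J ℝ} (hM : SmoothOn M U)
    (hU : IsOpen U) (a : T) : SmoothOn (matPartial a M) U :=
  fun i j => contDiffOn_partialDeriv hU (hM i j) a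

theorem SmoothOn.det [Fintype I] [DecidableEq I] {M : (T → ℝ) → Matrix I I ℝ}
    (hM : SmoothOn M U) : ContDiffOn ℝ ∞ (fun x => (M x).det) U := by
  simp only [Matrix.det_apply]
  exact ContDiffOn.sum fun σ _ =>
    (contDiffOn_prod fun i _ => hM (σ i) i).const_smul _

theorem SmoothOn.inv [Fintype I] [DecidableEq I] {M : (T → ℝ) → Matrix I I ℝ}
    (hM : SmoothOn M U) (hdet : ∀ x ∈ U, (M x).det ≠ 0) : SmoothOn (fun x => (M x)⁻¹) U := by
  intro i j
  have hadj : ContDiffOn ℝ ∞ (fun x => (M x).adjugate i j) U := by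
    simp only [Matrix.adjugate_apply]
    refine SmoothOn.det (M := fun x => (M x).updateRow j (Pi.single i 1)) fun p q => ?_
    by_cases h : p = j
    · subst h
      simpa using contDiffOn_const
    · simpa [Matrix.updateRow_ne h] using hM p q
  have : (fun x => (M x)⁻¹ i j) = fun x => (M x).det⁻¹ * (M x).adjugate i j := by
    funext x
    rw [Matrix.inv_def, Ring.inverse_eq_inv']
    simp
  rw [this]
  exact (hM.det.inv hdet).mul hadj

theorem matPartial_congr {M P : (T → ℝ) → Matrix I J ℝ} (hU : IsOpen U)
    (h : ∀ y ∈ U, M y = P y) (hx : x ∈ U) (a : T) : matPartial a M x = matPartial a P x := by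
  ext i j
  exact partialDeriv_congr hU (fun y hy => by rw [h y hy]) hx a

theorem matPartial_mul [Fintype J] {M : (T → ℝ) → Matrix I J ℝ} {P : (T → ℝ) → Matrix J K ℝ}
    (hU : IsOpen U) (hM : SmoothOn M U) (hP : SmoothOn P U) (hx : x ∈ U) (a : T) :
    matPartial a (fun y => M y * P y) x = matPartial a M x * P x + M x * matPartial a P x := by
  ext i j
  simp only [matPartial, Matrix.of_apply, Matrix.mul_apply, Matrix.add_apply]
  rw [partialDeriv_sum _ fun q _ =>
    (hM.differentiableAt hU hx i q).fun_mul (hP.differentiableAt hU hx q j),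
    ← Finset.sum_add_distrib]
  exact Finset.sum_congr rfl fun q _ =>
    partialDeriv_mul (hM.differentiableAt hU hx i q) (hP.differentiableAt hU hx q j) a

theorem matPartial_add {M P : (T → ℝ) → Matrix I J ℝ}
    (hU : IsOpen U) (hM : SmoothOn M U) (hP : SmoothOn P U) (hx : x ∈ U) (a : T) :
    matPartial a (fun y => M y + P y) x = matPartial a M x + matPartial a P x := by
  ext i j
  simp only [matPartial, Matrix.of_apply, Matrix.add_apply, partialDeriv]
  rw [fderiv_fun_add (hM.differentiableAt hU hx i j) (hP.differentiableAt hU hx i j)]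
  simp

theorem matPartial_const (C : Matrix I J ℝ) (a : T) : matPartial a (fun _ => C) x = 0 := by
  ext i j
  simp [matPartial, partialDeriv_const]

theorem matPartial_transpose {M : (T → ℝ) → Matrix I J ℝ} (a : T) :
    matPartial a (fun y => (M y)ᵀ) x = (matPartial a M x)ᵀ := rfl

theorem matPartial_comm {M : (T → ℝ) → Matrix I J ℝ} (hU : IsOpen U) (hM : SmoothOn M U)
    (hx : x ∈ U) (a b : T) :
    matPartial a (matPartial b M) x = matPartial b (matPartial a M) x := by
  ext i j
  exact partialDeriv_comm hU (hM i j) hx a b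

end Calculus

/-! ### Curvature in a moving frame -/

section Frame

variable {U : Set (T → ℝ)} {Θ : (T → ℝ) → Matrix T T ℝ} {Ω : T → (T → ℝ) → Matrix T T ℝ}
  {D : Matrix T T ℝ}

/-- The connection matrix `Θ⁻¹ (∂_a Θ + Ω_a Θ)` in coordinates of the connection with matrices
`Ω_a` in the frame dual to the coframe `Θ`. -/
noncomputable def frameConnection (Θ : (T → ℝ) → Matrix T T ℝ) (Ω : T → (T → ℝ) → Matrix T T ℝ)
    (a : T) (x : T → ℝ) : Matrix T T ℝ :=
  (Θ x)⁻¹ * (matPartial a Θ x + Ω a x * Θ x)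

theorem mul_frameConnection {x : T → ℝ} (hdet : (Θ x).det ≠ 0) (a : T) :
    Θ x * frameConnection Θ Ω a x = matPartial a Θ x + Ω a x * Θ x := by
  rw [frameConnection, Matrix.mul_nonsing_inv_cancel_left _ _ (Ne.isUnit hdet)]

/-- A metric, torsion-free connection given in a moving frame is the Levi-Civita connection. The
matrix `D` of the metric in the frame is constant, `hskew` says that the connection is metric, and
`htor` is the first structure equation without torsion. -/
theorem christoffel_eq_frameConnection (hU : IsOpen U) (hΘ : SmoothOn Θ U)
    (hdet : ∀ x ∈ U, (Θ x).det ≠ 0) (hD : Dᵀ = D) (hDdet : D.det ≠ 0)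
    (hskew : ∀ a, ∀ x ∈ U, D * Ω a x + (Ω a x)ᵀ * D = 0)
    (htor : ∀ a b, ∀ x ∈ U, ∀ i, matPartial a Θ x i b + (Ω a x * Θ x) i b
      = matPartial b Θ x i a + (Ω b x * Θ x) i a)
    {x : T → ℝ} (hx : x ∈ U) (c a b : T) :
    christoffel (fun y => (Θ y)ᵀ * D * Θ y) c a b x = frameConnection Θ Ω a x c b := by
  set g : (T → ℝ) → Matrix T T ℝ := fun y => (Θ y)ᵀ * D * Θ y with hg
  set Γ := fun a => frameConnection Θ Ω a x with hΓ
  have hΘΓ : ∀ a, Θ x * Γ a = matPartial a Θ x + Ω a x * Θ x :=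
    fun a => mul_frameConnection (hdet x hx) a
  have hu : IsUnit (g x).det := by
    rw [hg]
    simp only [Matrix.det_mul, Matrix.det_transpose]
    exact Ne.isUnit (mul_ne_zero (mul_ne_zero (hdet x hx) hDdet) (hdet x hx))
  -- the connection is torsion-free
  have hsymm : ∀ a b c, Γ a c b = Γ b c a := by
    intro a b c
    have h : ∀ i, (Θ x * Γ a) i b = (Θ x * Γ b) i a := by
      intro i
      rw [hΘΓ, hΘΓ, Matrix.add_apply, Matrix.add_apply]
      exact htor a b x hx i
    have e : ∀ a b, Γ a c b = ∑ i, (Θ x)⁻¹ c i * (Θ x * Γ a) i b := by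
      intro a b
      rw [← Matrix.mul_apply, Matrix.nonsing_inv_mul_cancel_left _ _ (Ne.isUnit (hdet x hx))]
    rw [e, e]
    exact Finset.sum_congr rfl fun i _ => by rw [h i]
  -- the connection preserves `g = Θᵀ D Θ`
  have hmet : ∀ a, matPartial a g x = (Γ a)ᵀ * g x + g x * Γ a := by
    intro a
    have hc : SmoothOn (fun _ : T → ℝ => D) U := fun i j => contDiffOn_const
    have h1 : matPartial a g x
        = ((matPartial a Θ x)ᵀ * D) * Θ x + ((Θ x)ᵀ * D) * matPartial a Θ x := by
      rw [hg, matPartial_mul hU (hΘ.transpose.mul hc) hΘ hx,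
        matPartial_mul hU hΘ.transpose hc hx, matPartial_const, matPartial_transpose]
      simp
    have h2 : matPartial a Θ x = Θ x * Γ a - Ω a x * Θ x := by rw [hΘΓ]; abel
    have h3 : (Ω a x)ᵀ * D = - (D * Ω a x) := by
      rw [eq_neg_iff_add_eq_zero, add_comm]; exact hskew a x hx
    have h4 : (Θ x)ᵀ * (Ω a x)ᵀ * D = -((Θ x)ᵀ * D * Ω a x) := by
      rw [Matrix.mul_assoc, h3, Matrix.mul_neg, Matrix.mul_assoc]
    rw [h1, h2, hg]
    simp only [Matrix.transpose_sub, Matrix.transpose_mul, Matrix.sub_mul, Matrix.mul_sub, h4,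
      Matrix.neg_mul, Matrix.mul_assoc]
    abel
  have hgs : (g x)ᵀ = g x := by
    rw [hg]; simp [Matrix.transpose_mul, hD, Matrix.mul_assoc]
  have hent : ∀ a p q, partialDeriv a (fun y => g y p q) x
      = (g x * Γ a) q p + (g x * Γ a) p q := by
    intro a p q
    have := congrFun (congrFun (hmet a) p) q
    rw [Matrix.add_apply] at this
    have h5 : ((Γ a)ᵀ * g x) p q = (g x * Γ a) q p := by
      rw [← Matrix.transpose_apply (g x * Γ a), Matrix.transpose_mul, hgs]
    rw [h5] at this
    exact this
  have hL : ∀ a b d, (g x * Γ a) d b = (g x * Γ b) d a := by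
    intro a b d
    simp only [Matrix.mul_apply]
    exact Finset.sum_congr rfl fun c _ => by rw [hsymm a b c]
  rw [christoffel]
  -- Koszul's formula: the two properties determine the connection
  have hs : ∀ d, partialDeriv a (fun y => g y d b) x + partialDeriv b (fun y => g y d a) x
      - partialDeriv d (fun y => g y a b) x = 2 * (g x * Γ a) d b := by
    intro d
    rw [hent, hent, hent, hL b a d, hL d a b, hL d b a]
    ring
  simp only [hs]
  have : Γ a c b = ∑ d, (g x)⁻¹ c d * (g x * Γ a) d b := by
    rw [← Matrix.mul_apply, Matrix.nonsing_inv_mul_cancel_left _ _ hu]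
  change _ = Γ a c b
  rw [this, Finset.mul_sum]
  exact Finset.sum_congr rfl fun d _ => by ring

/-- Cartan's second structure equation: the Ricci tensor in coordinates, from the connection
matrices `Ω_a` in a moving frame. -/
theorem ricci_eq_of_frame (hU : IsOpen U) (hΘ : SmoothOn Θ U) (hΩ : ∀ a, SmoothOn (Ω a) U)
    (hdet : ∀ x ∈ U, (Θ x).det ≠ 0) (hD : Dᵀ = D) (hDdet : D.det ≠ 0)
    (hskew : ∀ a, ∀ x ∈ U, D * Ω a x + (Ω a x)ᵀ * D = 0)
    (htor : ∀ a b, ∀ x ∈ U, ∀ i, matPartial a Θ x i b + (Ω a x * Θ x) i b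
      = matPartial b Θ x i a + (Ω b x * Θ x) i a)
    {x : T → ℝ} (hx : x ∈ U) (a b : T) :
    ricci (fun y => (Θ y)ᵀ * D * Θ y) x a b
      = ∑ c, ((Θ x)⁻¹ * ((matPartial c (Ω b) x - matPartial b (Ω c) x
          + (Ω c x * Ω b x - Ω b x * Ω c x)) * Θ x)) c a := by
  set Γ := frameConnection Θ Ω with hΓ
  have hchr : ∀ c a b, ∀ y ∈ U,
      christoffel (fun y => (Θ y)ᵀ * D * Θ y) c a b y = Γ a y c b :=
    fun c a b y hy => christoffel_eq_frameConnection hU hΘ hdet hD hDdet hskew htor hy c a b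
  have hsym : ∀ a b c, ∀ y ∈ U, Γ a y c b = Γ b y c a := by
    intro a b c y hy
    simp only [hΓ, frameConnection, Matrix.mul_apply (M := (Θ y)⁻¹)]
    refine Finset.sum_congr rfl fun i _ => ?_
    rw [Matrix.add_apply, Matrix.add_apply, htor a b y hy i]
  have hΓs : ∀ a, SmoothOn (Γ a) U := fun a =>
    (hΘ.inv hdet).mul ((hΘ.matPartial hU a).add ((hΩ a).mul hΘ))
  have hΘΓ : ∀ a, ∀ y ∈ U, Θ y * Γ a y = matPartial a Θ y + Ω a y * Θ y :=
    fun a y hy => mul_frameConnection (hdet y hy) a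
  have hder : ∀ c b, matPartial c Θ x * Γ b x + Θ x * matPartial c (Γ b) x
      = matPartial c (matPartial b Θ) x
        + (matPartial c (Ω b) x * Θ x + Ω b x * matPartial c Θ x) := by
    intro c b
    rw [← matPartial_mul hU hΘ (hΓs b) hx, matPartial_congr hU (hΘΓ b) hx,
      matPartial_add hU (hΘ.matPartial hU b) ((hΩ b).mul hΘ) hx,
      matPartial_mul hU (hΩ b) hΘ hx]
  -- the gauge transformation by `Θ` conjugates the curvature, as second derivatives of `Θ` commute
  have hcurv : ∀ c b, Θ x * (matPartial c (Γ b) x - matPartial b (Γ c) x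
      + (Γ c x * Γ b x - Γ b x * Γ c x))
      = (matPartial c (Ω b) x - matPartial b (Ω c) x
          + (Ω c x * Ω b x - Ω b x * Ω c x)) * Θ x := by
    intro c b
    have e1 := hder c b
    have e2 := hder b c
    rw [matPartial_comm hU hΘ hx b c] at e2
    have f1 : matPartial c Θ x = Θ x * Γ c x - Ω c x * Θ x := by rw [hΘΓ c x hx]; abel
    have f2 : matPartial b Θ x = Θ x * Γ b x - Ω b x * Θ x := by rw [hΘΓ b x hx]; abel
    have e3 : Θ x * matPartial c (Γ b) x - Θ x * matPartial b (Γ c) x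
        = matPartial c (Ω b) x * Θ x + Ω b x * matPartial c Θ x - matPartial c Θ x * Γ b x
          - (matPartial b (Ω c) x * Θ x + Ω c x * matPartial b Θ x - matPartial b Θ x * Γ c x) := by
      rw [← sub_eq_zero] at e1 e2 ⊢
      have : (0 : Matrix T T ℝ) = 0 - 0 := by simp
      rw [this]
      nth_rewrite 1 [← e1]
      rw [← e2]
      abel
    rw [Matrix.mul_add, Matrix.mul_sub, e3, f1, f2]
    simp only [Matrix.mul_sub, Matrix.sub_mul, Matrix.add_mul, Matrix.mul_assoc]
    abel
  have hR : ∀ c b, (Θ x)⁻¹ * ((matPartial c (Ω b) x - matPartial b (Ω c) x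
          + (Ω c x * Ω b x - Ω b x * Ω c x)) * Θ x)
      = matPartial c (Γ b) x - matPartial b (Γ c) x + (Γ c x * Γ b x - Γ b x * Γ c x) := by
    intro c b
    rw [← hcurv, Matrix.nonsing_inv_mul_cancel_left _ _ (Ne.isUnit (hdet x hx))]
  rw [ricci, Matrix.of_apply]
  refine Finset.sum_congr rfl fun c _ => ?_
  have h1 : partialDeriv c (christoffel (fun y => (Θ y)ᵀ * D * Θ y) c a b) x
      = partialDeriv c (fun y => Γ b y c a) x :=
    partialDeriv_congr hU (fun y hy => by rw [hchr c a b y hy, hsym a b c y hy]) hx c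
  have h2 : partialDeriv b (christoffel (fun y => (Θ y)ᵀ * D * Θ y) c a c) x
      = partialDeriv b (fun y => Γ c y c a) x :=
    partialDeriv_congr hU (fun y hy => by rw [hchr c a c y hy, hsym a c c y hy]) hx b
  rw [hR, h1, h2]
  simp only [Matrix.add_apply, Matrix.sub_apply, Matrix.mul_apply, matPartial, Matrix.of_apply]
  rw [← Finset.sum_sub_distrib]
  refine congrArg₂ _ rfl (Finset.sum_congr rfl fun d _ => ?_)
  rw [hchr c c d x hx, hchr d a b x hx, hchr c b d x hx, hchr d a c x hx, hsym a b d x hx,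
    hsym a c d x hx]

end Frame

end LocalRiemannian

/-! ### The Levi-Civita connection on the isotropy module -/

namespace BlockMatrix

open scoped Matrix

attribute [local instance] LieRing.ofAssociativeRing

variable {ι κ : Type} [Fintype ι] [DecidableEq ι] [DecidableEq κ] (β : ι → κ) (x : κ → κ → ℝ)

/-- Multiplication of the block `(r, s)` of a matrix by the scalar `W r s`. -/
def blockScale (W : κ → κ → ℝ) : Matrix ι ι ℝ →ₗ[ℝ] Matrix ι ι ℝ where
  toFun M := Matrix.of fun i j => W (β i) (β j) * M i j
  map_add' M P := by ext i j; simp [mul_add]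
  map_smul' c M := by ext i j; simp; ring

@[simp] theorem blockScale_apply (W : κ → κ → ℝ) (M : Matrix ι ι ℝ) (i j : ι) :
    blockScale β W M i j = W (β i) (β j) * M i j := rfl

/-- The diagonal blocks of the matrix vanish. -/
def IsOffDiag (M : Matrix ι ι ℝ) : Prop := ∀ i j, β i = β j → M i j = 0

/-- The off-diagonal blocks of the matrix vanish. -/
def IsBlockDiag (M : Matrix ι ι ℝ) : Prop := ∀ i j, β i ≠ β j → M i j = 0

/-- The off-diagonal part of a matrix. -/
def offPart : Matrix ι ι ℝ →ₗ[ℝ] Matrix ι ι ℝ := blockScale β fun r s => if r = s then 0 else 1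

theorem offPart_apply (M : Matrix ι ι ℝ) (i j : ι) :
    offPart β M i j = if β i = β j then 0 else M i j := by
  simp [offPart]

theorem isOffDiag_offPart (M : Matrix ι ι ℝ) : IsOffDiag β (offPart β M) := by
  intro i j h; simp [offPart_apply, h]

theorem isBlockDiag_sub_offPart (M : Matrix ι ι ℝ) : IsBlockDiag β (M - offPart β M) := by
  intro i j h; simp [offPart_apply, h]

variable {β} in
theorem IsOffDiag.offPart_eq {M : Matrix ι ι ℝ} (h : IsOffDiag β M) : offPart β M = M := by
  ext i j
  rw [offPart_apply]
  split_ifs with hij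
  · exact (h i j hij).symm
  · rfl

variable {β} in
/-- Scaling the blocks commutes with the isotropy action. -/
theorem IsBlockDiag.lie_blockScale {h : Matrix ι ι ℝ} (hh : IsBlockDiag β h) (W : κ → κ → ℝ)
    (M : Matrix ι ι ℝ) : ⁅h, blockScale β W M⁆ = blockScale β W ⁅h, M⁆ := by
  ext i j
  simp only [Ring.lie_def, Matrix.sub_apply, Matrix.mul_apply, blockScale_apply]
  rw [mul_sub, Finset.mul_sum, Finset.mul_sum]
  congr 1
  · refine Finset.sum_congr rfl fun q _ => ?_
    by_cases hq : β i = β q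
    · rw [hq]; ring
    · rw [hh i q hq]; ring
  · refine Finset.sum_congr rfl fun q _ => ?_
    by_cases hq : β q = β j
    · rw [hq]; ring
    · rw [hh q j hq]; ring

/-- The coefficients `(x_rs + x_qs - x_rq) / (2 x_rs)` of the Levi-Civita connection, for `r ≠ s`,
where the block `(r, s)` of the metric is scaled by `x_rs`. With the convention `x_rr = 0` they
also account for the isotropy action. -/
noncomputable def leviCivitaCoeff (r q s : κ) : ℝ :=
  if r = s then 0 else (x r s + x q s - x r q) / (2 * x r s)

/-- The operator `w ↦ [A_𝔥, w] + Λ(A_𝔭) w`, where `Λ` is the Levi-Civita connection of the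
invariant metric whose block `(r, s)` is scaled by `x r s`, written through Koszul's formula as
`½ S⁻¹ (S [A, w] + [A, S w] - [S A, w])`, where `S` is the scaling by `x`. -/
noncomputable def leviCivita : Matrix ι ι ℝ →ₗ[ℝ] Matrix ι ι ℝ →ₗ[ℝ] Matrix ι ι ℝ :=
  LinearMap.mk₂ ℝ
    (fun A w => blockScale β (fun r s => if r = s then 0 else (2 * x r s)⁻¹)
      (blockScale β x ⁅A, w⁆ + ⁅A, blockScale β x w⁆ - ⁅blockScale β x A, w⁆))
    (fun A A' w => by simp only [map_add, map_sub, add_lie]; abel)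
    (fun c A w => by simp only [map_smul, smul_lie, map_add, map_sub, smul_sub, smul_add])
    (fun A w w' => by simp only [map_add, map_sub, lie_add]; abel)
    (fun c A w => by simp only [map_smul, lie_smul, map_add, map_sub, smul_sub, smul_add])

theorem leviCivita_def (A w : Matrix ι ι ℝ) : leviCivita β x A w
    = blockScale β (fun r s => if r = s then 0 else (2 * x r s)⁻¹)
      (blockScale β x ⁅A, w⁆ + ⁅A, blockScale β x w⁆ - ⁅blockScale β x A, w⁆) := rfl

theorem isOffDiag_leviCivita (A w : Matrix ι ι ℝ) : IsOffDiag β (leviCivita β x A w) := by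
  intro i j h; simp [leviCivita_def, h]

section

variable {x} (hsymm : ∀ r s, x r s = x s r)
include hsymm

theorem leviCivita_apply (A w : Matrix ι ι ℝ) (i j : ι) :
    leviCivita β x A w i j = ∑ q, (leviCivitaCoeff x (β i) (β q) (β j) * (A i q * w q j)
      - leviCivitaCoeff x (β j) (β q) (β i) * (w i q * A q j)) := by
  by_cases hij : β i = β j
  · rw [isOffDiag_leviCivita β x A w i j hij]
    simp [leviCivitaCoeff, hij]
  · have hji : β j ≠ β i := Ne.symm hij
    simp only [leviCivita_def, blockScale_apply, Matrix.add_apply, Matrix.sub_apply, Ring.lie_def,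
      Matrix.mul_apply, leviCivitaCoeff, hij, hji, if_false, ← Finset.sum_sub_distrib,
      ← Finset.sum_add_distrib, Finset.mul_sum]
    refine Finset.sum_congr rfl fun q _ => ?_
    rw [hsymm (β j) (β i), hsymm (β q) (β i), hsymm (β j) (β q)]
    ring

theorem transpose_leviCivita {A w : Matrix ι ι ℝ} (hA : Aᵀ = -A) (hw : wᵀ = -w) :
    (leviCivita β x A w)ᵀ = -leviCivita β x A w := by
  have eA : ∀ i j, A i j = - A j i := fun i j => by
    have := congrFun (congrFun hA j) i; simpa using this
  have ew : ∀ i j, w i j = - w j i := fun i j => by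
    have := congrFun (congrFun hw j) i; simpa using this
  ext i j
  rw [Matrix.transpose_apply, Matrix.neg_apply, leviCivita_apply β hsymm, leviCivita_apply β hsymm,
    ← Finset.sum_neg_distrib]
  refine Finset.sum_congr rfl fun q _ => ?_
  rw [eA j q, ew q i, ew j q, eA q i]
  ring

end

section

variable {x} (hsymm : ∀ r s, x r s = x s r) (hdiag : ∀ r, x r r = 0)
  (hne : ∀ r s, r ≠ s → x r s ≠ 0)
include hsymm hdiag hne

omit [Fintype ι] [DecidableEq ι] in
theorem leviCivitaCoeff_left {r s : κ} (h : r ≠ s) : leviCivitaCoeff x r r s = 1 := by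
  rw [leviCivitaCoeff, if_neg h, hdiag, sub_zero, ← two_mul, div_self]
  exact mul_ne_zero two_ne_zero (hne r s h)

omit [Fintype ι] [DecidableEq ι] in
/-- The symmetric part of the connection cancels in the torsion. -/
theorem leviCivitaCoeff_add {r s : κ} (h : r ≠ s) (q : κ) :
    leviCivitaCoeff x r q s + leviCivitaCoeff x s q r = 1 := by
  have h1 := hne r s h
  rw [leviCivitaCoeff, leviCivitaCoeff, if_neg h, if_neg h.symm, hsymm s r, hsymm q s, hsymm q r]
  field_simp
  ring

/-- The connection is torsion-free. -/
theorem leviCivita_sub (A B : Matrix ι ι ℝ) :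
    leviCivita β x A (offPart β B) - leviCivita β x B (offPart β A) = offPart β ⁅A, B⁆ := by
  ext i j
  by_cases hij : β i = β j
  · rw [Matrix.sub_apply, isOffDiag_leviCivita β x _ _ i j hij,
      isOffDiag_leviCivita β x _ _ i j hij, isOffDiag_offPart β _ i j hij, sub_zero]
  rw [Matrix.sub_apply, leviCivita_apply β hsymm, leviCivita_apply β hsymm]
  simp only [offPart_apply, hij, if_false, Ring.lie_def, Matrix.sub_apply, Matrix.mul_apply,
    ← Finset.sum_sub_distrib]
  refine Finset.sum_congr rfl fun q _ => ?_
  by_cases h1 : β i = β q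
  · have h2 : β q ≠ β j := fun h => hij (h1.trans h)
    have c1 := leviCivitaCoeff_left hsymm hdiag hne h2
    simp only [h1, h2, if_true, if_false, c1]
    ring
  · by_cases h2 : β q = β j
    · have h3 : β j ≠ β i := Ne.symm hij
      have c1 := leviCivitaCoeff_left hsymm hdiag hne h3
      simp only [h2, hij, if_true, if_false, c1]
      ring
    · have c1 := leviCivitaCoeff_add hsymm hdiag hne hij (β q)
      simp only [h1, h2, if_false]
      linear_combination (A i q * B q j - B i q * A q j) * c1

variable {β} in
/-- On the isotropy algebra the operator is the isotropy action: with `x_rr = 0` the scaling by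
`x` annihilates block diagonal matrices, and the other two terms of Koszul's formula agree. -/
theorem IsBlockDiag.leviCivita_eq {h w : Matrix ι ι ℝ} (hh : IsBlockDiag β h)
    (hw : IsOffDiag β w) : leviCivita β x h w = ⁅h, w⁆ := by
  have h1 : blockScale β x h = 0 := by
    ext i j
    by_cases hij : β i = β j
    · simp [hij, hdiag]
    · simp [hh i j hij]
  have h2 : ⁅h, w⁆ = offPart β ⁅h, w⁆ := by
    rw [offPart, ← hh.lie_blockScale]
    exact congrArg _ hw.offPart_eq.symm
  rw [leviCivita_def, h1, hh.lie_blockScale, zero_lie, sub_zero]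
  conv_rhs => rw [h2]
  ext i j
  by_cases hij : β i = β j
  · simp [hij, offPart_apply]
  · have := hne _ _ hij
    simp only [blockScale_apply, Matrix.add_apply, offPart_apply, hij, if_false]
    field_simp
    ring

variable {β} in
omit hsymm hdiag hne in
/-- The connection is invariant under the isotropy algebra, which acts by derivations. -/
theorem IsBlockDiag.lie_leviCivita {h : Matrix ι ι ℝ} (hh : IsBlockDiag β h)
    (A w : Matrix ι ι ℝ) :
    ⁅h, leviCivita β x A w⁆ = leviCivita β x ⁅h, A⁆ w + leviCivita β x A ⁅h, w⁆ := by
  rw [leviCivita_def, leviCivita_def, leviCivita_def, hh.lie_blockScale, ← map_add]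
  congr 1
  rw [← hh.lie_blockScale x A, ← hh.lie_blockScale x w, lie_sub, lie_add, hh.lie_blockScale x ⁅A, w⁆,
    leibniz_lie h A w, leibniz_lie h A, leibniz_lie h (blockScale β x A), map_add]
  abel

end

/-- The curvature operator `[Ψ A, Ψ B] - Ψ [A, B]` of the connection `Ψ = leviCivita`. -/
noncomputable def curvature (A B w : Matrix ι ι ℝ) : Matrix ι ι ℝ :=
  leviCivita β x A (leviCivita β x B w) - leviCivita β x B (leviCivita β x A w)
    - leviCivita β x ⁅A, B⁆ w

theorem curvature_add_left (A A' B w : Matrix ι ι ℝ) :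
    curvature β x (A + A') B w = curvature β x A B w + curvature β x A' B w := by
  simp only [curvature, map_add, add_lie, LinearMap.add_apply]
  abel

theorem curvature_smul_left (c : ℝ) (A B w : Matrix ι ι ℝ) :
    curvature β x (c • A) B w = c • curvature β x A B w := by
  simp only [curvature, map_smul, smul_lie, LinearMap.smul_apply, smul_sub]

theorem curvature_swap (A B w : Matrix ι ι ℝ) :
    curvature β x A B w = - curvature β x B A w := by
  simp only [curvature]
  rw [← lie_skew A B, map_neg, LinearMap.neg_apply]
  abel

section

variable {x} (hsymm : ∀ r s, x r s = x s r) (hdiag : ∀ r, x r r = 0)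
  (hne : ∀ r s, r ≠ s → x r s ≠ 0)
include hsymm hdiag hne

/-- The curvature vanishes in the direction of the isotropy algebra, since the connection is
invariant under it. -/
theorem curvature_of_isBlockDiag {h : Matrix ι ι ℝ} (hh : IsBlockDiag β h) (B : Matrix ι ι ℝ)
    {w : Matrix ι ι ℝ} (hw : IsOffDiag β w) : curvature β x h B w = 0 := by
  rw [curvature, hh.leviCivita_eq hsymm hdiag hne (isOffDiag_leviCivita β x B w),
    hh.leviCivita_eq hsymm hdiag hne hw, hh.lie_leviCivita]
  abel

/-- The curvature depends only on the components of its arguments in the isotropy module. -/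
theorem curvature_offPart (A B : Matrix ι ι ℝ) {w : Matrix ι ι ℝ} (hw : IsOffDiag β w) :
    curvature β x A B w = curvature β x (offPart β A) (offPart β B) w := by
  have key : ∀ A B, curvature β x A B w = curvature β x (offPart β A) B w := by
    intro A B
    have h := curvature_add_left β x (A - offPart β A) (offPart β A) B w
    rwa [sub_add_cancel, curvature_of_isBlockDiag β hsymm hdiag hne
      (isBlockDiag_sub_offPart β A) B hw, zero_add] at h
  rw [key, curvature_swap, key, curvature_swap, neg_neg]

end

end BlockMatrix

namespace BlockMatrix

open scoped Matrix

attribute [local instance] LieRing.ofAssociativeRing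

variable {ι κ : Type} [Fintype ι] [DecidableEq ι] [DecidableEq κ] (β : ι → κ) {x : κ → κ → ℝ}

/-! ### The Ricci tensor on the isotropy module -/

/-- The basic skew-symmetric matrices. -/
def skewUnit (i j : ι) : Matrix ι ι ℝ := Matrix.single i j 1 - Matrix.single j i 1

theorem skewUnit_apply (i j a b : ι) : skewUnit i j a b
    = (if i = a ∧ j = b then 1 else 0) - (if j = a ∧ i = b then (1 : ℝ) else 0) := by
  simp [skewUnit, Matrix.single_apply]

theorem skewUnit_mul_apply (i j a b : ι) (v : Matrix ι ι ℝ) : (skewUnit i j * v) a b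
    = (if a = i then v j b else 0) - (if a = j then v i b else 0) := by
  rw [skewUnit, Matrix.sub_mul, Matrix.sub_apply]
  simp only [Matrix.mul_apply, Matrix.single_apply]
  congr 1
  · rw [Finset.sum_eq_single j]
    · by_cases h : i = a
      · simp [h]
      · simp [h, Ne.symm h]
    · intro q _ hq; simp [Ne.symm hq]
    · simp
  · rw [Finset.sum_eq_single i]
    · by_cases h : j = a
      · simp [h]
      · simp [h, Ne.symm h]
    · intro q _ hq; simp [Ne.symm hq]
    · simp

theorem mul_skewUnit_apply (i j a b : ι) (v : Matrix ι ι ℝ) : (v * skewUnit i j) a b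
    = (if b = j then v a i else 0) - (if b = i then v a j else 0) := by
  rw [skewUnit, Matrix.mul_sub, Matrix.sub_apply]
  simp only [Matrix.mul_apply, Matrix.single_apply]
  congr 1
  · rw [Finset.sum_eq_single i]
    · by_cases h : j = b
      · simp [h]
      · simp [h, Ne.symm h]
    · intro q _ hq; simp [Ne.symm hq]
    · simp
  · rw [Finset.sum_eq_single j]
    · by_cases h : i = b
      · simp [h]
      · simp [h, Ne.symm h]
    · intro q _ hq; simp [Ne.symm hq]
    · simp

section

variable (hsymm : ∀ r s, x r s = x s r)
include hsymm

/-- The entry `(i, j)` as a difference of entries of matrix products, where the weights, which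
depend on `i` and `j`, are moved into the second argument. -/
theorem leviCivita_apply' (A w : Matrix ι ι ℝ) (i j : ι) :
    leviCivita β x A w i j
      = (A * Matrix.of fun q b => leviCivitaCoeff x (β i) (β q) (β j) * w q b) i j
        - ((Matrix.of fun a q => leviCivitaCoeff x (β j) (β q) (β i) * w a q) * A) i j := by
  rw [leviCivita_apply β hsymm, Finset.sum_sub_distrib, Matrix.mul_apply, Matrix.mul_apply]
  congr 1
  · exact Finset.sum_congr rfl fun q _ => by simp only [Matrix.of_apply]; ring
  · exact Finset.sum_congr rfl fun q _ => by simp only [Matrix.of_apply]; ring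

theorem leviCivita_skewUnit_left (i j a b : ι) (u : Matrix ι ι ℝ) :
    leviCivita β x (skewUnit i j) u a b
      = (if a = i then leviCivitaCoeff x (β a) (β j) (β b) * u j b else 0)
        - (if a = j then leviCivitaCoeff x (β a) (β i) (β b) * u i b else 0)
        - ((if b = j then leviCivitaCoeff x (β b) (β i) (β a) * u a i else 0)
        - (if b = i then leviCivitaCoeff x (β b) (β j) (β a) * u a j else 0)) := by
  rw [leviCivita_apply' β hsymm, skewUnit_mul_apply, mul_skewUnit_apply]
  rfl

theorem leviCivita_skewUnit_right (p q i j : ι) (A : Matrix ι ι ℝ) :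
    leviCivita β x A (skewUnit p q) i j
      = (if j = q then leviCivitaCoeff x (β i) (β p) (β j) * A i p else 0)
        - (if j = p then leviCivitaCoeff x (β i) (β q) (β j) * A i q else 0)
        - ((if i = p then leviCivitaCoeff x (β j) (β q) (β i) * A q j else 0)
        - (if i = q then leviCivitaCoeff x (β j) (β p) (β i) * A p j else 0)) := by
  have h1 := mul_skewUnit_apply p q i j
    (Matrix.of fun a r => leviCivitaCoeff x (β i) (β r) (β j) * A a r)
  have h2 := skewUnit_mul_apply p q i j
    (Matrix.of fun r b => leviCivitaCoeff x (β j) (β r) (β i) * A r b)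
  simp only [Matrix.of_apply] at h1 h2
  rw [← h1, ← h2, leviCivita_apply β hsymm, Finset.sum_sub_distrib, Matrix.mul_apply,
    Matrix.mul_apply]
  congr 1
  · exact Finset.sum_congr rfl fun q _ => by simp only [Matrix.of_apply]; ring
  · exact Finset.sum_congr rfl fun q _ => by simp only [Matrix.of_apply]; ring

end

section

variable (hsymm : ∀ r s, x r s = x s r) (hdiag : ∀ r, x r r = 0)
  (hne : ∀ r s, r ≠ s → x r s ≠ 0)
include hsymm hdiag hne

omit [Fintype ι] [DecidableEq ι] hsymm hdiag in
theorem mul_leviCivitaCoeff {r s : κ} (h : r ≠ s) (q : κ) :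
    x r s * leviCivitaCoeff x r q s = (x r s + x q s - x r q) / 2 := by
  have := hne r s h
  rw [leviCivitaCoeff, if_neg h]
  field_simp

/-- The connection is metric: in the basis of the matrices `skewUnit i j`, which is orthogonal with
norms `x (β i) (β j)`, the operator is skew-symmetric. -/
theorem leviCivita_skew {A : Matrix ι ι ℝ} (hA : Aᵀ = -A) {i j p q : ι} (hij : β i ≠ β j)
    (hpq : β p ≠ β q) :
    x (β i) (β j) * leviCivita β x A (skewUnit p q) i j
      + x (β p) (β q) * leviCivita β x A (skewUnit i j) p q = 0 := by
  have eA : ∀ i j, A i j = - A j i := fun i j => by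
    have := congrFun (congrFun hA j) i; simpa using this
  have hji := hij.symm
  have hqp := hpq.symm
  have m1 := fun t => mul_leviCivitaCoeff hne hij t
  have m2 := fun t => mul_leviCivitaCoeff hne hji t
  have m3 := fun t => mul_leviCivitaCoeff hne hpq t
  have m4 := fun t => mul_leviCivitaCoeff hne hqp t
  rw [hsymm (β j) (β i)] at m2
  rw [hsymm (β q) (β p)] at m4
  rw [leviCivita_skewUnit_right β hsymm, leviCivita_skewUnit_right β hsymm]
  simp only [mul_sub, mul_ite, mul_zero, ← mul_assoc, m1, m2, m3, m4]
  have hc : ∀ {a b : ι} (f : ℝ), (if a = b then f else 0) = if b = a then f else 0 := by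
    intro a b f; simp only [eq_comm]
  rw [hc (a := q) (b := j), hc (a := q) (b := i), hc (a := p) (b := i), hc (a := p) (b := j)]
  have t1 : (if j = q then (x (β i) (β j) + x (β p) (β j) - x (β i) (β p)) / 2 * A i p else 0)
      + (if j = q then (x (β p) (β q) + x (β i) (β q) - x (β p) (β i)) / 2 * A p i else 0) = 0 := by
    split_ifs with h
    · subst h; rw [eA p i, hsymm (β p) (β i)]; ring
    · ring
  have t2 : (if i = p then (x (β i) (β j) + x (β q) (β i) - x (β j) (β q)) / 2 * A q j else 0)
      + (if i = p then (x (β p) (β q) + x (β j) (β p) - x (β q) (β j)) / 2 * A j q else 0) = 0 := by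
    split_ifs with h
    · subst h; rw [eA j q, hsymm (β q) (β j), hsymm (β q) (β i), hsymm (β j) (β i)]; ring
    · ring
  have t3 : (if j = p then (x (β i) (β j) + x (β q) (β j) - x (β i) (β q)) / 2 * A i q else 0)
      - (if j = p then (x (β p) (β q) + x (β i) (β p) - x (β q) (β i)) / 2 * A i q else 0) = 0 := by
    split_ifs with h
    · subst h; rw [hsymm (β q) (β i), hsymm (β q) (β j)]; ring
    · ring
  have t4 : (if i = q then (x (β i) (β j) + x (β p) (β i) - x (β j) (β p)) / 2 * A p j else 0)
      - (if i = q then (x (β p) (β q) + x (β j) (β q) - x (β p) (β j)) / 2 * A p j else 0) = 0 := by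
    split_ifs with h
    · subst h; rw [hsymm (β p) (β j), hsymm (β j) (β i)]; ring
    · ring
  linear_combination t1 - t2 - t3 + t4

/-- The diagonal entries of the operator `w ↦ R(w, v) u` in the basis of the matrices
`skewUnit i j`. -/
theorem curvature_skewUnit_apply {u v : Matrix ι ι ℝ} (hu : IsOffDiag β u) (hv : IsOffDiag β v)
    {i j : ι} (hij : β i ≠ β j) :
    curvature β x (skewUnit i j) v u i j
      = ∑ q, (leviCivitaCoeff x (β i) (β q) (β j) * leviCivitaCoeff x (β j) (β i) (β q)
            * (v i q * u q i) - leviCivitaCoeff x (β j) (β q) (β i) * (u i q * v q i))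
        + ∑ q, (leviCivitaCoeff x (β j) (β q) (β i) * leviCivitaCoeff x (β i) (β j) (β q)
            * (u j q * v q j) - leviCivitaCoeff x (β i) (β q) (β j) * (v j q * u q j))
        - 2 * (v i j * u i j) := by
  have hne' : i ≠ j := fun h => hij (congrArg β h)
  have hne'' : j ≠ i := hne'.symm
  have hu0 : ∀ a, u a a = 0 := fun a => hu a a rfl
  have hv0 : ∀ a, v a a = 0 := fun a => hv a a rfl
  have hz := isOffDiag_leviCivita β x v u
  -- the three terms of the curvature operator
  have L1 : leviCivita β x (skewUnit i j) (leviCivita β x v u) i j = 0 := by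
    rw [leviCivita_skewUnit_left β hsymm]
    simp [hne', hne'', hz i i rfl, hz j j rfl]
  have L2 : leviCivita β x v (leviCivita β x (skewUnit i j) u) i j
      = -∑ q, leviCivitaCoeff x (β i) (β q) (β j) * leviCivitaCoeff x (β j) (β i) (β q)
            * (v i q * u q i)
        - ∑ q, leviCivitaCoeff x (β j) (β q) (β i) * leviCivitaCoeff x (β i) (β j) (β q)
            * (u j q * v q j) := by
    rw [leviCivita_apply β hsymm, ← Finset.sum_neg_distrib, ← Finset.sum_sub_distrib]
    refine Finset.sum_congr rfl fun q _ => ?_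
    have e1 : leviCivita β x (skewUnit i j) u q j
        = -(leviCivitaCoeff x (β j) (β i) (β q) * u q i) := by
      rw [leviCivita_skewUnit_left β hsymm]
      have z1 : (if q = j then leviCivitaCoeff x (β q) (β i) (β j) * u i j else 0) = 0 := by
        split_ifs with h
        · subst h; simp [leviCivitaCoeff]
        · rfl
      rw [z1]
      simp [hne'', hu0]
    have e2 : leviCivita β x (skewUnit i j) u i q
        = leviCivitaCoeff x (β i) (β j) (β q) * u j q := by
      rw [leviCivita_skewUnit_left β hsymm]
      have z1 : (if q = i then leviCivitaCoeff x (β q) (β j) (β i) * u i j else 0) = 0 := by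
        split_ifs with h
        · subst h; simp [leviCivitaCoeff]
        · rfl
      rw [z1]
      simp [hne', hu0]
    rw [e1, e2]
    ring
  have L3 : leviCivita β x ⁅skewUnit i j, v⁆ u i j
      = ∑ q, leviCivitaCoeff x (β i) (β q) (β j) * (v j q * u q j)
        + ∑ q, leviCivitaCoeff x (β j) (β q) (β i) * (u i q * v q i) + 2 * (v i j * u i j) := by
    have s1 : ∀ q, ⁅skewUnit i j, v⁆ i q = v j q + if q = i then v i j else 0 := by
      intro q
      rw [Ring.lie_def, Matrix.sub_apply, skewUnit_mul_apply, mul_skewUnit_apply]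
      simp [hne', hv0]
    have s2 : ∀ q, ⁅skewUnit i j, v⁆ q j = - v q i - if q = j then v i j else 0 := by
      intro q
      rw [Ring.lie_def, Matrix.sub_apply, skewUnit_mul_apply, mul_skewUnit_apply]
      simp [hne'', hv0]
      ring
    rw [leviCivita_apply β hsymm]
    have c1 := leviCivitaCoeff_left hsymm hdiag hne hij
    have c2 := leviCivitaCoeff_left hsymm hdiag hne hij.symm
    have d1 : ∑ q, (if q = i then leviCivitaCoeff x (β i) (β q) (β j) * (v i j * u q j) else 0)
        = v i j * u i j := by simp [c1]
    have d2 : ∑ q, (if q = j then leviCivitaCoeff x (β j) (β q) (β i) * (u i q * v i j) else 0)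
        = v i j * u i j := by simp [c2]; ring
    rw [two_mul]
    nth_rewrite 1 [← d1]
    rw [← d2, ← Finset.sum_add_distrib, ← Finset.sum_add_distrib, ← Finset.sum_add_distrib]
    refine Finset.sum_congr rfl fun q _ => ?_
    rw [s1, s2]
    split_ifs <;> ring
  rw [curvature, Matrix.sub_apply, Matrix.sub_apply, L1, L2, L3, Finset.sum_sub_distrib,
    Finset.sum_sub_distrib]
  ring

/-- Twice the trace of `w ↦ R(w, v) u` on the isotropy module, in terms of the entries of `u` and
`v`. The sum on the left runs over ordered pairs, so that it counts each `skewUnit i j` twice. -/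
theorem sum_curvature {u v : Matrix ι ι ℝ} (hu : IsOffDiag β u) (hv : IsOffDiag β v)
    (hut : uᵀ = -u) (hvt : vᵀ = -v) :
    ∑ i, ∑ j, (if β i = β j then 0 else curvature β x (skewUnit i j) v u i j)
      = 2 * ∑ i, ∑ q, (∑ j, (leviCivitaCoeff x (β j) (β q) (β i)
          - leviCivitaCoeff x (β i) (β q) (β j) * leviCivitaCoeff x (β j) (β i) (β q)) - 1)
          * (u i q * v i q) := by
  have eu : ∀ i j, u i j = - u j i := fun i j => by
    have := congrFun (congrFun hut j) i; simpa using this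
  have ev : ∀ i j, v i j = - v j i := fun i j => by
    have := congrFun (congrFun hvt j) i; simpa using this
  set f : ι → ι → ι → ℝ := fun i j q => (leviCivitaCoeff x (β j) (β q) (β i)
          - leviCivitaCoeff x (β i) (β q) (β j) * leviCivitaCoeff x (β j) (β i) (β q))
          * (u i q * v i q) with hf
  have step : ∀ i j, (if β i = β j then 0 else curvature β x (skewUnit i j) v u i j)
      = (∑ q, f i j q + ∑ q, f j i q) - 2 * (u i j * v i j) := by
    intro i j
    split_ifs with hij
    · simp [hf, leviCivitaCoeff, hij, hu i j hij]
    · rw [curvature_skewUnit_apply β hsymm hdiag hne hu hv hij]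
      congr 1
      · congr 1
        · refine Finset.sum_congr rfl fun q _ => ?_
          simp only [hf]
          rw [eu q i, ev q i]; ring
        · refine Finset.sum_congr rfl fun q _ => ?_
          simp only [hf]
          rw [eu q j, ev q j]; ring
      · ring
  have e1 : ∑ i, ∑ j, ∑ q, f j i q = ∑ i, ∑ j, ∑ q, f i j q := Finset.sum_comm
  have e2 : ∑ i, ∑ j, ∑ q, f i j q = ∑ i, ∑ q, ∑ j, f i j q :=
    Finset.sum_congr rfl fun i _ => Finset.sum_comm
  simp only [step, Finset.sum_sub_distrib, Finset.sum_add_distrib]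
  rw [e1, e2]
  simp only [hf, sub_mul, one_mul, Finset.sum_mul, Finset.sum_sub_distrib, mul_sub,
    ← Finset.mul_sum]
  ring

end

end BlockMatrix

namespace LocalRiemannian

open scoped Matrix ContDiff

variable {T : Type} [Fintype T] [DecidableEq T] {U : Set (T → ℝ)} {x : T → ℝ}
  {I J : Type} [Fintype I] [Fintype J] [DecidableEq I] [DecidableEq J]

/-! ### Linear functions of matrix-valued functions -/

theorem linearMap_matrix_apply (f : Matrix I J ℝ →ₗ[ℝ] ℝ) (M : Matrix I J ℝ) :
    f M = ∑ i, ∑ j, M i j * f (Matrix.single i j 1) := by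
  conv_lhs => rw [Matrix.matrix_eq_sum_single M]
  simp only [map_sum]
  refine Finset.sum_congr rfl fun i _ => Finset.sum_congr rfl fun j _ => ?_
  rw [← smul_eq_mul, ← map_smul, Matrix.smul_single, smul_eq_mul, mul_one]

theorem SmoothOn.linearMap_comp {M : (T → ℝ) → Matrix I J ℝ} (hM : SmoothOn M U)
    (f : Matrix I J ℝ →ₗ[ℝ] ℝ) : ContDiffOn ℝ ∞ (fun y => f (M y)) U := by
  rw [show (fun y => f (M y)) = fun y => ∑ i, ∑ j, M y i j * f (Matrix.single i j 1) from
    funext fun y => linearMap_matrix_apply f (M y)]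
  exact ContDiffOn.sum fun i _ => ContDiffOn.sum fun j _ => (hM i j).mul contDiffOn_const

theorem partialDeriv_linearMap_comp {M : (T → ℝ) → Matrix I J ℝ} (hU : IsOpen U)
    (hM : SmoothOn M U) (hx : x ∈ U) (f : Matrix I J ℝ →ₗ[ℝ] ℝ) (a : T) :
    partialDeriv a (fun y => f (M y)) x = f (matPartial a M x) := by
  have hd : ∀ i j, DifferentiableAt ℝ (fun y => M y i j) x :=
    fun i j => hM.differentiableAt hU hx i j
  rw [show (fun y => f (M y)) = fun y => ∑ i, ∑ j, M y i j * f (Matrix.single i j 1) from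
    funext fun y => linearMap_matrix_apply f (M y), linearMap_matrix_apply f (matPartial a M x)]
  have h1 : ∀ i j, partialDeriv a (fun y => M y i j * f (Matrix.single i j 1)) x
      = matPartial a M x i j * f (Matrix.single i j 1) := by
    intro i j
    rw [partialDeriv_mul (f := fun y => M y i j) (hd i j) (differentiableAt_const _),
      partialDeriv_const, mul_zero, add_zero]
    rfl
  have h2 : ∀ i j, DifferentiableAt ℝ (fun y => M y i j * f (Matrix.single i j 1)) x :=
    fun i j => (hd i j).mul (differentiableAt_const _)
  rw [partialDeriv_sum (f := fun i y => ∑ j, M y i j * f (Matrix.single i j 1)) Finset.univ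
    fun i _ => DifferentiableAt.fun_sum fun j _ => h2 i j]
  refine Finset.sum_congr rfl fun i _ => ?_
  rw [partialDeriv_sum (f := fun j y => M y i j * f (Matrix.single i j 1)) Finset.univ
    fun j _ => h2 i j]
  exact Finset.sum_congr rfl fun j _ => h1 i j

end LocalRiemannian

namespace WallachSO

open scoped Matrix ContDiff
open BlockMatrix LocalRiemannian

attribute [local instance] LieRing.ofAssociativeRing

variable {k l m : ℕ}

/-! ### Coordinates on the isotropy module -/

/-- The row of the matrix entry that is the given coordinate on `𝔭`. -/
def row : Coord k l m → Idx k l m :=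
  Sum.elim (fun p => Sum.inl p.1)
    (Sum.elim (fun p => Sum.inl p.1) (fun p => Sum.inr (Sum.inl p.1)))

/-- The column of the matrix entry that is the given coordinate on `𝔭`. -/
def col : Coord k l m → Idx k l m :=
  Sum.elim (fun p => Sum.inr (Sum.inl p.2))
    (Sum.elim (fun p => Sum.inr (Sum.inr p.2)) (fun p => Sum.inr (Sum.inr p.2)))

theorem blk_row_ne_blk_col (t : Coord k l m) : blk (row t) ≠ blk (col t) := by
  rcases t with t | t | t <;> simp [row, col, blk]

theorem skewUnit_row_col (s t : Coord k l m) :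
    skewUnit (row s) (col s) (row t) (col t) = if s = t then 1 else 0 := by
  rcases s with ⟨i, j⟩ | ⟨i, j⟩ | ⟨i, j⟩ <;> rcases t with ⟨i', j'⟩ | ⟨i', j'⟩ | ⟨i', j'⟩ <;>
    simp [skewUnit_apply, row, col]

/-- A sum over the entries outside the diagonal blocks counts each coordinate of `𝔭` in both orders
of its indices. -/
theorem sum_offDiag (f : Idx k l m → Idx k l m → ℝ) :
    ∑ i, ∑ j, (if blk i = blk j then 0 else f i j)
      = ∑ t : Coord k l m, (f (row t) (col t) + f (col t) (row t)) := by
  simp only [Fintype.sum_sum_type, Fintype.sum_prod_type, blk, row, col, Sum.elim_inl,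
    Sum.elim_inr, if_true, Finset.sum_const_zero, Finset.sum_add_distrib]
  simp only [show (0 : Fin 3) ≠ 1 by decide, show (0 : Fin 3) ≠ 2 by decide,
    show (1 : Fin 3) ≠ 0 by decide, show (1 : Fin 3) ≠ 2 by decide,
    show (2 : Fin 3) ≠ 0 by decide, show (2 : Fin 3) ≠ 1 by decide, if_false]
  rw [Finset.sum_comm (s := (Finset.univ : Finset (Fin l))) (t := (Finset.univ : Finset (Fin k))),
    Finset.sum_comm (s := (Finset.univ : Finset (Fin m))) (t := (Finset.univ : Finset (Fin k))),
    Finset.sum_comm (s := (Finset.univ : Finset (Fin m))) (t := (Finset.univ : Finset (Fin l)))]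
  ring

theorem eq_of_coord_eq {X Y : Mat k l m} (hX : X ∈ 𝔭 k l m) (hY : Y ∈ 𝔭 k l m)
    (h : ∀ t, X (row t) (col t) = Y (row t) (col t)) : X = Y := by
  have eX : ∀ i j, X i j = - X j i := fun i j => by
    have := congrFun (congrFun hX.1 j) i; simpa using this
  have eY : ∀ i j, Y i j = - Y j i := fun i j => by
    have := congrFun (congrFun hY.1 j) i; simpa using this
  have h01 : ∀ i a, X (Sum.inl i) (Sum.inr (Sum.inl a)) = Y (Sum.inl i) (Sum.inr (Sum.inl a)) :=
    fun i a => h (Sum.inl (i, a))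
  have h02 : ∀ i a, X (Sum.inl i) (Sum.inr (Sum.inr a)) = Y (Sum.inl i) (Sum.inr (Sum.inr a)) :=
    fun i a => h (Sum.inr (Sum.inl (i, a)))
  have h12 : ∀ i a, X (Sum.inr (Sum.inl i)) (Sum.inr (Sum.inr a))
      = Y (Sum.inr (Sum.inl i)) (Sum.inr (Sum.inr a)) :=
    fun i a => h (Sum.inr (Sum.inr (i, a)))
  ext i j
  by_cases hij : blk i = blk j
  · rw [hX.2 i j hij, hY.2 i j hij]
  · rcases i with i | i | i <;> rcases j with j | j | j
    · exact absurd rfl hij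
    · exact h01 i j
    · exact h02 i j
    · rw [eX, eY, h01]
    · exact absurd rfl hij
    · exact h12 i j
    · rw [eX, eY, h02]
    · rw [eX, eY, h12]
    · exact absurd rfl hij

theorem skewUnit_mem {i j : Idx k l m} (h : blk i ≠ blk j) : skewUnit i j ∈ 𝔭 k l m := by
  refine ⟨?_, fun a b hab => ?_⟩
  · ext a b
    rw [Matrix.transpose_apply, Matrix.neg_apply, skewUnit_apply, skewUnit_apply, neg_sub]
    simp only [and_comm]
  · have h1 : ¬ (i = a ∧ j = b) := by rintro ⟨rfl, rfl⟩; exact h hab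
    have h2 : ¬ (j = a ∧ i = b) := by rintro ⟨rfl, rfl⟩; exact h hab.symm
    rw [skewUnit_apply, if_neg h1, if_neg h2, sub_zero]

/-- The coordinate basis of `𝔭`. -/
def basisVec (t : Coord k l m) : 𝔭 k l m :=
  ⟨skewUnit (row t) (col t), skewUnit_mem (blk_row_ne_blk_col t)⟩

theorem sum_coord_smul {X : Mat k l m} (hX : X ∈ 𝔭 k l m) :
    ∑ t, X (row t) (col t) • skewUnit (row t) (col t) = X := by
  refine eq_of_coord_eq (Submodule.sum_mem _ fun t _ =>
    Submodule.smul_mem _ _ (basisVec t).2) hX fun s => ?_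
  rw [Matrix.sum_apply]
  simp [skewUnit_row_col]

theorem sum_coord_smul_basisVec (X : 𝔭 k l m) :
    ∑ t, (X : Mat k l m) (row t) (col t) • basisVec t = X := by
  apply Subtype.ext
  rw [Submodule.coe_sum]
  exact sum_coord_smul X.2

/-- The bilinear form on `𝔭` that is diagonal in the coordinates, with the given coefficients. -/
noncomputable def diagForm (d : Coord k l m → ℝ) : LinearMap.BilinForm ℝ (𝔭 k l m) :=
  LinearMap.mk₂ ℝ
    (fun X Y => ∑ t, d t * ((X : Mat k l m) (row t) (col t) * (Y : Mat k l m) (row t) (col t)))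
    (fun X X' Y => by
      rw [← Finset.sum_add_distrib]
      exact Finset.sum_congr rfl fun t _ => by
        rw [Submodule.coe_add, Matrix.add_apply]; ring)
    (fun c X Y => by
      rw [smul_eq_mul, Finset.mul_sum]
      exact Finset.sum_congr rfl fun t _ => by
        rw [Submodule.coe_smul, Matrix.smul_apply, smul_eq_mul]; ring)
    (fun X Y Y' => by
      rw [← Finset.sum_add_distrib]
      exact Finset.sum_congr rfl fun t _ => by
        rw [Submodule.coe_add, Matrix.add_apply]; ring)
    (fun c X Y => by
      rw [smul_eq_mul, Finset.mul_sum]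
      exact Finset.sum_congr rfl fun t _ => by
        rw [Submodule.coe_smul, Matrix.smul_apply, smul_eq_mul]; ring)

theorem diagForm_apply (d : Coord k l m → ℝ) (X Y : 𝔭 k l m) : diagForm d X Y
    = ∑ t, d t * ((X : Mat k l m) (row t) (col t) * (Y : Mat k l m) (row t) (col t)) := rfl

/-! ### The coframe of a local parametrization -/

section Frame

variable {U : Set (Coord k l m → ℝ)} {φ : (Coord k l m → ℝ) → Mat k l m}

/-- The pullback `φ⁻¹ dφ` of the Maurer–Cartan form, evaluated on a coordinate vector field. -/
noncomputable def maurerCartan (φ : (Coord k l m → ℝ) → Mat k l m) (a : Coord k l m)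
    (y : Coord k l m → ℝ) : Mat k l m :=
  (φ y)ᵀ * matPartial a φ y

/-- The matrix of the coframe `y ↦ cosetDeriv φ y` in the coordinates on `𝔭`. -/
noncomputable def coframe (φ : (Coord k l m → ℝ) → Mat k l m) (y : Coord k l m → ℝ) :
    Matrix (Coord k l m) (Coord k l m) ℝ :=
  Matrix.of fun t a => (cosetDeriv φ y (Pi.single a 1) : Mat k l m) (row t) (col t)

theorem coframe_apply (y : Coord k l m → ℝ) (t a : Coord k l m) :
    coframe φ y t a
      = (maurerCartan φ a y (row t) (col t) - maurerCartan φ a y (col t) (row t)) / 2 := by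
  have : coframe φ y t a = if blk (row t) = blk (col t) then 0 else
      (maurerCartan φ a y (row t) (col t) - maurerCartan φ a y (col t) (row t)) / 2 := rfl
  rw [this, if_neg (blk_row_ne_blk_col t)]

theorem matDeriv_eq_sum (x v : Coord k l m → ℝ) :
    matDeriv φ x v = ∑ a, v a • matPartial a φ x := by
  ext i j
  rw [Matrix.sum_apply]
  simp only [matDeriv, Matrix.of_apply, Matrix.smul_apply, matPartial, smul_eq_mul, partialDeriv]
  have h := LinearMap.pi_apply_eq_sum_univ
    ((fderiv ℝ (fun y => φ y i j) x) : (Coord k l m → ℝ) →ₗ[ℝ] ℝ) v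
  simp only [ContinuousLinearMap.coe_coe, smul_eq_mul] at h
  rw [h]
  refine Finset.sum_congr rfl fun a _ => ?_
  congr 2
  funext b
  simp only [Pi.single_apply, eq_comm]

theorem cosetDeriv_eq_sum (x v : Coord k l m → ℝ) :
    cosetDeriv φ x v = ∑ a, v a • cosetDeriv φ x (Pi.single a 1) := by
  have h : ∀ a, matDeriv φ x (Pi.single a 1) = matPartial a φ x := fun a => rfl
  simp only [cosetDeriv, h]
  rw [matDeriv_eq_sum, Finset.mul_sum, map_sum]
  refine Finset.sum_congr rfl fun a _ => ?_
  rw [Matrix.mul_smul, map_smul]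

theorem coframe_mulVec (x v : Coord k l m → ℝ) (t : Coord k l m) :
    (coframe φ x *ᵥ v) t = (cosetDeriv φ x v : Mat k l m) (row t) (col t) := by
  rw [cosetDeriv_eq_sum, Submodule.coe_sum, Matrix.sum_apply, Matrix.mulVec, dotProduct]
  refine Finset.sum_congr rfl fun a _ => ?_
  rw [Submodule.coe_smul, Matrix.smul_apply, smul_eq_mul, mul_comm]
  rfl

/-- A parametrization is a local diffeomorphism to `G/H` where its coframe is invertible. -/
theorem bijective_cosetDeriv_iff (x : Coord k l m → ℝ) :
    Function.Bijective (cosetDeriv φ x) ↔ (coframe φ x).det ≠ 0 := by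
  rw [← isUnit_iff_ne_zero, ← Matrix.isUnit_iff_isUnit_det]
  constructor
  · intro h
    rw [← Matrix.mulVec_injective_iff_isUnit]
    intro v w hvw
    apply h.1
    apply Subtype.ext
    refine eq_of_coord_eq (Subtype.mem _) (Subtype.mem _) fun t => ?_
    rw [← coframe_mulVec, ← coframe_mulVec]
    exact congrFun hvw t
  · intro h
    refine ⟨fun v w hvw => Matrix.mulVec_injective_iff_isUnit.mpr h ?_, fun X => ?_⟩
    · funext t
      rw [coframe_mulVec, coframe_mulVec, hvw]
    · obtain ⟨v, hv⟩ := Matrix.mulVec_surjective_iff_isUnit.mpr h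
        (fun t => (X : Mat k l m) (row t) (col t))
      refine ⟨v, Subtype.ext (eq_of_coord_eq (Subtype.mem _) X.2 fun t => ?_)⟩
      rw [← coframe_mulVec, hv]

/-- In the moving frame given by the coframe, the local metric is constant. -/
theorem localMetric_diagForm (d : Coord k l m → ℝ) :
    localMetric (diagForm d) φ
      = fun y => (coframe φ y)ᵀ * Matrix.diagonal d * coframe φ y := by
  funext y
  ext a b
  rw [Matrix.mul_assoc, Matrix.mul_apply]
  simp only [localMetric, Matrix.of_apply, diagForm_apply, Matrix.transpose_apply,
    Matrix.diagonal_mul]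
  refine Finset.sum_congr rfl fun t _ => ?_
  simp only [coframe, Matrix.of_apply]
  ring

theorem smoothOn_maurerCartan (hU : IsOpen U) (hs : SmoothOn φ U) (a : Coord k l m) :
    SmoothOn (maurerCartan φ a) U :=
  hs.transpose.mul (hs.matPartial hU a)

theorem smoothOn_coframe (hU : IsOpen U) (hs : SmoothOn φ U) : SmoothOn (coframe φ) U := by
  intro t a
  simp only [coframe_apply]
  exact ((smoothOn_maurerCartan hU hs a _ _).sub (smoothOn_maurerCartan hU hs a _ _)).div_const 2

section Parametrization

variable (hφ : IsLocalParametrization U φ)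
include hφ

theorem IsLocalParametrization.smoothOn : SmoothOn φ U := hφ.smooth

theorem IsLocalParametrization.smoothOn_maurerCartan (a : Coord k l m) :
    SmoothOn (maurerCartan φ a) U :=
  WallachSO.smoothOn_maurerCartan hφ.isOpen hφ.smoothOn a

theorem IsLocalParametrization.transpose_mul_self {y : Coord k l m → ℝ} (hy : y ∈ U) :
    (φ y)ᵀ * φ y = 1 := by
  have h := (Matrix.mem_specialOrthogonalGroup_iff.mp (hφ.mem y hy)).1
  exact Matrix.mem_unitaryGroup_iff'.mp h

theorem IsLocalParametrization.transpose_maurerCartan {y : Coord k l m → ℝ} (hy : y ∈ U)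
    (a : Coord k l m) : (maurerCartan φ a y)ᵀ = -maurerCartan φ a y := by
  have h : matPartial a (fun z => (φ z)ᵀ * φ z) y = 0 := by
    rw [matPartial_congr hφ.isOpen (P := fun _ => 1) (fun z hz => hφ.transpose_mul_self hz) hy,
      matPartial_const]
  rw [matPartial_mul hφ.isOpen hφ.smoothOn.transpose hφ.smoothOn hy, matPartial_transpose] at h
  rw [maurerCartan, Matrix.transpose_mul, Matrix.transpose_transpose]
  exact eq_neg_of_add_eq_zero_left h

/-- The Maurer–Cartan equation `dω = -[ω, ω]` for `ω = φ⁻¹ dφ`. -/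
theorem IsLocalParametrization.matPartial_maurerCartan {y : Coord k l m → ℝ} (hy : y ∈ U)
    (a b : Coord k l m) :
    matPartial a (maurerCartan φ b) y - matPartial b (maurerCartan φ a) y
      = -⁅maurerCartan φ a y, maurerCartan φ b y⁆ := by
  have hu := hφ.transpose_mul_self hy
  have hu' : φ y * (φ y)ᵀ = 1 := mul_eq_one_comm.mp hu
  have e : ∀ a, matPartial a φ y = φ y * maurerCartan φ a y := by
    intro a
    rw [maurerCartan, ← Matrix.mul_assoc, hu', Matrix.one_mul]
  have d : ∀ a b, matPartial a (maurerCartan φ b) y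
      = - (maurerCartan φ a y * maurerCartan φ b y)
        + (φ y)ᵀ * matPartial a (matPartial b φ) y := by
    intro a b
    have : matPartial a (maurerCartan φ b) y
        = matPartial a (fun z => (φ z)ᵀ * matPartial b φ z) y := rfl
    rw [this, matPartial_mul hφ.isOpen hφ.smoothOn.transpose (hφ.smoothOn.matPartial hφ.isOpen b)
      hy, matPartial_transpose, e a, e b, Matrix.transpose_mul, hφ.transpose_maurerCartan hy,
      ← Matrix.mul_assoc, Matrix.mul_assoc _ (φ y)ᵀ, hu, Matrix.mul_one, Matrix.neg_mul]
  rw [d, d, matPartial_comm hφ.isOpen hφ.smoothOn hy a b, Ring.lie_def]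
  abel

theorem IsLocalParametrization.coframe_eq {y : Coord k l m → ℝ} (hy : y ∈ U)
    (t a : Coord k l m) : coframe φ y t a = maurerCartan φ a y (row t) (col t) := by
  have h := congrFun (congrFun (hφ.transpose_maurerCartan hy a) (row t)) (col t)
  rw [Matrix.transpose_apply, Matrix.neg_apply] at h
  rw [coframe_apply, h]
  ring

theorem IsLocalParametrization.smoothOn_coframe : SmoothOn (coframe φ) U :=
  WallachSO.smoothOn_coframe hφ.isOpen hφ.smoothOn

theorem IsLocalParametrization.offPart_mem {y : Coord k l m → ℝ} (hy : y ∈ U)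
    (a : Coord k l m) : offPart blk (maurerCartan φ a y) ∈ 𝔭 k l m := by
  refine ⟨?_, isOffDiag_offPart _ _⟩
  ext i j
  have h := congrFun (congrFun (hφ.transpose_maurerCartan hy a) i) j
  rw [Matrix.transpose_apply, Matrix.neg_apply] at h
  rw [Matrix.transpose_apply, Matrix.neg_apply, offPart_apply, offPart_apply, h]
  by_cases hij : blk i = blk j
  · simp [hij]
  · simp [hij, Ne.symm hij]

theorem IsLocalParametrization.sum_coframe_smul {y : Coord k l m → ℝ} (hy : y ∈ U)
    (a : Coord k l m) :
    ∑ t, coframe φ y t a • skewUnit (row t) (col t) = offPart blk (maurerCartan φ a y) := by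
  rw [← sum_coord_smul (hφ.offPart_mem hy a)]
  refine Finset.sum_congr rfl fun t _ => ?_
  rw [hφ.coframe_eq hy, offPart_apply, if_neg (blk_row_ne_blk_col t)]

end Parametrization

end Frame

end WallachSO

namespace WallachSO

open scoped Matrix ContDiff
open BlockMatrix LocalRiemannian

attribute [local instance] LieRing.ofAssociativeRing

variable {k l m : ℕ}

/-! ### The Ricci tensor of a diagonal invariant metric -/

section Operators

/-- The matrix of a linear operator in the coordinates on `𝔭`. The operator is defined on all
matrices; only the values on `𝔭`, and of these only the coordinate entries, are used. -/
def opMatrix (L : Mat k l m →ₗ[ℝ] Mat k l m) : Matrix (Coord k l m) (Coord k l m) ℝ :=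
  Matrix.of fun t s => L (skewUnit (row s) (col s)) (row t) (col t)

theorem opMatrix_apply (L : Mat k l m →ₗ[ℝ] Mat k l m) (t s : Coord k l m) :
    opMatrix L t s = L (skewUnit (row s) (col s)) (row t) (col t) := rfl

theorem sum_opMatrix_mul (L : Mat k l m →ₗ[ℝ] Mat k l m) {w : Mat k l m} (hw : w ∈ 𝔭 k l m)
    (t : Coord k l m) :
    ∑ s, opMatrix L t s * w (row s) (col s) = L w (row t) (col t) := by
  conv_rhs => rw [← sum_coord_smul hw]
  rw [map_sum, Matrix.sum_apply]
  refine Finset.sum_congr rfl fun s _ => ?_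
  rw [map_smul, Matrix.smul_apply, smul_eq_mul, mul_comm]
  rfl

/-- For operators that preserve `𝔭`, the matrix of a composition is the product of the matrices. -/
theorem opMatrix_mul (L L' : Mat k l m →ₗ[ℝ] Mat k l m)
    (hL : ∀ w ∈ 𝔭 k l m, L' w ∈ 𝔭 k l m) :
    opMatrix L * opMatrix L' = opMatrix (L ∘ₗ L') := by
  ext t s
  rw [Matrix.mul_apply]
  exact sum_opMatrix_mul L (hL _ (basisVec s).2) t

end Operators

section Ricci

variable {x : Fin 3 → Fin 3 → ℝ}

/-- The contribution of the ordered pair `(r, s)` to the Ricci tensor: on the summand of `𝔭` in the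
blocks `(r, s)` and `(s, r)`, the Ricci tensor is the form with the coefficient
`ricciCoeff k l m x r s + ricciCoeff k l m x s r` in the coordinates. -/
noncomputable def ricciCoeff (k l m : ℕ) (x : Fin 3 → Fin 3 → ℝ) (r s : Fin 3) : ℝ :=
  ∑ j : Idx k l m, (leviCivitaCoeff x (blk j) s r
    - leviCivitaCoeff x r s (blk j) * leviCivitaCoeff x (blk j) r s) - 1

variable (hsymm : ∀ r s, x r s = x s r)
include hsymm

theorem leviCivita_mem {A w : Mat k l m} (hA : Aᵀ = -A) (hw : w ∈ 𝔭 k l m) :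
    leviCivita blk x A w ∈ 𝔭 k l m :=
  ⟨transpose_leviCivita blk hsymm hA hw.1, isOffDiag_leviCivita _ _ _ _⟩

theorem transpose_lie {A B : Mat k l m} (hA : Aᵀ = -A) (hB : Bᵀ = -B) : ⁅A, B⁆ᵀ = -⁅A, B⁆ := by
  rw [Ring.lie_def, Matrix.transpose_sub, Matrix.transpose_mul, Matrix.transpose_mul, hA, hB]
  simp

theorem curvature_mem {A B w : Mat k l m} (hA : Aᵀ = -A) (hB : Bᵀ = -B) (hw : w ∈ 𝔭 k l m) :
    curvature blk x A B w ∈ 𝔭 k l m :=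
  Submodule.sub_mem _ (Submodule.sub_mem _
    (leviCivita_mem hsymm hA (leviCivita_mem hsymm hB hw))
    (leviCivita_mem hsymm hB (leviCivita_mem hsymm hA hw)))
    (leviCivita_mem hsymm (transpose_lie hsymm hA hB) hw)

variable (hdiag : ∀ r, x r r = 0) (hne : ∀ r s, r ≠ s → x r s ≠ 0)
include hdiag hne

/-- The Ricci tensor at the base point, as the trace of the curvature operator. -/
theorem sum_curvature_coord {u v : Mat k l m} (hu : u ∈ 𝔭 k l m) (hv : v ∈ 𝔭 k l m) :
    ∑ t, curvature blk x (skewUnit (row t) (col t)) v u (row t) (col t)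
      = ∑ t : Coord k l m, (ricciCoeff k l m x (blk (row t)) (blk (col t))
        + ricciCoeff k l m x (blk (col t)) (blk (row t)))
          * (u (row t) (col t) * v (row t) (col t)) := by
  have h := sum_curvature blk hsymm hdiag hne (u := u) (v := v) hu.2 hv.2 hu.1 hv.1
  have hsw : ∀ i j : Idx k l m, skewUnit j i = (-1 : ℝ) • skewUnit i j := by
    intro i j
    simp [skewUnit]
  have h1 : ∀ t : Coord k l m, curvature blk x (skewUnit (col t) (row t)) v u (col t) (row t)
      = curvature blk x (skewUnit (row t) (col t)) v u (row t) (col t) := by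
    intro t
    have h2 := (curvature_mem hsymm (basisVec t).2.1 hv.1 hu).1
    have h3 := congrFun (congrFun h2 (row t)) (col t)
    rw [Matrix.transpose_apply, Matrix.neg_apply] at h3
    rw [hsw, curvature_smul_left, Matrix.smul_apply, smul_eq_mul]
    simp only [basisVec] at h3
    rw [h3]
    ring
  rw [sum_offDiag fun i j => curvature blk x (skewUnit i j) v u i j] at h
  simp only [h1, ← two_mul] at h
  rw [← Finset.mul_sum] at h
  have h4 := mul_left_cancel₀ two_ne_zero h
  rw [h4]
  have h5 := sum_offDiag (k := k) (l := l) (m := m)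
    fun i q => ricciCoeff k l m x (blk i) (blk q) * (u i q * v i q)
  have h6 : ∀ i q : Idx k l m, (if blk i = blk q then 0
      else ricciCoeff k l m x (blk i) (blk q) * (u i q * v i q))
      = ricciCoeff k l m x (blk i) (blk q) * (u i q * v i q) := by
    intro i q
    split_ifs with hiq
    · rw [hu.2 i q hiq]; ring
    · rfl
  simp only [h6] at h5
  have h7 : ∀ w ∈ 𝔭 k l m, ∀ i j, w i j = - w j i := fun w hw i j => by
    have := congrFun (congrFun hw.1 j) i; simpa using this
  refine h5.trans (Finset.sum_congr rfl fun t _ => ?_)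
  rw [h7 u hu (col t) (row t), h7 v hv (col t) (row t)]
  ring

variable {U : Set (Coord k l m → ℝ)} {φ : (Coord k l m → ℝ) → Mat k l m}

omit hsymm hdiag hne in
/-- The contraction of an index of the coframe with one of the dual frame is a trace. -/
theorem sum_inv_mul_frame {T : Type} [Fintype T] [DecidableEq T] {Θ : Matrix T T ℝ}
    (hdet : Θ.det ≠ 0) (κ : T → T → ℝ) :
    ∑ c, ∑ t, Θ⁻¹ c t * ∑ s, Θ s c * κ s t = ∑ t, κ t t := by
  have hinv : ∀ s t, ∑ c, Θ s c * Θ⁻¹ c t = if s = t then 1 else 0 := by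
    intro s t
    rw [← Matrix.mul_apply, Matrix.mul_nonsing_inv _ (Ne.isUnit hdet), Matrix.one_apply]
  simp only [Finset.mul_sum]
  calc ∑ c, ∑ t, ∑ s, Θ⁻¹ c t * (Θ s c * κ s t)
      = ∑ t, ∑ s, (∑ c, Θ s c * Θ⁻¹ c t) * κ s t := by
        rw [Finset.sum_comm]
        refine Finset.sum_congr rfl fun t _ => ?_
        rw [Finset.sum_comm]
        refine Finset.sum_congr rfl fun s _ => ?_
        rw [Finset.sum_mul]
        exact Finset.sum_congr rfl fun c _ => by ring
    _ = _ := by simp [hinv]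

section Connection

variable (hφ : IsLocalParametrization U φ) {y : Coord k l m → ℝ} (hy : y ∈ U)
include hφ hy

omit hsymm hdiag hne in
theorem IsLocalParametrization.opMatrix_mul_coframe (L : Mat k l m →ₗ[ℝ] Mat k l m)
    (t a : Coord k l m) : (opMatrix L * coframe φ y) t a
      = L (offPart blk (maurerCartan φ a y)) (row t) (col t) := by
  rw [Matrix.mul_apply, ← sum_opMatrix_mul L (hφ.offPart_mem hy a)]
  refine Finset.sum_congr rfl fun s _ => ?_
  rw [hφ.coframe_eq hy, offPart_apply, if_neg (blk_row_ne_blk_col s)]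

/-- The curvature form of the connection, in terms of the curvature of the frame vectors. -/
theorem IsLocalParametrization.curvature_mul_coframe (a b c t : Coord k l m) :
    (opMatrix (leviCivita blk x (maurerCartan φ c y) ∘ₗ leviCivita blk x (maurerCartan φ b y)
        - leviCivita blk x (maurerCartan φ b y) ∘ₗ leviCivita blk x (maurerCartan φ c y)
        - leviCivita blk x ⁅maurerCartan φ c y, maurerCartan φ b y⁆) * coframe φ y) t a
      = ∑ s, coframe φ y s c * curvature blk x (skewUnit (row s) (col s))
          (offPart blk (maurerCartan φ b y)) (offPart blk (maurerCartan φ a y))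
          (row t) (col t) := by
  have hup := hφ.offPart_mem hy a
  set u := offPart blk (maurerCartan φ a y) with hu
  set v := offPart blk (maurerCartan φ b y) with hv
  let κ : Mat k l m →ₗ[ℝ] Mat k l m :=
    { toFun := fun A => curvature blk x A v u
      map_add' := fun A A' => curvature_add_left blk x A A' v u
      map_smul' := fun r A => curvature_smul_left blk x r A v u }
  have h2 : curvature blk x (maurerCartan φ c y) (maurerCartan φ b y) u
      = κ (∑ s, coframe φ y s c • skewUnit (row s) (col s)) := by
    rw [hφ.sum_coframe_smul hy]
    exact curvature_offPart blk hsymm hdiag hne _ _ hup.2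
  rw [hφ.opMatrix_mul_coframe hy]
  refine (congrFun (congrFun h2 (row t)) (col t)).trans ?_
  rw [map_sum, Matrix.sum_apply]
  refine Finset.sum_congr rfl fun s _ => ?_
  rw [map_smul, Matrix.smul_apply, smul_eq_mul]
  rfl

end Connection

/-- The Ricci tensor of the metric that scales the blocks of `𝔭` by `μ x` is again diagonal, and
independent of `μ`. The connection form in the frame of a parametrization is `leviCivita` of the
Maurer–Cartan form; its curvature form is evaluated with the Maurer–Cartan equation. -/
theorem ricci_localMetric_diagForm (hφ : IsLocalParametrization U φ) {μ : ℝ} (hμ : μ ≠ 0)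
    {y : Coord k l m → ℝ} (hy : y ∈ U) :
    ricci (localMetric (diagForm fun t => μ * x (blk (row t)) (blk (col t))) φ) y
      = localMetric (diagForm fun t => ricciCoeff k l m x (blk (row t)) (blk (col t))
        + ricciCoeff k l m x (blk (col t)) (blk (row t))) φ y := by
  set Ω : Coord k l m → (Coord k l m → ℝ) → Matrix (Coord k l m) (Coord k l m) ℝ :=
    fun a y => opMatrix (leviCivita blk x (maurerCartan φ a y)) with hΩ
  set D : Matrix (Coord k l m) (Coord k l m) ℝ :=
    Matrix.diagonal fun t => μ * x (blk (row t)) (blk (col t)) with hD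
  have hdet : ∀ z ∈ U, (coframe φ z).det ≠ 0 := fun z hz =>
    (bijective_cosetDeriv_iff z).mp (hφ.bijective z hz)
  have hskew := fun a z (hz : z ∈ U) => hφ.transpose_maurerCartan hz a
  -- the entries of the connection form are linear in the Maurer–Cartan form
  let f : Coord k l m → Coord k l m → (Mat k l m →ₗ[ℝ] ℝ) := fun t s =>
    (Matrix.entryLinearMap ℝ ℝ (row t) (col t)) ∘ₗ
      ((leviCivita blk x).flip (skewUnit (row s) (col s)))
  have hΩs : ∀ a, SmoothOn (Ω a) U := fun a t s =>
    (hφ.smoothOn_maurerCartan a).linearMap_comp (f t s)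
  have hΩd : ∀ a b, ∀ z ∈ U, matPartial a (Ω b) z
      = opMatrix (leviCivita blk x (matPartial a (maurerCartan φ b) z)) := by
    intro a b z hz
    ext t s
    exact partialDeriv_linearMap_comp hφ.isOpen (hφ.smoothOn_maurerCartan b) hz (f t s) a
  have hcof : ∀ a, ∀ z ∈ U, ∀ t, coframe φ z t a
      = offPart blk (maurerCartan φ a z) (row t) (col t) := by
    intro a z hz t
    rw [hφ.coframe_eq hz, offPart_apply, if_neg (blk_row_ne_blk_col t)]
  have hDdet : D.det ≠ 0 := by
    rw [hD, Matrix.det_diagonal]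
    exact Finset.prod_ne_zero_iff.mpr fun t _ =>
      mul_ne_zero hμ (hne _ _ (blk_row_ne_blk_col t))
  -- the connection is metric
  have hDΩ : ∀ a, ∀ z ∈ U, D * Ω a z + (Ω a z)ᵀ * D = 0 := by
    intro a z hz
    ext t s
    rw [Matrix.add_apply, hD, Matrix.diagonal_mul, Matrix.mul_diagonal, Matrix.transpose_apply]
    simp only [hΩ, opMatrix_apply, Matrix.zero_apply]
    have := leviCivita_skew blk hsymm hdiag hne (hskew a z hz) (blk_row_ne_blk_col t)
      (blk_row_ne_blk_col s)
    linear_combination μ * this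
  -- the connection is torsion-free, by the `𝔭`-part of the Maurer–Cartan equation
  have htor : ∀ a b, ∀ z ∈ U, ∀ i, matPartial a (coframe φ) z i b
      + (Ω a z * coframe φ z) i b
      = matPartial b (coframe φ) z i a + (Ω b z * coframe φ z) i a := by
    intro a b z hz i
    have hd : ∀ a b, matPartial a (coframe φ) z i b
        = matPartial a (maurerCartan φ b) z (row i) (col i) := fun a b =>
      partialDeriv_congr hφ.isOpen (fun w hw => hφ.coframe_eq hw i b) hz a
    rw [hd, hd, hφ.opMatrix_mul_coframe hz, hφ.opMatrix_mul_coframe hz]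
    have h1 := congrFun (congrFun (leviCivita_sub blk hsymm hdiag hne (maurerCartan φ a z)
      (maurerCartan φ b z)) (row i)) (col i)
    have h2 := congrFun (congrFun (hφ.matPartial_maurerCartan hz a b) (row i)) (col i)
    rw [offPart_apply, if_neg (blk_row_ne_blk_col i), Matrix.sub_apply] at h1
    rw [Matrix.neg_apply, Matrix.sub_apply] at h2
    linarith
  ext a b
  rw [localMetric_diagForm, ricci_eq_of_frame hφ.isOpen hφ.smoothOn_coframe hΩs hdet
    (Matrix.diagonal_transpose _) hDdet hDΩ htor hy]
  -- the curvature form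
  have hK : ∀ c, matPartial c (Ω b) y - matPartial b (Ω c) y
      + (Ω c y * Ω b y - Ω b y * Ω c y)
      = opMatrix (leviCivita blk x (maurerCartan φ c y) ∘ₗ leviCivita blk x (maurerCartan φ b y)
        - leviCivita blk x (maurerCartan φ b y) ∘ₗ leviCivita blk x (maurerCartan φ c y)
        - leviCivita blk x ⁅maurerCartan φ c y, maurerCartan φ b y⁆) := by
    intro c
    have hm : ∀ a b, Ω a y * Ω b y = opMatrix (leviCivita blk x (maurerCartan φ a y) ∘ₗ
        leviCivita blk x (maurerCartan φ b y)) := fun a b =>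
      opMatrix_mul _ _ fun w hw => leviCivita_mem hsymm (hskew b y hy) hw
    rw [hΩd _ _ y hy, hΩd _ _ y hy, hm, hm]
    ext t s
    have h3 := congrArg (fun A => leviCivita blk x A (skewUnit (row s) (col s)) (row t) (col t))
      (hφ.matPartial_maurerCartan hy c b)
    simp only [map_sub, map_neg, LinearMap.sub_apply, LinearMap.neg_apply, Matrix.sub_apply,
      Matrix.neg_apply] at h3
    simp only [Matrix.add_apply, Matrix.sub_apply, opMatrix_apply, LinearMap.sub_apply]
    linarith
  simp only [hK, Matrix.mul_apply (M := (coframe φ y)⁻¹),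
    hφ.curvature_mul_coframe hsymm hdiag hne hy]
  rw [sum_inv_mul_frame (hdet y hy) fun s t => curvature blk x (skewUnit (row s) (col s))
    (offPart blk (maurerCartan φ b y)) (offPart blk (maurerCartan φ a y)) (row t) (col t),
    sum_curvature_coord hsymm hdiag hne (hφ.offPart_mem hy a) (hφ.offPart_mem hy b),
    localMetric_diagForm]
  beta_reduce
  rw [Matrix.mul_assoc, Matrix.mul_apply]
  refine Finset.sum_congr rfl fun t _ => ?_
  rw [Matrix.transpose_apply, Matrix.diagonal_mul, hcof a y hy, hcof b y hy]
  ring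

end Ricci

end WallachSO

namespace WallachSO

open scoped Matrix ContDiff
open BlockMatrix LocalRiemannian

variable {k l m : ℕ}

/-! ### Existence of a local parametrization -/

section Cayley

/-- The skew-symmetric matrix with the given coordinates on `𝔭`. -/
def skewOfCoord (v : Coord k l m → ℝ) : Mat k l m := ∑ t, v t • skewUnit (row t) (col t)

theorem skewOfCoord_mem (v : Coord k l m → ℝ) : skewOfCoord v ∈ 𝔭 k l m :=
  Submodule.sum_mem _ fun t _ => Submodule.smul_mem _ _ (basisVec t).2

theorem skewOfCoord_apply (v : Coord k l m → ℝ) (i j : Idx k l m) :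
    skewOfCoord v i j = ∑ t, v t * skewUnit (row t) (col t) i j := by
  rw [skewOfCoord, Matrix.sum_apply]; rfl

theorem smoothOn_skewOfCoord (U : Set (Coord k l m → ℝ)) :
    SmoothOn (skewOfCoord : (Coord k l m → ℝ) → Mat k l m) U := by
  intro i j
  simp only [skewOfCoord_apply]
  exact ContDiffOn.sum fun t _ => (contDiff_apply ℝ ℝ t).contDiffOn.mul contDiffOn_const

theorem matPartial_skewOfCoord (a : Coord k l m) (y : Coord k l m → ℝ) :
    matPartial a skewOfCoord y = (skewUnit (row a) (col a) : Mat k l m) := by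
  ext i j
  simp only [matPartial, Matrix.of_apply, skewOfCoord_apply]
  have hd : ∀ t, DifferentiableAt ℝ (fun v : Coord k l m → ℝ => v t) y := fun t =>
    differentiableAt_apply t y
  rw [partialDeriv_sum (f := fun t v => v t * skewUnit (row t) (col t) i j) Finset.univ
    fun t _ => (hd t).mul (differentiableAt_const _)]
  rw [Finset.sum_eq_single a]
  · rw [partialDeriv_mul (f := fun v => v a) (hd a) (differentiableAt_const _),
      partialDeriv_const]
    simp [partialDeriv, fderiv_apply]
  · intro t _ hta
    rw [partialDeriv_mul (f := fun v => v t) (hd t) (differentiableAt_const _),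
      partialDeriv_const]
    simp [partialDeriv, fderiv_apply, hta]
  · simp

/-- The Cayley transform `(1 + X) (1 - X)⁻¹` of the skew-symmetric matrices in `𝔭`. -/
noncomputable def cayley (v : Coord k l m → ℝ) : Mat k l m :=
  (1 + skewOfCoord v) * (1 - skewOfCoord v)⁻¹

/-- The Cayley transform of a skew-symmetric matrix is orthogonal, and it has determinant `1` because
`1 + X` is the transpose of `1 - X`. -/
theorem cayley_mem {v : Coord k l m → ℝ} (hv : (1 - skewOfCoord v).det ≠ 0) :
    cayley v ∈ G k l m := by
  have ht : (1 + skewOfCoord v)ᵀ = 1 - skewOfCoord v := by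
    rw [Matrix.transpose_add, Matrix.transpose_one, (skewOfCoord_mem v).1, sub_eq_add_neg]
  have ht' : (1 - skewOfCoord v)ᵀ = 1 + skewOfCoord v := by
    rw [← ht, Matrix.transpose_transpose]
  have hdet : (1 + skewOfCoord v).det = (1 - skewOfCoord v).det := by
    rw [← ht, Matrix.det_transpose]
  have hu := Ne.isUnit hv
  have hu' : IsUnit (1 + skewOfCoord v).det := hdet ▸ hu
  rw [Matrix.mem_specialOrthogonalGroup_iff]
  constructor
  · refine Matrix.mem_unitaryGroup_iff'.mpr ?_
    rw [Matrix.star_eq_conjTranspose, Matrix.conjTranspose_eq_transpose_of_trivial, cayley,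
      Matrix.transpose_mul, Matrix.transpose_nonsing_inv, ht, ht']
    have hc : (1 - skewOfCoord v) * (1 + skewOfCoord v)
        = (1 + skewOfCoord v) * (1 - skewOfCoord v) := by noncomm_ring
    rw [Matrix.mul_assoc, ← Matrix.mul_assoc (1 - skewOfCoord v), hc,
      Matrix.mul_nonsing_inv_cancel_right _ _ hu, Matrix.nonsing_inv_mul _ hu']
  · rw [cayley, Matrix.det_mul, hdet, ← Matrix.det_mul, Matrix.mul_nonsing_inv _ hu,
      Matrix.det_one]

/-- The Cayley transform parametrizes a neighbourhood of the base point of `G/H`. -/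
theorem exists_isLocalParametrization : ∃ (U : Set (Coord k l m → ℝ))
    (φ : (Coord k l m → ℝ) → Mat k l m), IsLocalParametrization U φ ∧ U.Nonempty := by
  set M : (Coord k l m → ℝ) → Mat k l m := fun v => 1 - skewOfCoord v with hM
  set U : Set (Coord k l m → ℝ) := {v | (M v).det ≠ 0} with hUdef
  have hMs : ∀ V, SmoothOn M V := fun V i j => by
    simp only [hM, Matrix.sub_apply]
    exact contDiffOn_const.sub (smoothOn_skewOfCoord V i j)
  have hPs : ∀ V, SmoothOn (fun v : Coord k l m → ℝ => 1 + skewOfCoord v) V := fun V i j => by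
    simp only [Matrix.add_apply]
    exact contDiffOn_const.add (smoothOn_skewOfCoord V i j)
  have hU : IsOpen U := by
    have : Continuous fun v => (M v).det :=
      continuousOn_univ.mp ((hMs Set.univ).det.continuousOn)
    exact isOpen_ne_fun this continuous_const
  have hs : SmoothOn cayley U := (hPs U).mul ((hMs U).inv fun v hv => hv)
  have h0 : skewOfCoord (0 : Coord k l m → ℝ) = 0 := by simp [skewOfCoord]
  have h0U : (0 : Coord k l m → ℝ) ∈ U := by
    simp [hUdef, hM, h0]
  have hc0 : cayley (0 : Coord k l m → ℝ) = 1 := by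
    simp [cayley, h0]
  -- differentiate `c(X) (1 - X) = 1 + X` at `X = 0`
  have hder : ∀ a, matPartial a cayley (0 : Coord k l m → ℝ)
      = (2 : ℝ) • skewUnit (row a) (col a) := by
    intro a
    have hcst : ∀ C : Mat k l m, SmoothOn (fun _ => C) U := fun C i j => contDiffOn_const
    have h1 : ∀ v ∈ U, cayley v * M v = 1 + skewOfCoord v := fun v hv => by
      rw [cayley, Matrix.nonsing_inv_mul_cancel_right _ _ (Ne.isUnit hv)]
    have h2 := matPartial_congr hU h1 h0U a
    have hMe : M = fun v => 1 + (-1 : Mat k l m) * skewOfCoord v := by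
      funext v; simp [hM, sub_eq_add_neg]
    have h3 : matPartial a M (0 : Coord k l m → ℝ) = - skewUnit (row a) (col a) := by
      rw [hMe, matPartial_add hU (hcst 1) ((hcst (-1)).mul (smoothOn_skewOfCoord U)) h0U,
        matPartial_mul hU (hcst (-1)) (smoothOn_skewOfCoord U) h0U,
        matPartial_const, matPartial_const, matPartial_skewOfCoord]
      simp
    rw [matPartial_mul hU hs (hMs U) h0U, h3, hc0,
      matPartial_add hU (hcst 1) (smoothOn_skewOfCoord U) h0U,
      matPartial_const, matPartial_skewOfCoord] at h2
    simp only [hM, h0, sub_zero, Matrix.mul_one, Matrix.one_mul, zero_add] at h2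
    rw [two_smul]
    nth_rewrite 1 [← h2]
    abel
  have hcof : coframe cayley (0 : Coord k l m → ℝ) = (2 : ℝ) • 1 := by
    ext t a
    have hsk := congrFun (congrFun (basisVec a).2.1 (row t)) (col t)
    simp only [basisVec, Matrix.transpose_apply, Matrix.neg_apply] at hsk
    rw [coframe_apply, maurerCartan, hc0, hder, Matrix.transpose_one, Matrix.one_mul,
      Matrix.smul_apply, Matrix.smul_apply, hsk, skewUnit_row_col, Matrix.smul_apply,
      Matrix.one_apply]
    simp only [eq_comm (a := a), smul_eq_mul]
    ring
  -- the coframe is twice the identity at the base point, hence invertible nearby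
  refine ⟨U ∩ (fun v => (coframe cayley v).det) ⁻¹' {0}ᶜ, cayley, ⟨?_, ?_, ?_, ?_⟩, 0, h0U, ?_⟩
  · exact (smoothOn_coframe hU hs).det.continuousOn.isOpen_inter_preimage hU
      isOpen_compl_singleton
  · exact fun v hv => cayley_mem hv.1
  · exact fun i j => (hs i j).mono Set.inter_subset_left
  · exact fun v hv => (bijective_cosetDeriv_iff v).mpr hv.2
  · simp [hcof]

end Cayley

/-! ### The Einstein equations -/

/-- In the frame of a parametrization, the metric and its Ricci tensor are constant diagonal matrices,
so the Einstein condition is an equation between their entries. That some parametrization exists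
is needed for the implication from left to right. -/
theorem isEinstein_diagForm_iff {x : Fin 3 → Fin 3 → ℝ} (hsymm : ∀ r s, x r s = x s r)
    (hdiag : ∀ r, x r r = 0) (hne : ∀ r s, r ≠ s → x r s ≠ 0) {μ : ℝ} (hμ : μ ≠ 0) :
    IsEinstein (k := k) (l := l) (m := m)
        (diagForm fun t => μ * x (blk (row t)) (blk (col t)))
      ↔ ∃ c : ℝ, ∀ t : Coord k l m, ricciCoeff k l m x (blk (row t)) (blk (col t))
        + ricciCoeff k l m x (blk (col t)) (blk (row t))
          = c * x (blk (row t)) (blk (col t)) := by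
  constructor
  · rintro ⟨c, hc⟩
    obtain ⟨U, φ, hφ, y, hy⟩ := exists_isLocalParametrization (k := k) (l := l) (m := m)
    have h := hc U φ hφ y hy
    rw [ricci_localMetric_diagForm hsymm hdiag hne hφ hμ hy, localMetric_diagForm,
      localMetric_diagForm] at h
    beta_reduce at h
    have hdet := (bijective_cosetDeriv_iff y).mp (hφ.bijective y hy)
    have hu : IsUnit (coframe φ y) := (Matrix.isUnit_iff_isUnit_det _).mpr (Ne.isUnit hdet)
    have hu' : IsUnit (coframe φ y)ᵀ := by
      rw [Matrix.isUnit_iff_isUnit_det, Matrix.det_transpose]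
      exact Ne.isUnit hdet
    rw [← Matrix.smul_mul, ← Matrix.mul_smul] at h
    have h2 := hu'.mul_left_cancel (hu.mul_right_cancel h)
    refine ⟨c * μ, fun t => ?_⟩
    have h3 := congrFun (congrFun h2 t) t
    rw [Matrix.smul_apply, Matrix.diagonal_apply_eq, Matrix.diagonal_apply_eq, smul_eq_mul] at h3
    rw [h3, mul_assoc]
  · rintro ⟨c, hc⟩
    refine ⟨c * μ⁻¹, fun U φ hφ y hy => ?_⟩
    rw [ricci_localMetric_diagForm hsymm hdiag hne hφ hμ hy, localMetric_diagForm,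
      localMetric_diagForm]
    beta_reduce
    rw [← Matrix.smul_mul, ← Matrix.mul_smul]
    congr 2
    rw [← Matrix.diagonal_smul]
    congr 1
    funext t
    rw [hc t, Pi.smul_apply, smul_eq_mul]
    field_simp

/-- The matrix of a three-parameter metric: the block `(r, s)` is scaled by the entry `(r, s)`. The
zeros on the diagonal follow the convention of `leviCivitaCoeff`. -/
def blockMetric (X Y Z : ℝ) : Fin 3 → Fin 3 → ℝ := !![0, X, Y; X, 0, Z; Y, Z, 0]

theorem blockMetric_symm (X Y Z : ℝ) (r s : Fin 3) :
    blockMetric X Y Z r s = blockMetric X Y Z s r := by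
  fin_cases r <;> fin_cases s <;> rfl

theorem blockMetric_self (X Y Z : ℝ) (r : Fin 3) : blockMetric X Y Z r r = 0 := by
  fin_cases r <;> rfl

theorem blockMetric_pos {X Y Z : ℝ} (hX : 0 < X) (hY : 0 < Y) (hZ : 0 < Z) {r s : Fin 3}
    (h : r ≠ s) : 0 < blockMetric X Y Z r s := by
  fin_cases r <;> fin_cases s <;> first | exact absurd rfl h | assumption

/-- The Ricci coefficient of a summand is `N + c (u² - v² - w²) / (2 v w)` with `N = k + l + m - 2`,
where `u` scales the summand, `v` and `w` scale the other two, and `c` is the size of the index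
block that the summand does not involve. -/
theorem ricciCoeff_blockMetric {X Y Z : ℝ} (hX : 0 < X) (hY : 0 < Y) (hZ : 0 < Z) :
    ricciCoeff k l m (blockMetric X Y Z) 0 1 + ricciCoeff k l m (blockMetric X Y Z) 1 0
        = k + l + m - 2 + m * (X ^ 2 - Y ^ 2 - Z ^ 2) / (2 * (Y * Z)) ∧
      ricciCoeff k l m (blockMetric X Y Z) 0 2 + ricciCoeff k l m (blockMetric X Y Z) 2 0
        = k + l + m - 2 + l * (Y ^ 2 - X ^ 2 - Z ^ 2) / (2 * (X * Z)) ∧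
      ricciCoeff k l m (blockMetric X Y Z) 1 2 + ricciCoeff k l m (blockMetric X Y Z) 2 1
        = k + l + m - 2 + k * (Z ^ 2 - X ^ 2 - Y ^ 2) / (2 * (X * Y)) := by
  have e01 : blockMetric X Y Z 0 1 = X := rfl
  have e10 : blockMetric X Y Z 1 0 = X := rfl
  have e02 : blockMetric X Y Z 0 2 = Y := rfl
  have e20 : blockMetric X Y Z 2 0 = Y := rfl
  have e12 : blockMetric X Y Z 1 2 = Z := rfl
  have e21 : blockMetric X Y Z 2 1 = Z := rfl
  have e00 : blockMetric X Y Z 0 0 = 0 := rfl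
  have e11 : blockMetric X Y Z 1 1 = 0 := rfl
  have e22 : blockMetric X Y Z 2 2 = 0 := rfl
  have h01 : (0 : Fin 3) ≠ 1 := by decide
  have h02 : (0 : Fin 3) ≠ 2 := by decide
  have h12 : (1 : Fin 3) ≠ 2 := by decide
  have hX' := hX.ne'
  have hY' := hY.ne'
  have hZ' := hZ.ne'
  simp only [ricciCoeff, Fintype.sum_sum_type, blk, Sum.elim_inl, Sum.elim_inr,
    Finset.sum_const, Finset.card_univ, Fintype.card_fin, nsmul_eq_mul, leviCivitaCoeff,
    h01, h02, h12, h01.symm, h02.symm, h12.symm, if_true, if_false,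
    e01, e10, e02, e20, e12, e21, e00, e11, e22]
  refine ⟨?_, ?_, ?_⟩ <;> field_simp <;> ring

/-- The Einstein equations for the metric that scales the three isotropy summands by `X`, `Y`
and `Z`: up to a common constant factor, the three sides are `2 X Y Z` times the ratios of the Ricci
tensor to the metric on the summands. -/
def EinsteinSystem (k l m X Y Z : ℝ) : Prop :=
  2 * (k + l + m - 2) * (Y * Z) + m * (X ^ 2 - Y ^ 2 - Z ^ 2)
      = 2 * (k + l + m - 2) * (X * Z) + l * (Y ^ 2 - X ^ 2 - Z ^ 2) ∧
    2 * (k + l + m - 2) * (X * Z) + l * (Y ^ 2 - X ^ 2 - Z ^ 2)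
      = 2 * (k + l + m - 2) * (X * Y) + k * (Z ^ 2 - X ^ 2 - Y ^ 2)

/-- The metric of the three-parameter family with parameters `X`, `Y`, `Z`. As
`-tr (X²) = 2 ∑_{i<j} X_ij²`, the form `-(k+l+m-2) tr (XY)` has the coefficient `2 (k+l+m-2)` in the
coordinates. -/
noncomputable def familyMetric (k l m : ℕ) (X Y Z : ℝ) : LinearMap.BilinForm ℝ (𝔭 k l m) :=
  diagForm fun t => 2 * (((k + l + m : ℕ) : ℝ) - 2) * blockMetric X Y Z (blk (row t)) (blk (col t))

/-- A metric of the three-parameter family is Einstein if and only if its parameters satisfy two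
quadratic equations. -/
theorem isEinstein_familyMetric_iff (hk : 2 ≤ k) (hl : 1 ≤ l) (hm : 1 ≤ m) {X Y Z : ℝ}
    (hX : 0 < X) (hY : 0 < Y) (hZ : 0 < Z) :
    IsEinstein (familyMetric k l m X Y Z) ↔ EinsteinSystem k l m X Y Z := by
  have hμ : 2 * (((k + l + m : ℕ) : ℝ) - 2) ≠ 0 := by
    have : ((3 : ℕ) : ℝ) ≤ ((k + l + m : ℕ) : ℝ) := Nat.cast_le.mpr (by omega)
    push_cast at this ⊢
    intro h
    linarith
  obtain ⟨h1, h2, h3⟩ := ricciCoeff_blockMetric (k := k) (l := l) (m := m) hX hY hZ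
  rw [familyMetric, isEinstein_diagForm_iff (blockMetric_symm X Y Z) (blockMetric_self X Y Z)
    (fun r s h => (blockMetric_pos hX hY hZ h).ne') hμ]
  have hX' := hX.ne'
  have hY' := hY.ne'
  have hZ' := hZ.ne'
  constructor
  · rintro ⟨c, hc⟩
    have c1 := hc (Sum.inl (⟨0, by omega⟩, ⟨0, by omega⟩))
    have c2 := hc (Sum.inr (Sum.inl (⟨0, by omega⟩, ⟨0, by omega⟩)))
    have c3 := hc (Sum.inr (Sum.inr (⟨0, by omega⟩, ⟨0, by omega⟩)))
    replace c1 := h1.symm.trans c1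
    replace c2 := h2.symm.trans c2
    replace c3 := h3.symm.trans c3
    replace c1 : (k + l + m - 2 : ℝ) + m * (X ^ 2 - Y ^ 2 - Z ^ 2) / (2 * (Y * Z)) = c * X := c1
    replace c2 : (k + l + m - 2 : ℝ) + l * (Y ^ 2 - X ^ 2 - Z ^ 2) / (2 * (X * Z)) = c * Y := c2
    replace c3 : (k + l + m - 2 : ℝ) + k * (Z ^ 2 - X ^ 2 - Y ^ 2) / (2 * (X * Y)) = c * Z := c3
    field_simp at c1 c2 c3
    exact ⟨by linear_combination c1 - c2, by linear_combination c2 - c3⟩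
  · rintro ⟨s1, s2⟩
    refine ⟨(2 * (k + l + m - 2) * (Y * Z) + m * (X ^ 2 - Y ^ 2 - Z ^ 2)) / (2 * (X * Y * Z)), ?_⟩
    rintro (t | t | t)
    · refine h1.trans ?_
      change _ = _ * X
      field_simp
    · refine h2.trans ?_
      change _ = _ * Y
      field_simp
      linear_combination -s1
    · refine h3.trans ?_
      change _ = _ * Z
      field_simp
      linear_combination -s1 - s2

end WallachSO

namespace WallachSO

open scoped Matrix ContDiff
open BlockMatrix

variable {k l m : ℕ}

/-! ### The three-parameter family -/

section Family

theorem component_apply (s t : Fin 3) (X : Mat k l m) (i j : Idx k l m) :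
    component s t X i j = if (blk i = s ∧ blk j = t) ∨ (blk i = t ∧ blk j = s)
      then X i j else 0 := rfl

theorem apply_eq_neg {X : Mat k l m} (hX : X ∈ 𝔭 k l m) (i j : Idx k l m) : X i j = -X j i := by
  have := congrFun (congrFun hX.1 j) i
  simpa using this

theorem standardInner_component {X Y : Mat k l m} (hY : Y ∈ 𝔭 k l m)
    (s t : Fin 3) : standardInner (component s t X) (component s t Y)
      = (((k + l + m : ℕ) : ℝ) - 2) * ∑ i, ∑ j,
        if (blk i = s ∧ blk j = t) ∨ (blk i = t ∧ blk j = s) then X i j * Y i j else 0 := by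
  rw [standardInner, Matrix.trace, neg_mul, ← mul_neg, ← Finset.sum_neg_distrib]
  congr 1
  refine Finset.sum_congr rfl fun i _ => ?_
  rw [Matrix.diag_apply, Matrix.mul_apply, ← Finset.sum_neg_distrib]
  refine Finset.sum_congr rfl fun j _ => ?_
  rw [component_apply, component_apply, apply_eq_neg hY j i]
  have : ((blk j = s ∧ blk i = t) ∨ (blk j = t ∧ blk i = s))
      ↔ ((blk i = s ∧ blk j = t) ∨ (blk i = t ∧ blk j = s)) := by tauto
  simp only [this]
  split_ifs <;> ring

theorem blockMetric_mul_eq (x₁ x₂ x₃ w : ℝ) (r s : Fin 3) :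
    (if r = s then 0 else blockMetric x₁ x₂ x₃ r s * w)
      = x₁ * (if (r = 0 ∧ s = 1) ∨ (r = 1 ∧ s = 0) then w else 0)
        + x₂ * (if (r = 0 ∧ s = 2) ∨ (r = 2 ∧ s = 0) then w else 0)
        + x₃ * (if (r = 1 ∧ s = 2) ∨ (r = 2 ∧ s = 1) then w else 0) := by
  fin_cases r <;> fin_cases s <;> simp [blockMetric]

/-- The forms that are diagonal in the coordinates, with one coefficient for each summand, are the
forms of the three-parameter family. -/
theorem familyMetric_apply (x₁ x₂ x₃ : ℝ) (X Y : 𝔭 k l m) :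
    familyMetric k l m x₁ x₂ x₃ X Y
      = x₁ * standardInner (component 0 1 (X : Mat k l m)) (component 0 1 (Y : Mat k l m))
      + x₂ * standardInner (component 0 2 (X : Mat k l m)) (component 0 2 (Y : Mat k l m))
      + x₃ * standardInner (component 1 2 (X : Mat k l m)) (component 1 2 (Y : Mat k l m)) := by
  have h := sum_offDiag (k := k) (l := l) (m := m) fun i j =>
    blockMetric x₁ x₂ x₃ (blk i) (blk j) * ((X : Mat k l m) i j * (Y : Mat k l m) i j)
  simp only [blockMetric_mul_eq, Finset.sum_add_distrib, ← Finset.mul_sum] at h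
  rw [standardInner_component Y.2, standardInner_component Y.2, standardInner_component Y.2,
    familyMetric, diagForm_apply]
  have h2 : ∀ t : Coord k l m, blockMetric x₁ x₂ x₃ (blk (col t)) (blk (row t))
      * ((X : Mat k l m) (col t) (row t) * (Y : Mat k l m) (col t) (row t))
      = blockMetric x₁ x₂ x₃ (blk (row t)) (blk (col t))
      * ((X : Mat k l m) (row t) (col t) * (Y : Mat k l m) (row t) (col t)) := by
    intro t
    rw [blockMetric_symm, apply_eq_neg X.2 (col t), apply_eq_neg Y.2 (col t)]
    ring
  simp only [h2] at h
  calc _ = (((k + l + m : ℕ) : ℝ) - 2) * ((∑ t : Coord k l m,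
          blockMetric x₁ x₂ x₃ (blk (row t)) (blk (col t))
          * ((X : Mat k l m) (row t) (col t) * (Y : Mat k l m) (row t) (col t)))
        + ∑ t : Coord k l m, blockMetric x₁ x₂ x₃ (blk (row t)) (blk (col t))
          * ((X : Mat k l m) (row t) (col t) * (Y : Mat k l m) (row t) (col t))) := by
        rw [← two_mul, Finset.mul_sum, Finset.mul_sum]
        exact Finset.sum_congr rfl fun t _ => by ring
    _ = _ := by
        rw [← h]
        ring

theorem isThreeParameter_iff {B : LinearMap.BilinForm ℝ (𝔭 k l m)} : IsThreeParameter B ↔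
    ∃ x₁ x₂ x₃ : ℝ, 0 < x₁ ∧ 0 < x₂ ∧ 0 < x₃ ∧ B = familyMetric k l m x₁ x₂ x₃ := by
  constructor
  · rintro ⟨x₁, x₂, x₃, h₁, h₂, h₃, h⟩
    exact ⟨x₁, x₂, x₃, h₁, h₂, h₃, LinearMap.ext₂ fun X Y => by rw [h, familyMetric_apply]⟩
  · rintro ⟨x₁, x₂, x₃, h₁, h₂, h₃, rfl⟩
    exact ⟨x₁, x₂, x₃, h₁, h₂, h₃, familyMetric_apply x₁ x₂ x₃⟩

theorem H_isBlockDiag {h : Mat k l m} (hh : h ∈ H k l m) : IsBlockDiag blk h := by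
  obtain ⟨A, _, B, _, C, _, rfl⟩ := hh
  rintro (i | i | i) (j | j | j) hij <;>
    first | exact absurd rfl hij | rfl

theorem H_transpose_mul_self {h : Mat k l m} (hh : h ∈ H k l m) : hᵀ * h = 1 := by
  obtain ⟨A, hA, B, hB, C, hC, rfl⟩ := hh
  have eA := Matrix.mem_unitaryGroup_iff'.mp (Matrix.mem_specialOrthogonalGroup_iff.mp hA).1
  have eB := Matrix.mem_unitaryGroup_iff'.mp (Matrix.mem_specialOrthogonalGroup_iff.mp hB).1
  have eC := Matrix.mem_unitaryGroup_iff'.mp (Matrix.mem_specialOrthogonalGroup_iff.mp hC).1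
  rw [Matrix.star_eq_conjTranspose, Matrix.conjTranspose_eq_transpose_of_trivial] at eA eB eC
  simp only [diagBlocks, Matrix.fromBlocks_transpose, Matrix.fromBlocks_multiply, eA, eB, eC,
    Matrix.transpose_zero, Matrix.mul_zero, Matrix.zero_mul, add_zero, zero_add,
    Matrix.fromBlocks_one]

theorem component_conj {h : Mat k l m} (hh : h ∈ H k l m) (s t : Fin 3) (X : Mat k l m) :
    component s t (h * X * hᵀ) = h * component s t X * hᵀ := by
  have hd := H_isBlockDiag hh
  ext i j
  rw [component_apply]
  simp only [Matrix.mul_apply, Matrix.transpose_apply, Finset.sum_mul, component_apply]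
  have key : ∀ p q, (h i p * if (blk p = s ∧ blk q = t) ∨ (blk p = t ∧ blk q = s)
        then X p q else 0) * h j q
      = if (blk i = s ∧ blk j = t) ∨ (blk i = t ∧ blk j = s) then h i p * X p q * h j q
        else 0 := by
    intro p q
    by_cases hp : blk i = blk p
    · by_cases hq : blk j = blk q
      · rw [hp, hq]
        split_ifs <;> ring
      · simp [hd j q hq]
    · simp [hd i p hp]
  simp only [key]
  split_ifs
  · rfl
  · simp

theorem standardInner_conj {h : Mat k l m} (hh : h ∈ H k l m) (X Y : Mat k l m) :
    standardInner (h * X * hᵀ) (h * Y * hᵀ) = standardInner X Y := by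
  have e := H_transpose_mul_self hh
  have : h * X * hᵀ * (h * Y * hᵀ) = h * (X * Y) * hᵀ := by
    simp only [Matrix.mul_assoc]
    rw [← Matrix.mul_assoc hᵀ h, e, Matrix.one_mul]
  rw [standardInner, standardInner, this, Matrix.trace_mul_comm, ← Matrix.mul_assoc, e,
    Matrix.one_mul]

theorem isInvariantMetric_familyMetric (hk : 2 ≤ k) (hm : 1 ≤ m) {x₁ x₂ x₃ : ℝ} (h₁ : 0 < x₁)
    (h₂ : 0 < x₂) (h₃ : 0 < x₃) : IsInvariantMetric (familyMetric k l m x₁ x₂ x₃) where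
  symm X Y := by
    simp only [familyMetric, diagForm_apply]
    exact Finset.sum_congr rfl fun t _ => by ring
  pos X hX := by
    have hμ : 0 < 2 * (((k + l + m : ℕ) : ℝ) - 2) := by
      have : ((3 : ℕ) : ℝ) ≤ ((k + l + m : ℕ) : ℝ) := Nat.cast_le.mpr (by omega)
      push_cast at this ⊢
      linarith
    have hpos : ∀ t : Coord k l m, 0 < 2 * (((k + l + m : ℕ) : ℝ) - 2)
        * blockMetric x₁ x₂ x₃ (blk (row t)) (blk (col t)) := fun t =>
      mul_pos hμ (blockMetric_pos h₁ h₂ h₃ (blk_row_ne_blk_col t))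
    rw [familyMetric, diagForm_apply]
    refine Finset.sum_pos' (fun t _ => mul_nonneg (hpos t).le (mul_self_nonneg _)) ?_
    by_contra hcon
    push Not at hcon
    refine hX (Subtype.ext (eq_of_coord_eq X.2 (Submodule.zero_mem _) fun t => ?_))
    by_contra hne
    exact absurd (hcon t (Finset.mem_univ t))
      (not_le.mpr (mul_pos (hpos t) (mul_self_pos.mpr hne)))
  invariant h hh X Y X' Y' hX hY := by
    rw [familyMetric_apply, familyMetric_apply, hX, hY]
    simp only [component_conj hh, standardInner_conj hh]

end Family

/-! ### Invariant metrics belong to the three-parameter family -/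

section Isotropy

variable {ι : Type} [Fintype ι] [DecidableEq ι]

/-- The rotation by a right angle in the coordinate plane of `i` and `j`, with `e_i ↦ e_j` and
`e_j ↦ -e_i`. -/
def planeRotation (i j : ι) : Matrix ι ι ℝ :=
  Matrix.of fun p q => if p = Equiv.swap i j q then (if q = j then -1 else 1) else 0

theorem eq_swap_comm {i j p q : ι} : p = Equiv.swap i j q ↔ Equiv.swap i j p = q := by
  constructor
  · rintro rfl; simp
  · rintro rfl; simp

theorem planeRotation_mem {i j : ι} (hij : i ≠ j) :
    planeRotation i j ∈ Matrix.specialOrthogonalGroup ι ℝ := by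
  set D : Matrix ι ι ℝ := Matrix.diagonal fun q => if q = j then -1 else 1 with hD
  have hP : planeRotation i j = D.submatrix (Equiv.swap i j) id := by
    ext p q
    rw [Matrix.submatrix_apply, hD, Matrix.diagonal_apply]
    simp only [planeRotation, Matrix.of_apply, eq_swap_comm, id]
    split_ifs with h1 h2 h3 h3
    · rfl
    · exact absurd (h1.trans h2) h3
    · exact absurd (h1 ▸ h3) h2
    · rfl
    · rfl
  rw [Matrix.mem_specialOrthogonalGroup_iff, hP]
  constructor
  · refine Matrix.mem_unitaryGroup_iff'.mpr ?_
    rw [Matrix.star_eq_conjTranspose, Matrix.conjTranspose_eq_transpose_of_trivial,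
      Matrix.transpose_submatrix, Matrix.submatrix_mul_equiv, hD, Matrix.diagonal_transpose,
      Matrix.diagonal_mul_diagonal, Matrix.submatrix_id_id, ← Matrix.diagonal_one]
    congr 1
    funext q
    split_ifs <;> norm_num
  · rw [Matrix.det_permute, Equiv.Perm.sign_swap hij, hD, Matrix.det_diagonal,
      Finset.prod_ite_eq' Finset.univ j]
    simp

theorem planeRotation_mem_H {i j : Idx k l m} (hij : i ≠ j) (hb : blk i = blk j) :
    planeRotation i j ∈ H k l m := by
  have h1 := fun n : ℕ => Submonoid.one_mem (Matrix.specialOrthogonalGroup (Fin n) ℝ)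
  rcases i with i | i | i <;> rcases j with j | j | j <;> simp only [blk, Sum.elim_inl,
    Sum.elim_inr, Fin.reduceEq] at hb
  · have hij' : i ≠ j := fun h => hij (h ▸ rfl)
    have s1 : ∀ q,
        Equiv.swap (Sum.inl i : Idx k l m) (Sum.inl j) (Sum.inl q)
          = Sum.inl (Equiv.swap i j q) :=
      fun q => Sum.inl_injective.swap_apply i j q
    have s2 : ∀ q : Fin l,
        Equiv.swap (Sum.inl i : Idx k l m) (Sum.inl j) (Sum.inr (Sum.inl q))
          = Sum.inr (Sum.inl q) :=
      fun q => Equiv.swap_apply_of_ne_of_ne (by simp) (by simp)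
    have s3 : ∀ q : Fin m,
        Equiv.swap (Sum.inl i : Idx k l m) (Sum.inl j) (Sum.inr (Sum.inr q))
          = Sum.inr (Sum.inr q) :=
      fun q => Equiv.swap_apply_of_ne_of_ne (by simp) (by simp)
    refine ⟨planeRotation i j, planeRotation_mem hij', 1, h1 l, 1, h1 m, ?_⟩
    ext (p | p | p) (q | q | q) <;>
      simp [planeRotation, diagBlocks, Matrix.one_apply, s1, s2, s3]
  · have hij' : i ≠ j := fun h => hij (h ▸ rfl)
    have s1 : ∀ q,
        Equiv.swap (Sum.inr (Sum.inl i) : Idx k l m) (Sum.inr (Sum.inl j)) (Sum.inr (Sum.inl q))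
          = Sum.inr (Sum.inl (Equiv.swap i j q)) :=
      fun q => (Sum.inr_injective.comp Sum.inl_injective).swap_apply i j q
    have s2 : ∀ q : Fin k,
        Equiv.swap (Sum.inr (Sum.inl i) : Idx k l m) (Sum.inr (Sum.inl j)) (Sum.inl q)
          = Sum.inl q :=
      fun q => Equiv.swap_apply_of_ne_of_ne (by simp) (by simp)
    have s3 : ∀ q : Fin m,
        Equiv.swap (Sum.inr (Sum.inl i) : Idx k l m) (Sum.inr (Sum.inl j)) (Sum.inr (Sum.inr q))
          = Sum.inr (Sum.inr q) :=
      fun q => Equiv.swap_apply_of_ne_of_ne (by simp) (by simp)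
    refine ⟨1, h1 k, planeRotation i j, planeRotation_mem hij', 1, h1 m, ?_⟩
    ext (p | p | p) (q | q | q) <;>
      simp [planeRotation, diagBlocks, Matrix.one_apply, s1, s2, s3]
  · have hij' : i ≠ j := fun h => hij (h ▸ rfl)
    have s1 : ∀ q,
        Equiv.swap (Sum.inr (Sum.inr i) : Idx k l m) (Sum.inr (Sum.inr j)) (Sum.inr (Sum.inr q))
          = Sum.inr (Sum.inr (Equiv.swap i j q)) :=
      fun q => (Sum.inr_injective.comp Sum.inr_injective).swap_apply i j q
    have s2 : ∀ q : Fin k,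
        Equiv.swap (Sum.inr (Sum.inr i) : Idx k l m) (Sum.inr (Sum.inr j)) (Sum.inl q)
          = Sum.inl q :=
      fun q => Equiv.swap_apply_of_ne_of_ne (by simp) (by simp)
    have s3 : ∀ q : Fin l,
        Equiv.swap (Sum.inr (Sum.inr i) : Idx k l m) (Sum.inr (Sum.inr j)) (Sum.inr (Sum.inl q))
          = Sum.inr (Sum.inl q) :=
      fun q => Equiv.swap_apply_of_ne_of_ne (by simp) (by simp)
    refine ⟨1, h1 k, 1, h1 l, planeRotation i j, planeRotation_mem hij', ?_⟩
    ext (p | p | p) (q | q | q) <;>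
      simp [planeRotation, diagBlocks, Matrix.one_apply, s1, s2, s3]

theorem planeRotation_apply (i j p a : ι) : planeRotation i j p a
    = (if a = j then -1 else 1) * (if Equiv.swap i j a = p then 1 else 0) := by
  rw [planeRotation, Matrix.of_apply]
  by_cases h : p = Equiv.swap i j a
  · rw [if_pos h, if_pos h.symm, mul_one]
  · rw [if_neg h, if_neg (Ne.symm h), mul_zero]

/-- The isotropy action of a rotation by a right angle permutes the basis of `𝔭` up to signs. -/
theorem planeRotation_conj_skewUnit (i j a b : ι) :
    planeRotation i j * skewUnit a b * (planeRotation i j)ᵀ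
      = ((if a = j then -1 else 1) * (if b = j then (-1 : ℝ) else 1))
        • skewUnit (Equiv.swap i j a) (Equiv.swap i j b) := by
  ext p q
  have h : (planeRotation i j * skewUnit a b * (planeRotation i j)ᵀ) p q
      = planeRotation i j p a * planeRotation i j q b
        - planeRotation i j p b * planeRotation i j q a := by
    rw [Matrix.mul_apply]
    simp only [mul_skewUnit_apply, Matrix.transpose_apply, sub_mul, Finset.sum_sub_distrib,
      ite_mul, zero_mul, Finset.sum_ite_eq', Finset.mem_univ, if_true]
  rw [h, Matrix.smul_apply, skewUnit_apply, smul_eq_mul]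
  simp only [planeRotation_apply, ite_and]
  have hite : ∀ (P Q : Prop) [Decidable P] [Decidable Q], (if P then if Q then (1 : ℝ) else 0 else 0)
      = (if P then 1 else 0) * (if Q then 1 else 0) := by
    intro P Q _ _
    split_ifs <;> simp
  rw [hite, hite]
  ring

end Isotropy

end WallachSO

namespace WallachSO

open scoped Matrix ContDiff
open BlockMatrix

variable {k l m : ℕ}

section Invariant

/-- The projection to `𝔭` of the matrix `e_i e_jᵀ - e_j e_iᵀ`. -/
noncomputable def unitVec (i j : Idx k l m) : 𝔭 k l m := proj k l m (skewUnit i j)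

theorem coe_unitVec {i j : Idx k l m} (h : blk i ≠ blk j) :
    (unitVec i j : Mat k l m) = skewUnit i j := by
  ext a b
  have h1 : (unitVec i j : Mat k l m) a b
      = if blk a = blk b then 0 else (skewUnit i j a b - skewUnit i j b a) / 2 := rfl
  rw [h1]
  split_ifs with hab
  · exact ((skewUnit_mem h).2 a b hab).symm
  · rw [apply_eq_neg (skewUnit_mem h) b a]
    ring

theorem blk_swap {i j : Idx k l m} (hb : blk i = blk j) (a : Idx k l m) :
    blk (Equiv.swap i j a) = blk a := by
  rw [Equiv.swap_apply_def]
  split_ifs with h1 h2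
  · rw [h1, hb]
  · rw [h2, hb]
  · rfl

variable {B : LinearMap.BilinForm ℝ (𝔭 k l m)} (hB : IsInvariantMetric B)
include hB

/-- Invariance under the rotation by a right angle in a coordinate plane of one block. -/
theorem IsInvariantMetric.planeRotation {i j a b c d : Idx k l m} (hij : i ≠ j)
    (hb : blk i = blk j) (hab : blk a ≠ blk b) (hcd : blk c ≠ blk d) :
    ((if a = j then -1 else 1) * (if b = j then -1 else 1) *
      ((if c = j then -1 else 1) * (if d = j then (-1 : ℝ) else 1)))
      * B (unitVec (Equiv.swap i j a) (Equiv.swap i j b))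
          (unitVec (Equiv.swap i j c) (Equiv.swap i j d))
      = B (unitVec a b) (unitVec c d) := by
  have key : ∀ a b, blk a ≠ blk b →
      (((((if a = j then -1 else 1) * (if b = j then (-1 : ℝ) else 1))
        • unitVec (Equiv.swap i j a) (Equiv.swap i j b) : 𝔭 k l m)) : Mat k l m)
      = WallachSO.planeRotation i j * (unitVec a b : Mat k l m)
        * (WallachSO.planeRotation i j)ᵀ := by
    intro a b hab
    rw [coe_unitVec hab, planeRotation_conj_skewUnit, Submodule.coe_smul,
      coe_unitVec (by rwa [blk_swap hb, blk_swap hb])]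
  have h := hB.invariant _ (planeRotation_mem_H hij hb) _ _ _ _ (key a b hab) (key c d hcd)
  rw [← h, map_smul, map_smul, LinearMap.smul_apply, smul_eq_mul, smul_eq_mul]
  ring

/-- Invariance under the half turn in a coordinate plane of one block, which changes the signs of
the two basis vectors of the plane. -/
theorem IsInvariantMetric.halfTurn {i j a b c d : Idx k l m} (hij : i ≠ j)
    (hb : blk i = blk j) (hab : blk a ≠ blk b) (hcd : blk c ≠ blk d) :
    ((if a = i ∨ a = j then -1 else 1) * (if b = i ∨ b = j then -1 else 1) *
      ((if c = i ∨ c = j then -1 else 1) * (if d = i ∨ d = j then (-1 : ℝ) else 1)))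
      * B (unitVec a b) (unitVec c d) = B (unitVec a b) (unitVec c d) := by
  have hs : ∀ a, (if a = j then (-1 : ℝ) else 1) * (if Equiv.swap i j a = j then -1 else 1)
      = if a = i ∨ a = j then -1 else 1 := by
    intro a
    by_cases h1 : a = i
    · subst h1; simp [hij]
    · by_cases h2 : a = j
      · subst h2; simp [hij]
      · simp [Equiv.swap_apply_of_ne_of_ne h1 h2, h1, h2]
  have h1 := hB.planeRotation hij hb hab hcd
  have h2 := hB.planeRotation (a := Equiv.swap i j a) (b := Equiv.swap i j b)
    (c := Equiv.swap i j c) (d := Equiv.swap i j d) hij hb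
    (by rwa [blk_swap hb, blk_swap hb]) (by rwa [blk_swap hb, blk_swap hb])
  have sw : ∀ a, Equiv.swap i j (Equiv.swap i j a) = a := by simp
  rw [sw, sw, sw, sw] at h2
  rw [← h2] at h1
  rw [← hs a, ← hs b, ← hs c, ← hs d]
  linear_combination h1

theorem IsInvariantMetric.eq_zero_of_halfTurn {i j a b c d : Idx k l m} (hij : i ≠ j)
    (hb : blk i = blk j) (hab : blk a ≠ blk b) (hcd : blk c ≠ blk d)
    (hs : (if a = i ∨ a = j then -1 else 1) * (if b = i ∨ b = j then -1 else 1) *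
      ((if c = i ∨ c = j then -1 else 1) * (if d = i ∨ d = j then (-1 : ℝ) else 1)) = -1) :
    B (unitVec a b) (unitVec c d) = 0 := by
  have h := hB.halfTurn hij hb hab hcd
  rw [hs] at h
  linarith

/-- Vectors that share one index are orthogonal: a rotation by a right angle in the plane of the
other two indices interchanges them and changes one sign. -/
theorem IsInvariantMetric.eq_zero_left {a b c : Idx k l m} (hac : a ≠ c)
    (hb : blk a = blk c) (hab : blk a ≠ blk b) :
    B (unitVec a b) (unitVec c b) = 0 := by
  have hba : b ≠ a := fun h => hab (h ▸ rfl)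
  have hbc : b ≠ c := fun h => hab (hb.trans (h ▸ rfl))
  have h := hB.planeRotation (a := a) (b := b) (c := c) (d := b) hac hb hab (hb ▸ hab)
  rw [Equiv.swap_apply_left, Equiv.swap_apply_right, Equiv.swap_apply_of_ne_of_ne hba hbc,
    if_neg hac, if_neg hbc, if_pos rfl, hB.symm] at h
  linarith

theorem IsInvariantMetric.eq_zero_right {a b c : Idx k l m} (hac : a ≠ c)
    (hb : blk a = blk c) (hab : blk a ≠ blk b) :
    B (unitVec b a) (unitVec b c) = 0 := by
  have hba : b ≠ a := fun h => hab (h ▸ rfl)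
  have hbc : b ≠ c := fun h => hab (hb.trans (h ▸ rfl))
  have h := hB.planeRotation (a := b) (b := a) (c := b) (d := c) hac hb hab.symm (hb ▸ hab.symm)
  rw [Equiv.swap_apply_left, Equiv.swap_apply_right, Equiv.swap_apply_of_ne_of_ne hba hbc,
    if_neg hac, if_neg hbc, if_pos rfl, hB.symm] at h
  linarith

/-- Vectors of one isotropy summand have the same norm, as rotations by right angles permute them
transitively. -/
theorem IsInvariantMetric.norm_eq {a b a' b' : Idx k l m} (ha : blk a = blk a')
    (hb : blk b = blk b') (hab : blk a ≠ blk b) :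
    B (unitVec a b) (unitVec a b) = B (unitVec a' b') (unitVec a' b') := by
  have h1 : B (unitVec a b) (unitVec a b) = B (unitVec a' b) (unitVec a' b) := by
    by_cases haa : a = a'
    · rw [haa]
    · have hba : b ≠ a := fun h => hab (h ▸ rfl)
      have hba' : b ≠ a' := fun h => hab (ha.trans (h ▸ rfl))
      have h := hB.planeRotation (a := a) (b := b) (c := a) (d := b) haa ha hab hab
      rw [Equiv.swap_apply_left, Equiv.swap_apply_of_ne_of_ne hba hba', if_neg haa,
        if_neg hba'] at h
      linarith
  rw [h1]
  by_cases hbb : b = b'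
  · rw [hbb]
  · have hba : a' ≠ b := fun h => hab (ha.trans (h ▸ rfl))
    have hba' : a' ≠ b' := fun h => hab (ha.trans (h ▸ hb.symm))
    have h := hB.planeRotation (a := a') (b := b) (c := a') (d := b) hbb hb (ha ▸ hab) (ha ▸ hab)
    rw [Equiv.swap_apply_left, Equiv.swap_apply_of_ne_of_ne hba hba', if_neg hbb,
      if_neg hba'] at h
    linarith

/-- Vectors of one isotropy summand are orthogonal if one of the blocks has a third index: a half
turn that fixes one of the two vectors then changes the sign of the other. -/
theorem IsInvariantMetric.eq_zero_of_exists {a b c d : Idx k l m} (hac : blk a = blk c)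
    (hbd : blk b = blk d) (hab : blk a ≠ blk b) (hne : a ≠ c ∨ b ≠ d)
    (hex : (∃ j, blk j = blk a ∧ j ≠ a ∧ j ≠ c) ∨ (∃ j, blk j = blk b ∧ j ≠ b ∧ j ≠ d)) :
    B (unitVec a b) (unitVec c d) = 0 := by
  have hcd : blk c ≠ blk d := hac ▸ hbd ▸ hab
  have hne' : ∀ {x y : Idx k l m}, blk x ≠ blk y → x ≠ y := fun h h' => h (h' ▸ rfl)
  by_cases h1 : a = c
  · subst h1
    have hbd' : b ≠ d := hne.resolve_left (fun h => h rfl)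
    exact hB.eq_zero_right hbd' hbd hab.symm
  · by_cases h2 : b = d
    · subst h2
      exact hB.eq_zero_left h1 hac hab
    · rcases hex with ⟨j, hj, hja, hjc⟩ | ⟨j, hj, hjb, hjd⟩
      · refine hB.eq_zero_of_halfTurn (i := a) (j := j) hja.symm hj.symm hab hcd ?_
        have e1 : b ≠ a := hne' hab.symm
        have e2 : b ≠ j := hne' (hj ▸ hab.symm)
        have e3 : d ≠ a := hne' (hbd ▸ hab.symm)
        have e4 : d ≠ j := hne' (hbd ▸ hj ▸ hab.symm)
        simp [e1, e2, e3, e4, Ne.symm h1, hjc.symm]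
      · refine hB.eq_zero_of_halfTurn (i := b) (j := j) hjb.symm hj.symm hab hcd ?_
        have e1 : a ≠ b := hne' hab
        have e2 : a ≠ j := hne' (hj ▸ hab)
        have e3 : c ≠ b := hne' (hac ▸ hab)
        have e4 : c ≠ j := hne' (hj ▸ hac ▸ hab)
        simp [e1, e2, e3, e4, Ne.symm h2, hjd.symm]

end Invariant

theorem exists_left (hk : 3 ≤ k) (a c : Fin k) : ∃ j : Idx k l m,
    blk j = blk (Sum.inl a : Idx k l m) ∧ j ≠ Sum.inl a ∧ j ≠ Sum.inl c := by
  obtain ⟨j, h1, h2⟩ := Fin.exists_ne_and_ne_of_two_lt a c hk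
  exact ⟨Sum.inl j, rfl, by simpa using h1, by simpa using h2⟩

/-- An invariant metric is diagonal in the coordinates on `𝔭`, unless two of the blocks have size
two. For two such blocks, `SO(2) × SO(2)` acts reducibly on the `2 × 2` matrices. -/
theorem IsInvariantMetric.eq_zero_of_ne {B : LinearMap.BilinForm ℝ (𝔭 k l m)}
    (hB : IsInvariantMetric B) (hlk : l ≤ k) (hml : m ≤ l) (hl : 2 ≤ l)
    (h2 : ¬ (l = 2 ∧ (k = 2 ∨ m = 2))) {s t : Coord k l m} (hst : s ≠ t) :
    B (basisVec s) (basisVec t) = 0 := by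
  have hbv : ∀ t : Coord k l m, basisVec t = unitVec (row t) (col t) := fun t =>
    Subtype.ext (coe_unitVec (blk_row_ne_blk_col t)).symm
  have hk : 3 ≤ k := by omega
  have ex2 : ∀ {n : ℕ} (_ : 2 ≤ n) (a : Fin n), ∃ j, j ≠ a := fun {n} hn a => by
    have : Nontrivial (Fin n) := Fin.nontrivial_iff_two_le.mpr hn
    exact exists_ne a
  rw [hbv, hbv]
  have hs := blk_row_ne_blk_col s
  have ht := blk_row_ne_blk_col t
  -- vectors of different summands: half turns in a plane that meets only one of the two
  have z01 : ∀ (p : Fin k × Fin l) (q : Fin k × Fin m),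
      B (unitVec (Sum.inl p.1) (Sum.inr (Sum.inl p.2)))
        (unitVec (Sum.inl q.1) (Sum.inr (Sum.inr q.2))) = 0 := by
    intro p q
    obtain ⟨j, hj⟩ := ex2 hl p.2
    exact hB.eq_zero_of_halfTurn (i := Sum.inr (Sum.inl p.2)) (j := Sum.inr (Sum.inl j))
      (by simpa using hj.symm) rfl (by simp [blk]) (by simp [blk]) (by simp)
  have z02 : ∀ (p : Fin k × Fin l) (q : Fin l × Fin m),
      B (unitVec (Sum.inl p.1) (Sum.inr (Sum.inl p.2)))
        (unitVec (Sum.inr (Sum.inl q.1)) (Sum.inr (Sum.inr q.2))) = 0 := by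
    intro p q
    obtain ⟨j, hj⟩ := ex2 (by omega : 2 ≤ k) p.1
    exact hB.eq_zero_of_halfTurn (i := Sum.inl p.1) (j := Sum.inl j)
      (by simpa using hj.symm) rfl (by simp [blk]) (by simp [blk]) (by simp)
  have z12 : ∀ (p : Fin k × Fin m) (q : Fin l × Fin m),
      B (unitVec (Sum.inl p.1) (Sum.inr (Sum.inr p.2)))
        (unitVec (Sum.inr (Sum.inl q.1)) (Sum.inr (Sum.inr q.2))) = 0 := by
    intro p q
    obtain ⟨j, hj⟩ := ex2 (by omega : 2 ≤ k) p.1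
    exact hB.eq_zero_of_halfTurn (i := Sum.inl p.1) (j := Sum.inl j)
      (by simpa using hj.symm) rfl (by simp [blk]) (by simp [blk]) (by simp)
  rcases s with p | p | p <;> rcases t with q | q | q
  · refine hB.eq_zero_of_exists rfl rfl hs ?_ (Or.inl (exists_left hk _ _))
    by_contra hcon
    push Not at hcon
    simp only [row, col, Sum.elim_inl, Sum.inl.injEq, Sum.inr.injEq] at hcon
    exact hst (congrArg Sum.inl (Prod.ext hcon.1 hcon.2))
  · exact z01 p q
  · exact z02 p q
  · rw [hB.symm]; exact z01 q p
  · refine hB.eq_zero_of_exists rfl rfl hs ?_ (Or.inl (exists_left hk _ _))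
    by_contra hcon
    push Not at hcon
    simp only [row, col, Sum.elim_inl, Sum.elim_inr, Sum.inl.injEq, Sum.inr.injEq] at hcon
    exact hst (congrArg (Sum.inr ∘ Sum.inl) (Prod.ext hcon.1 hcon.2))
  · exact z12 p q
  · rw [hB.symm]; exact z02 q p
  · rw [hB.symm]; exact z12 q p
  · have hne : Sum.inr (Sum.inl p.1) ≠ (Sum.inr (Sum.inl q.1) : Idx k l m)
        ∨ Sum.inr (Sum.inr p.2) ≠ (Sum.inr (Sum.inr q.2) : Idx k l m) := by
      by_contra hcon
      push Not at hcon
      simp only [Sum.inl.injEq, Sum.inr.injEq] at hcon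
      exact hst (congrArg (Sum.inr ∘ Sum.inr) (Prod.ext hcon.1 hcon.2))
    -- for `l = 2` the last block has size one, and two vectors of the third summand share its index
    by_cases hl3 : 3 ≤ l
    · refine hB.eq_zero_of_exists rfl rfl hs hne (Or.inl ?_)
      obtain ⟨j, h1, h2⟩ := Fin.exists_ne_and_ne_of_two_lt p.1 q.1 hl3
      exact ⟨Sum.inr (Sum.inl j), rfl, by simpa [row] using h1, by simpa [row] using h2⟩
    · have : Subsingleton (Fin m) := Fin.subsingleton_iff_le_one.mpr (by omega)
      have hpq : p.2 = q.2 := Subsingleton.elim _ _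
      have h := hne.resolve_right (fun h => h (congrArg _ (congrArg _ hpq)))
      change B (unitVec (Sum.inr (Sum.inl p.1)) (Sum.inr (Sum.inr p.2)))
        (unitVec (Sum.inr (Sum.inl q.1)) (Sum.inr (Sum.inr q.2))) = 0
      rw [← hpq]
      exact hB.eq_zero_left h rfl hs

/-- Every invariant metric belongs to the three-parameter family if at most one block has size two. -/
theorem isThreeParameter_of_isInvariantMetric {B : LinearMap.BilinForm ℝ (𝔭 k l m)}
    (hB : IsInvariantMetric B) (hlk : l ≤ k) (hml : m ≤ l) (hm : 1 ≤ m) (hl : 2 ≤ l)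
    (h2 : ¬ (l = 2 ∧ (k = 2 ∨ m = 2))) : IsThreeParameter B := by
  have hμ : 0 < 2 * (((k + l + m : ℕ) : ℝ) - 2) := by
    have : ((3 : ℕ) : ℝ) ≤ ((k + l + m : ℕ) : ℝ) := Nat.cast_le.mpr (by omega)
    push_cast at this ⊢
    linarith
  have hbv : ∀ t : Coord k l m, basisVec t = unitVec (row t) (col t) := fun t =>
    Subtype.ext (coe_unitVec (blk_row_ne_blk_col t)).symm
  have hpos : ∀ t : Coord k l m, 0 < B (basisVec t) (basisVec t) := fun t => by
    refine hB.pos _ fun h => ?_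
    have h3 := congrFun (congrFun (congrArg (Subtype.val) h) (row t)) (col t)
    have h4 : skewUnit (row t) (col t) (row t) (col t) = (0 : ℝ) := h3
    rw [skewUnit_row_col, if_pos rfl] at h4
    exact one_ne_zero h4
  have i0 : Fin k := ⟨0, by omega⟩
  have j0 : Fin l := ⟨0, by omega⟩
  have q0 : Fin m := ⟨0, by omega⟩
  set μ := 2 * (((k + l + m : ℕ) : ℝ) - 2) with hμdef
  set t₁ : Coord k l m := Sum.inl (i0, j0) with ht₁
  set t₂ : Coord k l m := Sum.inr (Sum.inl (i0, q0)) with ht₂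
  set t₃ : Coord k l m := Sum.inr (Sum.inr (j0, q0)) with ht₃
  refine isThreeParameter_iff.mpr ⟨B (basisVec t₁) (basisVec t₁) / μ,
    B (basisVec t₂) (basisVec t₂) / μ, B (basisVec t₃) (basisVec t₃) / μ,
    div_pos (hpos _) hμ, div_pos (hpos _) hμ, div_pos (hpos _) hμ, ?_⟩
  have hd : ∀ t : Coord k l m, B (basisVec t) (basisVec t)
      = μ * blockMetric (B (basisVec t₁) (basisVec t₁) / μ) (B (basisVec t₂) (basisVec t₂) / μ)
        (B (basisVec t₃) (basisVec t₃) / μ) (blk (row t)) (blk (col t)) := by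
    rintro (t | t | t)
    · change _ = μ * (B (basisVec t₁) (basisVec t₁) / μ)
      rw [mul_div_cancel₀ _ hμ.ne', hbv, hbv]
      exact hB.norm_eq rfl rfl (blk_row_ne_blk_col (Sum.inl t))
    · change _ = μ * (B (basisVec t₂) (basisVec t₂) / μ)
      rw [mul_div_cancel₀ _ hμ.ne', hbv, hbv]
      exact hB.norm_eq rfl rfl (blk_row_ne_blk_col (Sum.inr (Sum.inl t)))
    · change _ = μ * (B (basisVec t₃) (basisVec t₃) / μ)
      rw [mul_div_cancel₀ _ hμ.ne', hbv, hbv]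
      exact hB.norm_eq rfl rfl (blk_row_ne_blk_col (Sum.inr (Sum.inr t)))
  refine LinearMap.ext₂ fun X Y => ?_
  rw [familyMetric, diagForm_apply]
  conv_lhs => rw [← sum_coord_smul_basisVec X, ← sum_coord_smul_basisVec Y]
  simp only [map_sum, map_smul, LinearMap.sum_apply, LinearMap.smul_apply, smul_eq_mul]
  refine Finset.sum_congr rfl fun t _ => ?_
  rw [Finset.sum_eq_single t]
  · rw [hd]; ring
  · intro s _ hs
    rw [hB.eq_zero_of_ne hlk hml hl h2 hs]; ring
  · simp

end WallachSO

namespace WallachSO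

variable {k l m : ℕ}

/-! ### Counting metrics up to homothety -/

/-- A family of metrics that meets each homothety class of `S` exactly once counts these classes. -/
theorem numUpToHomothety_eq_ncard {S : Set (LinearMap.BilinForm ℝ (𝔭 k l m))} {ι : Type}
    {P : Set ι} (F : ι → LinearMap.BilinForm ℝ (𝔭 k l m)) (hF : ∀ p ∈ P, F p ∈ S)
    (hinj : ∀ p ∈ P, ∀ q ∈ P, ∀ c : ℝ, 0 < c → F q = c • F p → p = q)
    (hsurj : ∀ B ∈ S, ∃ p ∈ P, ∃ c : ℝ, 0 < c ∧ B = c • F p) :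
    numUpToHomothety S = P.ncard := by
  rw [numUpToHomothety, ← Nat.card_coe_set_eq]
  symm
  refine Nat.card_eq_of_bijective
    (fun p : P => (Quotient.mk (homothety S) ⟨F p, hF p p.2⟩)) ⟨?_, ?_⟩
  · intro p q hpq
    obtain ⟨c, hc, h⟩ := Quotient.exact hpq
    exact Subtype.ext (hinj p p.2 q q.2 c hc h)
  · intro B
    induction B using Quotient.inductionOn with
    | h B =>
      obtain ⟨p, hp, c, hc, h⟩ := hsurj B B.2
      exact ⟨⟨p, hp⟩, Quotient.sound ⟨c, hc, h⟩⟩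

theorem smul_familyMetric (c X Y Z : ℝ) :
    c • familyMetric k l m X Y Z = familyMetric k l m (c * X) (c * Y) (c * Z) := by
  refine LinearMap.ext₂ fun U V => ?_
  rw [LinearMap.smul_apply, LinearMap.smul_apply, smul_eq_mul, familyMetric_apply,
    familyMetric_apply]
  ring

theorem familyMetric_injective (hk : 2 ≤ k) (hl : 1 ≤ l) (hm : 1 ≤ m) {X Y Z X' Y' Z' : ℝ}
    (h : familyMetric k l m X Y Z = familyMetric k l m X' Y' Z') :
    X = X' ∧ Y = Y' ∧ Z = Z' := by
  have hμ : 2 * (((k + l + m : ℕ) : ℝ) - 2) ≠ 0 := by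
    have : ((3 : ℕ) : ℝ) ≤ ((k + l + m : ℕ) : ℝ) := Nat.cast_le.mpr (by omega)
    push_cast at this ⊢
    intro h
    linarith
  have e : ∀ (X Y Z : ℝ) (t : Coord k l m), familyMetric k l m X Y Z (basisVec t) (basisVec t)
      = 2 * (((k + l + m : ℕ) : ℝ) - 2) * blockMetric X Y Z (blk (row t)) (blk (col t)) := by
    intro X Y Z t
    rw [familyMetric, diagForm_apply]
    simp [basisVec, skewUnit_row_col]
  have h' : ∀ t : Coord k l m, blockMetric X Y Z (blk (row t)) (blk (col t))
      = blockMetric X' Y' Z' (blk (row t)) (blk (col t)) := fun t => by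
    refine mul_left_cancel₀ hμ ?_
    rw [← e, ← e, h]
  exact ⟨h' (Sum.inl (⟨0, by omega⟩, ⟨0, by omega⟩)),
    h' (Sum.inr (Sum.inl (⟨0, by omega⟩, ⟨0, by omega⟩))),
    h' (Sum.inr (Sum.inr (⟨0, by omega⟩, ⟨0, by omega⟩)))⟩

theorem einsteinSystem_smul {k l m X Y Z c : ℝ} (hc : c ≠ 0) :
    EinsteinSystem k l m (c * X) (c * Y) (c * Z) ↔ EinsteinSystem k l m X Y Z := by
  have hc2 : c ^ 2 ≠ 0 := pow_ne_zero 2 hc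
  constructor
  · rintro ⟨h1, h2⟩
    exact ⟨mul_left_cancel₀ hc2 (by linear_combination h1),
      mul_left_cancel₀ hc2 (by linear_combination h2)⟩
  · rintro ⟨h1, h2⟩
    exact ⟨by linear_combination c ^ 2 * h1, by linear_combination c ^ 2 * h2⟩

/-- A cyclic permutation of the blocks permutes the parameters and the Einstein equations. -/
theorem einsteinSystem_rotate {k l m X Y Z : ℝ} :
    EinsteinSystem m k l Y Z X ↔ EinsteinSystem k l m X Y Z := by
  constructor
  · rintro ⟨h1, h2⟩
    exact ⟨by linear_combination -h1 - h2, by linear_combination h1⟩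
  · rintro ⟨h1, h2⟩
    exact ⟨by linear_combination h2, by linear_combination -h1 - h2⟩

/-- The positive solutions of the Einstein equations with the third unknown equal to `1`. The
unknowns `x`, `y`, `1` belong to the modules whose third index blocks have sizes `α`, `β`, `γ`. -/
def solutionSet (α β γ : ℝ) : Set (ℝ × ℝ) :=
  {p | 0 < p.1 ∧ 0 < p.2 ∧ EinsteinSystem γ β α p.1 p.2 1}

theorem mem_threeParameterEinsteinMetrics (hk : 2 ≤ k) (hl : 1 ≤ l) (hm : 1 ≤ m)
    {B : LinearMap.BilinForm ℝ (𝔭 k l m)} : B ∈ threeParameterEinsteinMetrics k l m ↔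
      ∃ X Y Z : ℝ, 0 < X ∧ 0 < Y ∧ 0 < Z ∧ EinsteinSystem k l m X Y Z
        ∧ B = familyMetric k l m X Y Z := by
  constructor
  · rintro ⟨_, h3, hE⟩
    obtain ⟨X, Y, Z, hX, hY, hZ, rfl⟩ := isThreeParameter_iff.mp h3
    exact ⟨X, Y, Z, hX, hY, hZ, (isEinstein_familyMetric_iff hk hl hm hX hY hZ).mp hE, rfl⟩
  · rintro ⟨X, Y, Z, hX, hY, hZ, hS, rfl⟩
    exact ⟨isInvariantMetric_familyMetric hk hm hX hY hZ,
      isThreeParameter_iff.mpr ⟨X, Y, Z, hX, hY, hZ, rfl⟩,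
      (isEinstein_familyMetric_iff hk hl hm hX hY hZ).mpr hS⟩

/-- Up to homothety, the parameter of the summand in the blocks of sizes `l` and `m` is `1`. -/
theorem numUpToHomothety_eq_solutionSet (hk : 2 ≤ k) (hl : 1 ≤ l) (hm : 1 ≤ m) :
    numUpToHomothety (threeParameterEinsteinMetrics k l m) = (solutionSet m l k).ncard := by
  refine numUpToHomothety_eq_ncard (fun p => familyMetric k l m p.1 p.2 1) ?_ ?_ ?_
  · rintro p ⟨h1, h2, h3⟩
    exact (mem_threeParameterEinsteinMetrics hk hl hm).mpr
      ⟨p.1, p.2, 1, h1, h2, one_pos, h3, rfl⟩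
  · rintro p - q - c - h
    rw [smul_familyMetric] at h
    obtain ⟨h1, h2, h3⟩ := familyMetric_injective hk hl hm h
    have hc1 : c = 1 := by linarith
    rw [hc1, one_mul] at h1 h2
    exact Prod.ext h1.symm h2.symm
  · intro B hB
    obtain ⟨X, Y, Z, hX, hY, hZ, hS, rfl⟩ := (mem_threeParameterEinsteinMetrics hk hl hm).mp hB
    refine ⟨(X / Z, Y / Z), ⟨div_pos hX hZ, div_pos hY hZ, ?_⟩, Z, hZ, ?_⟩
    · refine (einsteinSystem_smul hZ.ne').mp ?_
      rwa [mul_div_cancel₀ _ hZ.ne', mul_div_cancel₀ _ hZ.ne', mul_one]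
    · rw [smul_familyMetric, mul_div_cancel₀ _ hZ.ne', mul_div_cancel₀ _ hZ.ne', mul_one]

/-- Up to homothety, the parameter of the summand in the blocks of sizes `k` and `l` is `1`. -/
theorem numUpToHomothety_eq_solutionSet_rotate (hk : 2 ≤ k) (hl : 1 ≤ l) (hm : 1 ≤ m) :
    numUpToHomothety (threeParameterEinsteinMetrics k l m) = (solutionSet l k m).ncard := by
  refine numUpToHomothety_eq_ncard (fun p => familyMetric k l m 1 p.1 p.2) ?_ ?_ ?_
  · rintro p ⟨h1, h2, h3⟩
    exact (mem_threeParameterEinsteinMetrics hk hl hm).mpr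
      ⟨1, p.1, p.2, one_pos, h1, h2, einsteinSystem_rotate.mp h3, rfl⟩
  · rintro p - q - c - h
    rw [smul_familyMetric] at h
    obtain ⟨h1, h2, h3⟩ := familyMetric_injective hk hl hm h
    have hc1 : c = 1 := by linarith
    rw [hc1, one_mul] at h2 h3
    exact Prod.ext h2.symm h3.symm
  · intro B hB
    obtain ⟨X, Y, Z, hX, hY, hZ, hS, rfl⟩ := (mem_threeParameterEinsteinMetrics hk hl hm).mp hB
    refine ⟨(Y / X, Z / X), ⟨div_pos hY hX, div_pos hZ hX, ?_⟩, X, hX, ?_⟩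
    · refine (einsteinSystem_smul hX.ne').mp ?_
      rw [mul_div_cancel₀ _ hX.ne', mul_div_cancel₀ _ hX.ne', mul_one]
      exact einsteinSystem_rotate.mpr hS
    · rw [smul_familyMetric, mul_div_cancel₀ _ hX.ne', mul_div_cancel₀ _ hX.ne', mul_one]

theorem invariantEinsteinMetrics_eq (hlk : l ≤ k) (hml : m ≤ l) (hm : 1 ≤ m) (hl : 2 ≤ l)
    (h2 : ¬ (l = 2 ∧ (k = 2 ∨ m = 2))) :
    invariantEinsteinMetrics k l m = threeParameterEinsteinMetrics k l m := by
  ext B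
  exact ⟨fun h => ⟨h.1, isThreeParameter_of_isInvariantMetric h.1 hlk hml hm hl h2, h.2⟩,
    fun h => ⟨h.1, h.2.2⟩⟩

end WallachSO

namespace WallachSO

/-! ### Reduction of the Einstein equations to a quartic equation -/

section Generic

/-- The quartic in `p = x - y` that is obtained from the Einstein equations by eliminating
`x + y`, where `α` and `β` differ. -/
def quartic (α β γ p : ℝ) : ℝ :=
  (γ + (α + β + γ - 2)) * (α + β) ^ 2 * p ^ 4
    - 2 * (α + β + γ - 2) * (α + β) * (β - α) * p ^ 3
    + (8 * (α + β + γ - 2) ^ 2 - 2 * (α + β) * (γ * (α + β) + 2 * α * β)) * p ^ 2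
    + 2 * (α + β + γ - 2) * (β - α) * (α + β - 4) * p - (α + β - 2) * (β - α) ^ 2

/-- The values of `p` that belong to positive `x` and `y`. Since
`(α + β) p (x + y) = 2 (α + β + γ - 2) p - (β - α)`, the inequalities say that `|p| < x + y`. -/
def IsAdmissible (α β γ p : ℝ) : Prop :=
  (0 < p ∧ (α + β) * p ^ 2 - 2 * (α + β + γ - 2) * p + (β - α) < 0) ∨
    (p < 0 ∧ (α + β) * p ^ 2 + 2 * (α + β + γ - 2) * p - (β - α) < 0)

variable {α β γ : ℝ}

/-- The identity behind the elimination, with `p = x - y` and `s = x + y`. -/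
theorem quartic_eq (p s : ℝ)
    (hs : (α + β) * p * s = 2 * (α + β + γ - 2) * p - (β - α)) :
    quartic α β γ p = ((α + β) * p) ^ 2 * (2 * (α + β + γ - 2) * s - (β - α) * p * s - (α + β)
      - (α + β + γ - 2) * (s ^ 2 - p ^ 2) - 2 * γ + γ * (s ^ 2 + p ^ 2)) := by
  rw [quartic]
  linear_combination -(2 * (α + β + γ - 2) * (α + β) * p - (β - α) * (α + β) * p ^ 2
    - (α + β - 2) * (2 * (α + β + γ - 2) * p - (β - α) + (α + β) * p * s)) * hs

/-- The difference `p = x - y` determines a solution: the first Einstein equation is linear in `x + y`,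
and the second one then is the quartic equation for `p`. -/
theorem ncard_solutionSet (ha : 0 < α + β) (hd : 0 < β - α) :
    (solutionSet α β γ).ncard = {p | IsAdmissible α β γ p ∧ quartic α β γ p = 0}.ncard := by
  have ha' := ha.ne'
  have hsum : ∀ x y : ℝ, EinsteinSystem γ β α x y 1 →
      (α + β) * (x - y) * (x + y) = 2 * (α + β + γ - 2) * (x - y) - (β - α) := by
    rintro x y ⟨h1, -⟩
    linear_combination h1
  have hp0 : ∀ x y : ℝ, EinsteinSystem γ β α x y 1 → x - y ≠ 0 := by
    intro x y h h0
    have := hsum x y h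
    rw [h0] at this
    linarith
  refine Set.ncard_congr (fun q _ => q.1 - q.2) ?_ ?_ ?_
  · rintro ⟨x, y⟩ ⟨hx, hy, h⟩
    have h1 := hsum x y h
    have h0 := hp0 x y h
    simp only at hx hy h ⊢
    refine ⟨?_, ?_⟩
    · rcases lt_or_gt_of_ne h0 with hneg | hpos
      · right
        refine ⟨hneg, ?_⟩
        have : (α + β) * ((x - y) * (2 * x)) < 0 :=
          mul_neg_of_pos_of_neg ha (mul_neg_of_neg_of_pos hneg (by linarith))
        linarith
      · left
        refine ⟨hpos, ?_⟩
        have : 0 < (α + β) * ((x - y) * (2 * y)) := by positivity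
        linarith
    · obtain ⟨e1, e2⟩ := h
      rw [quartic_eq (x - y) (x + y) h1]
      linear_combination ((α + β) * (x - y)) ^ 2 * (e1 + 2 * e2)
  · rintro ⟨x, y⟩ ⟨x', y'⟩ ⟨hx, hy, h⟩ ⟨hx', hy', h'⟩ hp
    simp only at h h' hp
    have h1 := hsum x y h
    have h1' := hsum x' y' h'
    rw [← hp] at h1'
    have h2 : x + y = x' + y' :=
      mul_left_cancel₀ (mul_ne_zero ha' (hp0 x y h)) (h1.trans h1'.symm)
    exact Prod.ext (by simp only; linarith) (by simp only; linarith)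
  · rintro p ⟨hadm, hq⟩
    have hp : p ≠ 0 := by
      rcases hadm with h | h
      · exact h.1.ne'
      · exact h.1.ne
    obtain ⟨s, hs⟩ : ∃ s, (α + β) * p * s = 2 * (α + β + γ - 2) * p - (β - α) :=
      ⟨(2 * (α + β + γ - 2) * p - (β - α)) / ((α + β) * p), by field_simp⟩
    have hsp : 0 < s + p ∧ 0 < s - p := by
      rcases hadm with ⟨h1, h2⟩ | ⟨h1, h2⟩
      · have h3 : 0 < (α + β) * p * (s - p) := by linarith
        have h4 : 0 < s - p := pos_of_mul_pos_right h3 (by positivity)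
        exact ⟨by linarith, h4⟩
      · have h3 : 0 < (α + β) * (-p) * (s + p) := by linarith
        have h4 : 0 < s + p := pos_of_mul_pos_right h3 (mul_pos ha (neg_pos.mpr h1)).le
        exact ⟨h4, by linarith⟩
    rw [quartic_eq p s hs] at hq
    have hE := (mul_eq_zero.mp hq).resolve_left (pow_ne_zero 2 (mul_ne_zero ha' hp))
    refine ⟨((s + p) / 2, (s - p) / 2), ⟨by simp only; linarith, by simp only; linarith, ?_⟩,
      by simp only; ring⟩
    constructor
    · simp only
      linear_combination hs
    · simp only
      linear_combination (1 / 2) * hE - (1 / 2) * hs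

theorem continuous_quartic (α β γ : ℝ) : Continuous (quartic α β γ) := by
  unfold quartic
  fun_prop

/-- A convex quadratic function is negative between two points where it is not positive. -/
theorem quadratic_neg_of_between {a b c u v p : ℝ} (ha : 0 < a) (hu : a * u ^ 2 + b * u + c ≤ 0)
    (hv : a * v ^ 2 + b * v + c ≤ 0) (hup : u < p) (hpv : p < v) :
    a * p ^ 2 + b * p + c < 0 := by
  have h1 : (v - u) * (a * p ^ 2 + b * p + c) = (v - p) * (a * u ^ 2 + b * u + c)
      + (p - u) * (a * v ^ 2 + b * v + c) - a * ((p - u) * (v - p) * (v - u)) := by ring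
  have h2 : (v - p) * (a * u ^ 2 + b * u + c) ≤ 0 :=
    mul_nonpos_of_nonneg_of_nonpos (by linarith) hu
  have h3 : (p - u) * (a * v ^ 2 + b * v + c) ≤ 0 :=
    mul_nonpos_of_nonneg_of_nonpos (by linarith) hv
  have h4 : 0 < a * ((p - u) * (v - p) * (v - u)) :=
    mul_pos ha (mul_pos (mul_pos (by linarith) (by linarith)) (by linarith))
  have h5 : (v - u) * (a * p ^ 2 + b * p + c) < 0 := by linarith
  exact neg_of_mul_neg_right h5 (by linarith)

variable (hα : 0 < α) (hd : 0 < β - α) (hγ : 0 < γ) (hβγ : 2 < β + γ) (hαγ : 2 < α + γ)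
include hα hd hγ hβγ hαγ

/-- There is an admissible negative root: at the end of the admissible interval, where `x = 0`,
the sign of the quartic is that of `y² - 1`. -/
theorem exists_neg_root (hab : 2 < α + β) :
    ∃ p, p < 0 ∧ IsAdmissible α β γ p ∧ quartic α β γ p = 0 := by
  obtain ⟨q, hq, hq0⟩ : ∃ q < -1,
      (α + β) * q ^ 2 + 2 * (α + β + γ - 2) * q - (β - α) = 0 := by
    have hM : 0 ≤ (2 * (α + β + γ - 2) + (β - α)) / (α + β) :=
      div_nonneg (by linarith) (by linarith)
    obtain ⟨M, hM', hMe⟩ : ∃ M, 1 ≤ M ∧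
        (α + β) * (M - 1) = 2 * (α + β + γ - 2) + (β - α) :=
      ⟨1 + (2 * (α + β + γ - 2) + (β - α)) / (α + β), by linarith, by
        have : α + β ≠ 0 := by linarith
        field_simp
        ring⟩
    have hc : Continuous fun q : ℝ =>
      (α + β) * q ^ 2 + 2 * (α + β + γ - 2) * q - (β - α) := by fun_prop
    have := intermediate_value_Ioo' (show -M ≤ -1 by linarith) hc.continuousOn
    obtain ⟨q, hq, hq0⟩ := this (show (0 : ℝ) ∈ Set.Ioo _ _ from ⟨by nlinarith, by
      have : (α + β) * (-M) ^ 2 + 2 * (α + β + γ - 2) * (-M) - (β - α)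
        = M * ((β - α) + (α + β)) - (β - α) := by linear_combination M * hMe
      rw [this]
      nlinarith⟩)
    exact ⟨q, hq.2, hq0⟩
  have hPq : 0 < quartic α β γ q := by
    rw [quartic_eq q (-q) (by linarith)]
    have hq2 : 0 < q ^ 2 - 1 := by nlinarith
    have : 0 < ((α + β) * q) ^ 2 * ((2 * β + 2 * γ) * (q ^ 2 - 1)) := by
      have : (α + β) * q ≠ 0 := mul_ne_zero (by linarith) (by linarith)
      have : 0 < 2 * β + 2 * γ := by linarith
      positivity
    convert this using 2
    linear_combination -hq0
  have hP0 : quartic α β γ 0 < 0 := by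
    have : 0 < (α + β - 2) * (β - α) ^ 2 := by
      have : 0 < α + β - 2 := by linarith
      positivity
    simp only [quartic]
    linarith
  obtain ⟨p, hp, hp0⟩ := intermediate_value_Ioo' (show q ≤ 0 by linarith)
    (continuous_quartic α β γ).continuousOn (show (0 : ℝ) ∈ Set.Ioo _ _ from ⟨hP0, hPq⟩)
  refine ⟨p, hp.2, Or.inr ⟨hp.2, ?_⟩, hp0⟩
  have := quadratic_neg_of_between (a := α + β) (b := 2 * (α + β + γ - 2)) (c := -(β - α))
    (by linarith) (u := q) (v := 0) (by linarith) (by linarith) hp.1 hp.2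
  linarith

/-- The end points of the interval of admissible positive values: there `y = 0`, and the sign of
the quartic is that of `x² - 1`. -/
theorem exists_endpoints : ∃ u v, 0 < u ∧ u < 1 ∧ 1 < v ∧
    (α + β) * u ^ 2 + -(2 * (α + β + γ - 2)) * u + (β - α) = 0 ∧
    (α + β) * v ^ 2 + -(2 * (α + β + γ - 2)) * v + (β - α) = 0 ∧
    quartic α β γ u < 0 ∧ 0 < quartic α β γ v := by
  have hc : Continuous fun q : ℝ =>
    (α + β) * q ^ 2 + -(2 * (α + β + γ - 2)) * q + (β - α) := by fun_prop
  have hP : ∀ q, (α + β) * q ^ 2 + -(2 * (α + β + γ - 2)) * q + (β - α) = 0 →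
      quartic α β γ q = ((α + β) * q) ^ 2 * ((2 * α + 2 * γ) * (q ^ 2 - 1)) := by
    intro q hq
    rw [quartic_eq q q (by linarith)]
    congr 1
    linear_combination -hq
  have h1 : (α + β) * 1 ^ 2 + -(2 * (α + β + γ - 2)) * 1 + (β - α) < 0 := by linarith
  have hαγ' : 0 < 2 * α + 2 * γ := by linarith
  obtain ⟨u, hu, hu0⟩ := intermediate_value_Ioo' zero_le_one hc.continuousOn
    (show (0 : ℝ) ∈ Set.Ioo _ _ from ⟨h1, by simpa using hd⟩)
  obtain ⟨M, hM1, hMe⟩ : ∃ M, 1 ≤ M ∧ (α + β) * M = (α + β) + 2 * (α + β + γ - 2) := by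
    have hM : 0 ≤ 2 * (α + β + γ - 2) / (α + β) := div_nonneg (by linarith) (by linarith)
    refine ⟨1 + 2 * (α + β + γ - 2) / (α + β), by linarith, ?_⟩
    have : α + β ≠ 0 := by linarith
    field_simp
  obtain ⟨v, hv, hv0⟩ := intermediate_value_Ioo hM1 hc.continuousOn
    (show (0 : ℝ) ∈ Set.Ioo _ _ from ⟨h1, by
      have : (α + β) * M ^ 2 + -(2 * (α + β + γ - 2)) * M + (β - α)
        = (α + β) * M + (β - α) := by linear_combination M * hMe
      rw [this]
      have : 0 < (α + β) * M := mul_pos (by linarith) (by linarith)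
      linarith⟩)
  refine ⟨u, v, hu.1, hu.2, hv.1, hu0, hv0, ?_, ?_⟩
  · rw [hP u hu0]
    have h2 : 0 < ((α + β) * u) ^ 2 := pow_pos (mul_pos (by linarith) hu.1) 2
    have h3 : (2 * α + 2 * γ) * (u ^ 2 - 1) < 0 :=
      mul_neg_of_pos_of_neg hαγ' (by nlinarith [hu.1, hu.2])
    exact mul_neg_of_pos_of_neg h2 h3
  · rw [hP v hv0]
    have h2 : 0 < ((α + β) * v) ^ 2 := pow_pos (mul_pos (by linarith) (by linarith [hv.1])) 2
    exact mul_pos h2 (mul_pos hαγ' (by nlinarith [hv.1]))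

/-- There is an admissible positive root. -/
theorem exists_pos_root : ∃ p, 0 < p ∧ IsAdmissible α β γ p ∧ quartic α β γ p = 0 := by
  obtain ⟨u, v, hu, hu1, hv1, hu0, hv0, hPu, hPv⟩ := exists_endpoints hα hd hγ hβγ hαγ
  obtain ⟨p, hp, hp0⟩ := intermediate_value_Ioo (show u ≤ v by linarith)
    (continuous_quartic α β γ).continuousOn (show (0 : ℝ) ∈ Set.Ioo _ _ from ⟨hPu, hPv⟩)
  refine ⟨p, by linarith [hp.1], Or.inl ⟨by linarith [hp.1], ?_⟩, hp0⟩
  have := quadratic_neg_of_between (by linarith) hu0.le hv0.le hp.1 hp.2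
  linarith

omit hα hd hγ hβγ hαγ in
/-- A case of Descartes' rule of signs: as a polynomial in `-p`, the quartic has one sign change,
whatever the sign of `A₂`. -/
theorem neg_root_unique {A₄ A₃ A₂ A₁ A₀ p p' : ℝ} (h4 : 0 < A₄) (h3 : 0 ≤ A₃) (h1 : 0 ≤ A₁)
    (h0 : 0 ≤ A₀) (hp : p < 0) (hp' : p' < 0)
    (e : A₄ * p ^ 4 - A₃ * p ^ 3 + A₂ * p ^ 2 + A₁ * p - A₀ = 0)
    (e' : A₄ * p' ^ 4 - A₃ * p' ^ 3 + A₂ * p' ^ 2 + A₁ * p' - A₀ = 0) : p = p' := by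
  have key : (p - p') * (A₄ * p ^ 2 * p' ^ 2 * -(p + p') + A₃ * p ^ 2 * p' ^ 2
      + A₁ * (p * p') + A₀ * -(p + p')) = 0 := by
    linear_combination -(p' ^ 2) * e + p ^ 2 * e'
  have hpos : 0 < A₄ * p ^ 2 * p' ^ 2 * -(p + p') + A₃ * p ^ 2 * p' ^ 2
      + A₁ * (p * p') + A₀ * -(p + p') := by
    have hpp : 0 < p * p' := mul_pos_of_neg_of_neg hp hp'
    have hs : 0 < -(p + p') := by linarith
    have hp2 : 0 < p ^ 2 := by nlinarith
    have hp2' : 0 < p' ^ 2 := by nlinarith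
    positivity
  exact sub_eq_zero.mp ((mul_eq_zero.mp key).resolve_right hpos.ne')

omit hα hd hγ hβγ hαγ in
/-- The case of Descartes' rule of signs in which the sign of `A₁` is arbitrary. -/
theorem neg_root_unique' {A₄ A₃ A₂ A₁ A₀ p p' : ℝ} (h4 : 0 < A₄) (h3 : 0 ≤ A₃) (h2 : 0 ≤ A₂)
    (h0 : 0 ≤ A₀) (hp : p < 0) (hp' : p' < 0)
    (e : A₄ * p ^ 4 - A₃ * p ^ 3 + A₂ * p ^ 2 + A₁ * p - A₀ = 0)
    (e' : A₄ * p' ^ 4 - A₃ * p' ^ 3 + A₂ * p' ^ 2 + A₁ * p' - A₀ = 0) : p = p' := by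
  have key : (p - p') * (A₄ * (p * p') * (p ^ 2 + p * p' + p' ^ 2)
      + A₃ * (p * p') * -(p + p') + A₂ * (p * p') + A₀) = 0 := by
    linear_combination p' * e - p * e'
  have hpos : 0 < A₄ * (p * p') * (p ^ 2 + p * p' + p' ^ 2)
      + A₃ * (p * p') * -(p + p') + A₂ * (p * p') + A₀ := by
    have hpp : 0 < p * p' := mul_pos_of_neg_of_neg hp hp'
    have hs : 0 < -(p + p') := by linarith
    positivity
  exact sub_eq_zero.mp ((mul_eq_zero.mp key).resolve_right hpos.ne')

/-- If there is only one admissible positive root, then there are exactly two solutions. The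
condition `hab` makes the negative root unique. -/
theorem ncard_solutionSet_eq_two (hab : 4 ≤ α + β ∨
      0 ≤ 8 * (α + β + γ - 2) ^ 2 - 2 * (α + β) * (γ * (α + β) + 2 * α * β))
    (hab' : 2 < α + β)
    (huniq : ∀ p p', 0 < p → 0 < p' → IsAdmissible α β γ p → IsAdmissible α β γ p' →
      quartic α β γ p = 0 → quartic α β γ p' = 0 → p = p') :
    (solutionSet α β γ).ncard = 2 := by
  rw [ncard_solutionSet (by linarith) hd]
  obtain ⟨r, hr, hra, hr0⟩ := exists_neg_root hα hd hγ hβγ hαγ hab'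
  obtain ⟨t, ht, hta, ht0⟩ := exists_pos_root hα hd hγ hβγ hαγ
  have hrt : r ≠ t := by linarith
  rw [← Set.ncard_pair hrt]
  congr 1
  ext p
  constructor
  · rintro ⟨hpa, hp0⟩
    have hne : p ≠ 0 := by
      rcases hpa with h | h
      · exact h.1.ne'
      · exact h.1.ne
    rcases lt_or_gt_of_ne hne with hn | hpos
    · left
      have hA4 : 0 < (γ + (α + β + γ - 2)) * (α + β) ^ 2 := by
        have : 0 < α + β := by linarith
        have : 0 < γ + (α + β + γ - 2) := by linarith
        positivity
      have hA3 : 0 ≤ 2 * (α + β + γ - 2) * (α + β) * (β - α) := by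
        have : 0 < α + β := by linarith
        have : 0 < α + β + γ - 2 := by linarith
        positivity
      have hA0 : 0 ≤ (α + β - 2) * (β - α) ^ 2 := by
        have : 0 < α + β - 2 := by linarith
        positivity
      unfold quartic at hp0 hr0
      rcases hab with h4 | h4
      · refine neg_root_unique hA4 hA3 ?_ hA0 hn hr hp0 hr0
        have : 0 ≤ α + β - 4 := by linarith
        have : 0 < α + β + γ - 2 := by linarith
        positivity
      · exact neg_root_unique' hA4 hA3 h4 hA0 hn hr hp0 hr0
    · right
      exact huniq p t hpos ht hpa hta hp0 ht0
  · rintro (rfl | rfl)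
    · exact ⟨hra, hr0⟩
    · exact ⟨hta, ht0⟩

/-- If the quartic takes a positive and then a negative value at positive admissible points, then
there are four solutions: the signs at the end points of the admissible interval give three
positive roots. -/
theorem ncard_solutionSet_eq_four (hab : 2 < α + β) {p₁ p₂ : ℝ} (hp : 0 < p₁) (hpp : p₁ < p₂)
    (ha1 : IsAdmissible α β γ p₁) (ha2 : IsAdmissible α β γ p₂)
    (h1 : 0 < quartic α β γ p₁) (h2 : quartic α β γ p₂ < 0) :
    (solutionSet α β γ).ncard = 4 := by
  rw [ncard_solutionSet (by linarith) hd]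
  have hadm : ∀ {p}, 0 < p → IsAdmissible α β γ p →
      (α + β) * p ^ 2 + -(2 * (α + β + γ - 2)) * p + (β - α) < 0 := by
    rintro p hp (h | h)
    · linarith [h.2]
    · exact absurd hp (not_lt.mpr h.1.le)
  have hp2 : 0 < p₂ := hp.trans hpp
  replace ha1 := hadm hp ha1
  replace ha2 := hadm hp2 ha2
  obtain ⟨u, v, hu, hu1, hv1, hu0, hv0, hPu, hPv⟩ := exists_endpoints hα hd hγ hβγ hαγ
  have ha : 0 < α + β := by linarith
  have hup : u < p₁ := by
    by_contra hcon
    rcases (not_lt.mp hcon).lt_or_eq with h | h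
    · have := quadratic_neg_of_between ha ha1.le hv0.le h (by linarith)
      linarith
    · rw [h] at ha1; linarith
  have hpv : p₂ < v := by
    by_contra hcon
    rcases (not_lt.mp hcon).lt_or_eq with h | h
    · have := quadratic_neg_of_between ha hu0.le ha2.le (by linarith) h
      linarith
    · rw [← h] at ha2; linarith
  have hc := (continuous_quartic α β γ)
  obtain ⟨r₀, hr0, hra, hr0'⟩ := exists_neg_root hα hd hγ hβγ hαγ hab
  obtain ⟨r₁, hr1, hr1'⟩ := intermediate_value_Ioo hup.le hc.continuousOn
    (show (0 : ℝ) ∈ Set.Ioo _ _ from ⟨hPu, h1⟩)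
  obtain ⟨r₂, hr2, hr2'⟩ := intermediate_value_Ioo' hpp.le hc.continuousOn
    (show (0 : ℝ) ∈ Set.Ioo _ _ from ⟨h2, h1⟩)
  obtain ⟨r₃, hr3, hr3'⟩ := intermediate_value_Ioo hpv.le hc.continuousOn
    (show (0 : ℝ) ∈ Set.Ioo _ _ from ⟨h2, hPv⟩)
  have hadm' : ∀ {r}, u < r → r < v → IsAdmissible α β γ r := by
    intro r h h'
    left
    have := quadratic_neg_of_between ha hu0.le hv0.le h h'
    exact ⟨by linarith, by linarith⟩
  set V := {p | IsAdmissible α β γ p ∧ quartic α β γ p = 0} with hV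
  have hsub : (({r₀, r₁, r₂, r₃} : Finset ℝ) : Set ℝ) ⊆ V := by
    intro r hr
    simp only [Finset.coe_insert, Finset.coe_singleton, Set.mem_insert_iff,
      Set.mem_singleton_iff] at hr
    rcases hr with rfl | rfl | rfl | rfl
    · exact ⟨hra, hr0'⟩
    · exact ⟨hadm' hr1.1 (by linarith [hr1.2]), hr1'⟩
    · exact ⟨hadm' (by linarith [hr2.1]) (by linarith [hr2.2]), hr2'⟩
    · exact ⟨hadm' (by linarith [hr3.1]) hr3.2, hr3'⟩
  have hcard : ({r₀, r₁, r₂, r₃} : Finset ℝ).card = 4 := by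
    have n1 : r₀ < r₁ := by linarith [hr1.1]
    have n2 : r₁ < r₂ := by linarith [hr1.2, hr2.1]
    have n3 : r₂ < r₃ := by linarith [hr2.2, hr3.1]
    rw [Finset.card_insert_of_notMem, Finset.card_insert_of_notMem, Finset.card_pair n3.ne]
    · simp only [Finset.mem_insert, Finset.mem_singleton, not_or]
      exact ⟨n2.ne, (n2.trans n3).ne⟩
    · simp only [Finset.mem_insert, Finset.mem_singleton, not_or]
      exact ⟨n1.ne, (n1.trans n2).ne, (n1.trans (n2.trans n3)).ne⟩
  -- a polynomial of degree four has at most four roots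
  obtain ⟨F, hF⟩ : ∃ F : Finset ℝ, V ⊆ F ∧ F.card ≤ 4 := by
    set A₄ := (γ + (α + β + γ - 2)) * (α + β) ^ 2
    set A₃ := -(2 * (α + β + γ - 2) * (α + β) * (β - α))
    set A₂ := 8 * (α + β + γ - 2) ^ 2 - 2 * (α + β) * (γ * (α + β) + 2 * α * β)
    set A₁ := 2 * (α + β + γ - 2) * (β - α) * (α + β - 4)
    set A₀ := -((α + β - 2) * (β - α) ^ 2)
    set f : Polynomial ℝ := Polynomial.C A₄ * Polynomial.X ^ 4 + Polynomial.C A₃ * Polynomial.X ^ 3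
      + Polynomial.C A₂ * Polynomial.X ^ 2 + Polynomial.C A₁ * Polynomial.X + Polynomial.C A₀
      with hf
    have heval : ∀ p, f.eval p = quartic α β γ p := by
      intro p
      simp only [hf, quartic, Polynomial.eval_add, Polynomial.eval_mul, Polynomial.eval_C,
        Polynomial.eval_pow, Polynomial.eval_X]
      ring
    have hdeg : f.natDegree ≤ 4 := by
      rw [hf]; compute_degree
    have hne : f ≠ 0 := by
      intro h
      have := heval p₁
      rw [h, Polynomial.eval_zero] at this
      linarith
    refine ⟨f.roots.toFinset, fun p hp => ?_, ?_⟩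
    · rw [Finset.mem_coe, Multiset.mem_toFinset, Polynomial.mem_roots hne, Polynomial.IsRoot.def,
        heval]
      exact hp.2
    · exact (Multiset.toFinset_card_le _).trans ((Polynomial.card_roots' f).trans hdeg)
  refine le_antisymm ?_ ?_
  · exact (Set.ncard_le_ncard hF.1 F.finite_toSet).trans (by rw [Set.ncard_coe_finset]; exact hF.2)
  · rw [← hcard, ← Set.ncard_coe_finset]
    exact Set.ncard_le_ncard hsub (F.finite_toSet.subset hF.1)

end Generic
end WallachSO

namespace WallachSO

/-! ### The Einstein equations with two blocks of equal size -/

section Degenerate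

variable {β γ : ℝ}

/-- For `α = β` the first Einstein equation is a product of two linear factors. -/
theorem einsteinSystem_self_iff (x y : ℝ) : EinsteinSystem γ β β x y 1 ↔
    (x - y) * (β * (x + y) - (2 * β + γ - 2)) = 0 ∧
      2 * (2 * β + γ - 2) * (x + y) - 2 * β - 4 * (2 * β + γ - 2) * (x * y)
        - 2 * γ * (1 - x ^ 2 - y ^ 2) = 0 := by
  constructor
  · rintro ⟨h1, h2⟩
    exact ⟨by linear_combination (1 / 2) * h1, by linear_combination h1 + 2 * h2⟩
  · rintro ⟨h1, h2⟩
    exact ⟨by linear_combination 2 * h1, by linear_combination (1 / 2) * h2 - h1⟩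

variable (hβ : 1 < β) (hγ : 0 < γ)
include hβ hγ

/-- For `x = y` a quadratic equation with discriminant `γ² - 4 (β - 1)` remains. -/
theorem ncard_diagonal_eq_two (h : 4 * (β - 1) < γ ^ 2) :
    (solutionSet β β γ ∩ {p | p.1 = p.2}).ncard = 2 := by
  obtain ⟨r, hr, hr2⟩ : ∃ r, 0 < r ∧ r ^ 2 = γ ^ 2 - 4 * (β - 1) :=
    ⟨√(γ ^ 2 - 4 * (β - 1)), Real.sqrt_pos.mpr (by linarith), Real.sq_sqrt (by linarith)⟩
  have hb : 0 < 4 * (β - 1) := by linarith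
  have hrN : r < 2 * β + γ - 2 := by nlinarith
  have hne : (((2 * β + γ - 2) - r) / (4 * (β - 1)), ((2 * β + γ - 2) - r) / (4 * (β - 1)))
      ≠ (((2 * β + γ - 2) + r) / (4 * (β - 1)), ((2 * β + γ - 2) + r) / (4 * (β - 1))) := by
    intro hcon
    have := congrArg Prod.fst hcon
    simp only at this
    rw [div_left_inj' hb.ne'] at this
    linarith
  rw [← Set.ncard_pair hne]
  congr 1
  have hkey : ∀ x : ℝ, 4 * (β - 1) * (2 * (2 * β + γ - 2) * (x + x) - 2 * β
      - 4 * (2 * β + γ - 2) * (x * x) - 2 * γ * (1 - x ^ 2 - x ^ 2))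
      = -2 * ((4 * (β - 1) * x - ((2 * β + γ - 2) - r))
        * (4 * (β - 1) * x - ((2 * β + γ - 2) + r))) := by
    intro x
    linear_combination -2 * hr2
  ext ⟨x, y⟩
  constructor
  · rintro ⟨⟨hx, hy, hE⟩, hxy⟩
    simp only [Set.mem_ofPred_eq] at hx hy hE hxy
    subst hxy
    have h2 := ((einsteinSystem_self_iff x x).mp hE).2
    have h3 := hkey x
    rw [h2, mul_zero] at h3
    rcases mul_eq_zero.mp ((mul_eq_zero.mp h3.symm).resolve_left (by norm_num)) with h4 | h4
    · left
      have : x = ((2 * β + γ - 2) - r) / (4 * (β - 1)) := by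
        rw [eq_div_iff hb.ne']; linarith
      rw [← this]
    · right
      have : x = ((2 * β + γ - 2) + r) / (4 * (β - 1)) := by
        rw [eq_div_iff hb.ne']; linarith
      rw [← this]; exact Set.mem_singleton _
  · intro hmem
    have hsol : ∀ x, (4 * (β - 1) * x - ((2 * β + γ - 2) - r))
        * (4 * (β - 1) * x - ((2 * β + γ - 2) + r)) = 0 → 0 < x →
        (x, x) ∈ solutionSet β β γ ∩ {p | p.1 = p.2} := by
      intro x h0 hx
      refine ⟨⟨hx, hx, (einsteinSystem_self_iff x x).mpr ⟨by ring, ?_⟩⟩, rfl⟩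
      have := hkey x
      rw [h0, mul_zero] at this
      exact (mul_eq_zero.mp this).resolve_left hb.ne'
    rcases hmem with hm | hm
    · rw [hm]
      refine hsol _ ?_ (div_pos (by linarith) hb)
      rw [mul_div_cancel₀ _ hb.ne']
      ring
    · rw [Set.mem_singleton_iff.mp hm]
      refine hsol _ ?_ (div_pos (by linarith) hb)
      rw [mul_div_cancel₀ _ hb.ne']
      ring

theorem diagonal_eq_empty (h : γ ^ 2 < 4 * (β - 1)) :
    solutionSet β β γ ∩ {p | p.1 = p.2} = ∅ := by
  rw [Set.eq_empty_iff_forall_notMem]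
  rintro ⟨x, y⟩ ⟨⟨hx, hy, hE⟩, hxy⟩
  simp only [Set.mem_ofPred_eq] at hx hy hE hxy
  subst hxy
  have h2 := ((einsteinSystem_self_iff x x).mp hE).2
  have h3 : (4 * (β - 1) * x - (2 * β + γ - 2)) ^ 2 = γ ^ 2 - 4 * (β - 1) := by
    linear_combination -(2 * (β - 1)) * h2
  nlinarith [sq_nonneg (4 * (β - 1) * x - (2 * β + γ - 2))]

/-- For `x ≠ y` the first equation determines `x + y`, and the second one then `(x - y)²`. -/
theorem offDiagonal_iff {x y : ℝ} (hxy : x ≠ y) : EinsteinSystem γ β β x y 1 ↔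
    β * (x + y) = 2 * β + γ - 2 ∧ β ^ 2 * (2 * β + γ - 2 + γ) * (x - y) ^ 2
      = 2 * (β ^ 2 * (β + γ) - (2 * β + γ - 2) ^ 2) := by
  have hβ0 : β ≠ 0 := by linarith
  rw [einsteinSystem_self_iff]
  constructor
  · rintro ⟨h1, h2⟩
    have h3 := (mul_eq_zero.mp h1).resolve_left (sub_ne_zero.mpr hxy)
    refine ⟨by linarith, ?_⟩
    linear_combination β ^ 2 * h2 + (-(2 * (2 * β + γ - 2) * β)
      + (2 * β - 2) * (β * (x + y) + (2 * β + γ - 2))) * h3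
  · rintro ⟨h1, h2⟩
    have h3 : β * (x + y) - (2 * β + γ - 2) = 0 := by linarith
    refine ⟨by rw [h3, mul_zero], ?_⟩
    refine (mul_eq_zero.mp (?_ : β ^ 2 * _ = 0)).resolve_left (pow_ne_zero 2 hβ0)
    linear_combination h2 - (-(2 * (2 * β + γ - 2) * β)
      + (2 * β - 2) * (β * (x + y) + (2 * β + γ - 2))) * h3

theorem ncard_offDiagonal_eq_two (h : (2 * β + γ - 2) ^ 2 < β ^ 2 * (β + γ))
    (hβγ : 2 < β + γ) : (solutionSet β β γ ∩ {p | p.1 ≠ p.2}).ncard = 2 := by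
  have hβ0 : 0 < β := by linarith
  have hA : 0 < β ^ 2 * (2 * β + γ - 2 + γ) := by
    have : 0 < 2 * β + γ - 2 + γ := by linarith
    positivity
  obtain ⟨w, hw, hwe⟩ : ∃ w, 0 < w ∧ β ^ 2 * (2 * β + γ - 2 + γ) * w
      = 2 * (β ^ 2 * (β + γ) - (2 * β + γ - 2) ^ 2) :=
    ⟨2 * (β ^ 2 * (β + γ) - (2 * β + γ - 2) ^ 2) / (β ^ 2 * (2 * β + γ - 2 + γ)),
      div_pos (by linarith) hA, mul_div_cancel₀ _ hA.ne'⟩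
  obtain ⟨r, hr, hr2⟩ : ∃ r, 0 < r ∧ r ^ 2 = w :=
    ⟨√w, Real.sqrt_pos.mpr hw, Real.sq_sqrt hw.le⟩
  obtain ⟨s, hs⟩ : ∃ s, β * s = 2 * β + γ - 2 :=
    ⟨(2 * β + γ - 2) / β, mul_div_cancel₀ _ hβ0.ne'⟩
  have hs0 : 0 < s := pos_of_mul_pos_right (by rw [hs]; linarith) hβ0.le
  -- `|x - y| < x + y`, so that `x` and `y` are positive
  have hrs : r < s := by
    refine lt_of_pow_lt_pow_left₀ 2 hs0.le ?_
    have h1 : β ^ 2 * (2 * β + γ - 2 + γ) * w < β ^ 2 * (2 * β + γ - 2 + γ) * s ^ 2 := by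
      have h2 : β ^ 2 * (2 * β + γ - 2 + γ) * s ^ 2
          = (2 * β + γ - 2) ^ 2 * (2 * β + γ - 2 + γ) := by
        linear_combination (2 * β + γ - 2 + γ) * (β * s + (2 * β + γ - 2)) * hs
      have h3 : β ^ 2 < (2 * β + γ - 2) ^ 2 := pow_lt_pow_left₀ (by linarith) hβ0.le two_ne_zero
      rw [hwe, h2]
      nlinarith
    rw [hr2]
    exact lt_of_mul_lt_mul_left h1 hA.le
  have hne : ((s + r) / 2, (s - r) / 2) ≠ ((s - r) / 2, (s + r) / 2) := by
    intro hcon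
    have := congrArg Prod.fst hcon
    simp only at this
    linarith
  rw [← Set.ncard_pair hne]
  congr 1
  ext ⟨x, y⟩
  constructor
  · rintro ⟨⟨hx, hy, hE⟩, hxy⟩
    obtain ⟨h1, h2⟩ := (offDiagonal_iff hβ hγ hxy).mp hE
    simp only at h1 h2
    have h3 : x + y = s := mul_left_cancel₀ hβ0.ne' (h1.trans hs.symm)
    have h4 : (x - y) ^ 2 = r ^ 2 := by
      rw [hr2]; exact mul_left_cancel₀ hA.ne' (h2.trans hwe.symm)
    rcases sq_eq_sq_iff_eq_or_eq_neg.mp h4 with h5 | h5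
    · left
      exact Prod.ext (by simp only; linarith) (by simp only; linarith)
    · right
      exact Prod.ext (by simp only; linarith) (by simp only; linarith)
  · have hsol : ∀ x y, x + y = s → (x - y) ^ 2 = r ^ 2 → 0 < x → 0 < y → x ≠ y →
        (x, y) ∈ solutionSet β β γ ∩ {p | p.1 ≠ p.2} := by
      intro x y h1 h2 hx hy hxy
      refine ⟨⟨hx, hy, (offDiagonal_iff hβ hγ hxy).mpr ⟨by rw [h1, hs], ?_⟩⟩, hxy⟩
      rw [h2, hr2, hwe]
    rintro (hm | hm)
    · rw [hm]
      exact hsol _ _ (by ring) (by ring) (by linarith) (by linarith) (by intro h; linarith)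
    · rw [Set.mem_singleton_iff.mp hm]
      exact hsol _ _ (by ring) (by ring) (by linarith) (by linarith) (by intro h; linarith)

theorem offDiagonal_eq_empty (h : β ^ 2 * (β + γ) ≤ (2 * β + γ - 2) ^ 2) :
    solutionSet β β γ ∩ {p | p.1 ≠ p.2} = ∅ := by
  rw [Set.eq_empty_iff_forall_notMem]
  rintro ⟨x, y⟩ ⟨⟨hx, hy, hE⟩, hxy⟩
  obtain ⟨h1, h2⟩ := (offDiagonal_iff hβ hγ hxy).mp hE
  simp only [ne_eq, Set.mem_ofPred_eq] at h1 h2 hxy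
  have hA : 0 < β ^ 2 * (2 * β + γ - 2 + γ) := by
    have : 0 < 2 * β + γ - 2 + γ := by linarith
    positivity
  have h3 : 0 < (x - y) ^ 2 := by
    have := sub_ne_zero.mpr hxy
    positivity
  nlinarith [mul_pos hA h3]

omit hβ hγ in
theorem solutionSet_eq_union : solutionSet β β γ
    = solutionSet β β γ ∩ {p | p.1 = p.2} ∪ solutionSet β β γ ∩ {p | p.1 ≠ p.2} := by
  rw [← Set.inter_union_distrib_left]
  symm
  rw [Set.inter_eq_left]
  exact fun p _ => em _

theorem ncard_solutionSet_self_eq_four (h : 4 * (β - 1) < γ ^ 2)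
    (h' : (2 * β + γ - 2) ^ 2 < β ^ 2 * (β + γ)) (hβγ : 2 < β + γ) :
    (solutionSet β β γ).ncard = 4 := by
  have h1 := ncard_diagonal_eq_two hβ hγ h
  have h2 := ncard_offDiagonal_eq_two hβ hγ h' hβγ
  rw [solutionSet_eq_union, Set.ncard_union_eq _ (Set.finite_of_ncard_ne_zero (by omega))
    (Set.finite_of_ncard_ne_zero (by omega)), h1, h2]
  rw [Set.disjoint_left]
  exact fun p hp hp' => hp'.2 hp.2

theorem ncard_solutionSet_self_eq_two_of_lt (h : 4 * (β - 1) < γ ^ 2)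
    (h' : β ^ 2 * (β + γ) ≤ (2 * β + γ - 2) ^ 2) : (solutionSet β β γ).ncard = 2 := by
  rw [solutionSet_eq_union, offDiagonal_eq_empty hβ hγ h', Set.union_empty,
    ncard_diagonal_eq_two hβ hγ h]

theorem ncard_solutionSet_self_eq_two_of_gt (h : γ ^ 2 < 4 * (β - 1))
    (h' : (2 * β + γ - 2) ^ 2 < β ^ 2 * (β + γ)) (hβγ : 2 < β + γ) :
    (solutionSet β β γ).ncard = 2 := by
  rw [solutionSet_eq_union, diagonal_eq_empty hβ hγ h, Set.empty_union,
    ncard_offDiagonal_eq_two hβ hγ h' hβγ]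

end Degenerate
end WallachSO

namespace WallachSO

/-! ### Two metrics: the quartic for block sizes far apart -/

section Roots

/-- At most one positive root, since `A p³ - B p² + C p + D - F / p` is increasing for `p > 0`: the
derivative of the cubic part has no sign change if `B² ≤ 3 A C`. -/
theorem pos_root_unique_of_cubic {A B C D F p p' : ℝ} (hA : 0 < A) (hC : B ^ 2 ≤ 3 * A * C)
    (hF : 0 < F) (hp : 0 < p) (hp' : 0 < p')
    (e : A * p ^ 4 - B * p ^ 3 + C * p ^ 2 + D * p - F = 0)
    (e' : A * p' ^ 4 - B * p' ^ 3 + C * p' ^ 2 + D * p' - F = 0) : p = p' := by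
  have key : (p - p') * (p * p' * (A * (p ^ 2 + p * p' + p' ^ 2) - B * (p + p') + C) + F) = 0 := by
    linear_combination p' * e - p * e'
  have h1 : 0 ≤ A * (p ^ 2 + p * p' + p' ^ 2) - B * (p + p') + C := by
    refine nonneg_of_mul_nonneg_right (a := 12 * A) ?_ (by linarith)
    have h2 := mul_nonneg (mul_nonneg hA.le hA.le) (sq_nonneg (p - p'))
    linarith [sq_nonneg (3 * A * (p + p') - 2 * B)]
  have hpos : 0 < p * p' * (A * (p ^ 2 + p * p' + p' ^ 2) - B * (p + p') + C) + F := by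
    positivity
  exact sub_eq_zero.mp ((mul_eq_zero.mp key).resolve_right hpos.ne')

/-- At most one positive root: after division by `x²`, or by `x³` in the second case, the left side is
a decreasing function of `x`. -/
theorem pos_root_unique_of_coeff {c₀ c₁ c₂ c₃ c₄ x x' : ℝ} (h0 : 0 < c₀) (h3 : 0 ≤ c₃)
    (h4 : 0 < c₄) (h1 : 0 ≤ c₁ ∨ c₁ ^ 2 ≤ 3 * c₀ * c₂) (hx : 0 < x) (hx' : 0 < x')
    (e : c₀ + c₁ * x + c₂ * x ^ 2 - c₃ * x ^ 3 - c₄ * x ^ 4 = 0)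
    (e' : c₀ + c₁ * x' + c₂ * x' ^ 2 - c₃ * x' ^ 3 - c₄ * x' ^ 4 = 0) : x = x' := by
  rcases h1 with h1 | h1
  · have key : (x - x') * (c₀ * (x + x') + c₁ * (x * x') + c₃ * (x ^ 2 * x' ^ 2)
        + c₄ * (x ^ 2 * x' ^ 2 * (x + x'))) = 0 := by
      linear_combination -(x' ^ 2) * e + x ^ 2 * e'
    have hpos : 0 < c₀ * (x + x') + c₁ * (x * x') + c₃ * (x ^ 2 * x' ^ 2)
        + c₄ * (x ^ 2 * x' ^ 2 * (x + x')) := by positivity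
    exact sub_eq_zero.mp ((mul_eq_zero.mp key).resolve_right hpos.ne')
  · have key : (x - x') * (c₀ / 4 * (x - x') ^ 2 + (3 / 4 * c₀ * (x + x') ^ 2
        + c₁ * (x + x') * (x * x') + c₂ * (x * x') ^ 2) + c₄ * (x * x') ^ 3) = 0 := by
      linear_combination -(x' ^ 3) * e + x ^ 3 * e'
    have h2 : 0 ≤ 3 / 4 * c₀ * (x + x') ^ 2
        + c₁ * (x + x') * (x * x') + c₂ * (x * x') ^ 2 := by
      refine nonneg_of_mul_nonneg_right (a := 12 * c₀) ?_ (by linarith)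
      have h5 := mul_nonneg (sub_nonneg.mpr h1) (sq_nonneg (x * x'))
      linarith [sq_nonneg (3 * c₀ * (x + x') + 2 * c₁ * (x * x'))]
    have hpos : 0 < c₀ / 4 * (x - x') ^ 2 + (3 / 4 * c₀ * (x + x') ^ 2
        + c₁ * (x + x') * (x * x') + c₂ * (x * x') ^ 2) + c₄ * (x * x') ^ 3 := by positivity
    exact sub_eq_zero.mp ((mul_eq_zero.mp key).resolve_right hpos.ne')

end Roots

section FarApart

/-- Two solutions if `k` is large compared to `l`: the quartic divided by `p` is increasing. -/
theorem ncard_solutionSet_of_large {k l m : ℕ} (hm : 1 ≤ m) (hml : m < l) (hlk : l < k)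
    (hk : l * l ≤ k + 2 * l) : (solutionSet (m : ℝ) l k).ncard = 2 := by
  have hm' : (1 : ℝ) ≤ m := by exact_mod_cast hm
  have hml' : (m : ℝ) + 1 ≤ l := by exact_mod_cast hml
  have hlk' : (l : ℝ) + 1 ≤ k := by exact_mod_cast hlk
  -- the conditions of `pos_root_unique_of_cubic`; after the substitutions `m = 1 + M`, `l = m + 1 + D`
  -- and `k = l² - 2 l + E` they are polynomials with positive coefficients once `M + D` is at least
  -- `2`; in the other cases `k = l + 1 + E` is substituted
  obtain ⟨hC, hdisc⟩ : (0 : ℝ) < 8 * ((m : ℝ) + l + k - 2) ^ 2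
        - 2 * ((m : ℝ) + l) * (k * ((m : ℝ) + l) + 2 * m * l) ∧
      0 < 3 * ((k : ℝ) + ((m : ℝ) + l + k - 2)) * (8 * ((m : ℝ) + l + k - 2) ^ 2
        - 2 * ((m : ℝ) + l) * (k * ((m : ℝ) + l) + 2 * m * l))
        - 4 * ((m : ℝ) + l + k - 2) ^ 2 * ((l : ℝ) - m) ^ 2 := by
    obtain ⟨M, rfl⟩ := Nat.exists_eq_add_of_le hm
    obtain ⟨D, rfl⟩ := Nat.exists_eq_add_of_le hml
    by_cases ht : M + D < 2
    · obtain ⟨E, rfl⟩ := Nat.exists_eq_add_of_le hlk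
      have : (M = 0 ∧ D = 0) ∨ (M = 0 ∧ D = 1) ∨ (M = 1 ∧ D = 0) := by omega
      rcases this with ⟨rfl, rfl⟩ | ⟨rfl, rfl⟩ | ⟨rfl, rfl⟩ <;> push_cast <;>
        constructor <;> ring_nf <;> positivity
    · obtain ⟨E, hE⟩ := Nat.exists_eq_add_of_le hk
      have hkE : (k : ℝ) = ((1 + M).succ + D) * ((1 + M).succ + D) + E
          - 2 * ((1 + M).succ + D) := by
        have : ((k + 2 * ((1 + M).succ + D) : ℕ) : ℝ)
          = ((((1 + M).succ + D) * ((1 + M).succ + D) + E : ℕ) : ℝ) := by rw [hE]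
        push_cast at this ⊢
        linarith
      have : (∃ M', M = 2 + M') ∨ (M = 1 ∧ ∃ D', D = 1 + D') ∨ (M = 0 ∧ ∃ D', D = 2 + D') := by
        by_cases h2 : 2 ≤ M
        · exact Or.inl (Nat.exists_eq_add_of_le h2)
        · right
          by_cases h1 : M = 1
          · exact Or.inl ⟨h1, Nat.exists_eq_add_of_le (by omega)⟩
          · exact Or.inr ⟨by omega, Nat.exists_eq_add_of_le (by omega)⟩
      rw [hkE]
      rcases this with ⟨M', rfl⟩ | ⟨rfl, D', rfl⟩ | ⟨rfl, D', rfl⟩ <;> push_cast <;>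
        constructor <;> ring_nf <;> positivity
  have hN : 0 < (m : ℝ) + l + k - 2 := by linarith
  refine ncard_solutionSet_eq_two (by linarith) (by linarith) (by linarith) (by linarith)
    (by linarith) (Or.inr hC.le) (by linarith) fun p p' hp hp' _ _ h h' => ?_
  unfold quartic at h h'
  refine pos_root_unique_of_cubic ?_ ?_ ?_ hp hp' h h'
  · have : 0 < (k : ℝ) + ((m : ℝ) + l + k - 2) := by linarith
    have : 0 < (m : ℝ) + l := by linarith
    positivity
  · have h1 := mul_pos (pow_pos (show 0 < (m : ℝ) + l by linarith) 2) hdisc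
    refine le_of_sub_nonneg (h1.le.trans_eq ?_)
    ring
  · have : 0 < (m : ℝ) + l - 2 := by linarith
    have : 0 < (l : ℝ) - m := by linarith
    positivity

end FarApart

end WallachSO

namespace WallachSO

/-! ### Two metrics: the quartic for block sizes close together -/

section Close

/-- The quartic in the variables `u = (α + β) p` and `x = u - (β - α)`. -/
theorem quartic_eq_shift (α β γ p : ℝ) : (α + β) ^ 2 * quartic α β γ p
    = -((α + β - 2) * ((α + β) ^ 2 - ((α + β) * p) ^ 2) * ((α + β) * p - (β - α)) ^ 2
      + 2 * ((α + β) * p) * ((α + β) * p - (β - α)) * (γ * ((α + β) ^ 2 - ((α + β) * p) ^ 2)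
        - 4 * (α + β) * (α + β + γ - 2))
      + 8 * (α * β - (γ - 2) * (α + β + γ - 2)) * ((α + β) * p) ^ 2) := by
  rw [quartic]
  ring

/-- The expansion of the quartic in powers of `x = (α + β) p - (β - α)`. -/
theorem quartic_eq_expand {α β γ p x e κ T R : ℝ} (hx : (α + β) * p = x + e) (he : e = β - α)
    (hκ : κ = α * β - (γ - 2) * (α + β + γ - 2))
    (hT : T = γ * (α * β) - (α + β) * (α + β + γ - 2))
    (hR : R = (α + β - 2) * (α * β) - γ * e ^ 2) :
    (α + β) ^ 2 * quartic α β γ p = -(8 * κ * e ^ 2 + 8 * e * (T + 2 * κ) * x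
      + (4 * R + 8 * T + 8 * κ) * x ^ 2 - 2 * e * (α + β - 2 + 3 * γ) * x ^ 3
      - (α + β - 2 + 2 * γ) * x ^ 4) := by
  rw [quartic_eq_shift, hx]
  subst hκ hT hR he
  ring

/-- Two solutions if `k` is small compared to `l` and large compared to `m`. In powers of
`x = (l + k) p - (k - l)`, the quartic has no zero with `p > 0` and `x ≤ 0`, and by
`pos_root_unique_of_coeff` at most one with `x > 0`. -/
theorem ncard_solutionSet_of_small {k l m : ℕ} (hm : 1 ≤ m) (hml : m < l) (hlk : l < k)
    (hk : k + 2 * l + 1 ≤ l * l) (hmk : m * m + 1 ≤ k + l) :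
    (solutionSet (l : ℝ) k m).ncard = 2 := by
  have hm' : (1 : ℝ) ≤ m := by exact_mod_cast hm
  have hml' : (m : ℝ) + 1 ≤ l := by exact_mod_cast hml
  have hlk' : (l : ℝ) + 1 ≤ k := by exact_mod_cast hlk
  obtain ⟨e, he⟩ : ∃ e : ℝ, e = (k : ℝ) - l := ⟨_, rfl⟩
  obtain ⟨κ, hκ⟩ : ∃ κ : ℝ, κ = (l : ℝ) * k - (m - 2) * ((l : ℝ) + k + m - 2) := ⟨_, rfl⟩
  obtain ⟨T, hT⟩ : ∃ T : ℝ, T = m * ((l : ℝ) * k) - ((l : ℝ) + k) * ((l : ℝ) + k + m - 2) :=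
    ⟨_, rfl⟩
  obtain ⟨R, hR⟩ : ∃ R : ℝ, R = ((l : ℝ) + k - 2) * (l * k) - m * e ^ 2 := ⟨_, rfl⟩
  obtain ⟨hκ0, hR0, hTR⟩ : 0 < κ ∧ 0 < R ∧ 2 * T ^ 2 ≤ 3 * κ * R := by
    -- `p` and `q` measure the slack in the assumptions; the differences below are polynomials with
    -- nonnegative coefficients in `M`, `D` and `E`, where `m = 1 + M`, `l = m + 1 + D`, `k = l + E`
    obtain ⟨p, hp⟩ : ∃ p : ℝ, p = (k : ℝ) + l - 1 - m * m := ⟨_, rfl⟩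
    obtain ⟨q, hq⟩ : ∃ q : ℝ, q = (l : ℝ) * l - 2 * l - 1 - k := ⟨_, rfl⟩
    have hp0 : 0 ≤ p := by
      have : (m : ℝ) * m + 1 ≤ k + l := by exact_mod_cast hmk
      linarith
    have hq0 : 0 ≤ q := by
      have : (k : ℝ) + 2 * l + 1 ≤ l * l := by exact_mod_cast hk
      linarith
    obtain ⟨M, rfl⟩ := Nat.exists_eq_add_of_le hm
    obtain ⟨D, rfl⟩ := Nat.exists_eq_add_of_le hml
    obtain ⟨E, rfl⟩ := Nat.exists_eq_add_of_le hlk.le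
    have h1 : 0 < κ - 2 * p := by
      rw [hκ, hp]; push_cast; ring_nf; positivity
    have h2 : 0 < R := by
      rw [hR, he]; push_cast; ring_nf; positivity
    have h3 : 0 ≤ 3 * κ * R - 2 * T ^ 2
        - (2 * (((1 + M).succ + D + E : ℕ) : ℝ) ^ 2 * (p * q) + 6 * (E : ℝ) ^ 2 * M * q
          + 7 * (E : ℝ) ^ 2 * p) := by
      rw [hκ, hR, hT, he, hp, hq]; push_cast; ring_nf; positivity
    have h4 : 0 ≤ 2 * (((1 + M).succ + D + E : ℕ) : ℝ) ^ 2 * (p * q) + 6 * (E : ℝ) ^ 2 * M * q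
          + 7 * (E : ℝ) ^ 2 * p := by positivity
    exact ⟨by linarith, h2, by linarith⟩
  have he0 : 0 < e := by linarith
  have hb : 0 < (l : ℝ) + k - 2 := by linarith
  refine ncard_solutionSet_eq_two (by linarith) (by linarith) (by linarith) (by linarith)
    (by linarith) (Or.inl (by linarith)) (by linarith) fun p p' hp hp' _ _ h h' => ?_
  have hroot : ∀ p, 0 < p → quartic (l : ℝ) k m p = 0 →
      0 < ((l : ℝ) + k) * p - e ∧
      8 * κ * e ^ 2 + 8 * e * (T + 2 * κ) * (((l : ℝ) + k) * p - e)
      + (4 * R + 8 * T + 8 * κ) * (((l : ℝ) + k) * p - e) ^ 2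
      - 2 * e * ((l : ℝ) + k - 2 + 3 * m) * (((l : ℝ) + k) * p - e) ^ 3
      - ((l : ℝ) + k - 2 + 2 * m) * (((l : ℝ) + k) * p - e) ^ 4 = 0 := by
    intro p hp h
    have hu : 0 < ((l : ℝ) + k) * p := mul_pos (by linarith) hp
    obtain ⟨x, hx⟩ : ∃ x, x = ((l : ℝ) + k) * p - e := ⟨_, rfl⟩
    have h1 := quartic_eq_expand (x := x) (p := p) (by rw [hx]; ring) he hκ hT hR
    rw [h, mul_zero] at h1
    rw [← hx]
    refine ⟨?_, by linarith⟩
    by_contra hcon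
    -- for `x ≤ 0` the quadratic part is a positive definite form in `e + x` and `x`
    obtain ⟨y, hy⟩ : ∃ y, y = -x := ⟨_, rfl⟩
    have hy0 : 0 ≤ y := by linarith
    have hye : 0 < e - y := by linarith
    have h2 : 0 < 8 * κ * (8 * κ * (e - y) ^ 2 - 8 * T * (e - y) * y + 4 * R * y ^ 2) := by
      have h3 : 8 * κ * (8 * κ * (e - y) ^ 2 - 8 * T * (e - y) * y + 4 * R * y ^ 2)
          = (8 * κ * (e - y) - 4 * T * y) ^ 2 + 8 * (3 * κ * R - 2 * T ^ 2) * y ^ 2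
            + 8 * (κ * R) * y ^ 2 := by ring
      rw [h3]
      rcases hy0.eq_or_lt with h4 | h4
      · rw [← h4]
        have : 0 < (8 * κ * e) ^ 2 := by positivity
        linarith
      · have h5 : 0 ≤ 8 * (3 * κ * R - 2 * T ^ 2) * y ^ 2 :=
          mul_nonneg (by linarith) (sq_nonneg y)
        have h6 : 0 < 8 * (κ * R) * y ^ 2 := by positivity
        linarith [sq_nonneg (8 * κ * (e - y) - 4 * T * y)]
    have h3 := pos_of_mul_pos_right h2 (by linarith)
    have h4 : 0 ≤ y ^ 3 * ((2 * e * ((l : ℝ) + k - 2 + 3 * m))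
        - ((l : ℝ) + k - 2 + 2 * m) * y) := by
      refine mul_nonneg (pow_nonneg hy0 3) ?_
      have h5 : ((l : ℝ) + k - 2 + 2 * m) * y ≤ ((l : ℝ) + k - 2 + 2 * m) * e :=
        mul_le_mul_of_nonneg_left (by linarith) (by linarith)
      have h6 : 0 ≤ e * (((l : ℝ) + k - 2) + 4 * m) := mul_nonneg he0.le (by linarith)
      linarith
    have hxy : x = -y := by linarith
    rw [hxy] at h1
    linarith
  obtain ⟨hx, hx0⟩ := hroot p hp h
  obtain ⟨hx', hx0'⟩ := hroot p' hp' h'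
  have hc : 0 ≤ 8 * e * (T + 2 * κ) ∨ (8 * e * (T + 2 * κ)) ^ 2
      ≤ 3 * (8 * κ * e ^ 2) * (4 * R + 8 * T + 8 * κ) := by
    rcases le_or_gt 0 (T + 2 * κ) with h1 | h1
    · left; positivity
    · right
      have h2 : 0 ≤ 32 * e ^ 2 * ((3 * κ * R - 2 * T ^ 2) + 2 * κ * (-(T + 2 * κ))
          + 2 * κ ^ 2) := by
        have h3 : 0 < κ * (-(T + 2 * κ)) := mul_pos hκ0 (by linarith)
        have h4 : 0 ≤ 3 * κ * R - 2 * T ^ 2 := by linarith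
        have h5 : 0 ≤ (3 * κ * R - 2 * T ^ 2) + 2 * κ * (-(T + 2 * κ)) + 2 * κ ^ 2 := by
          linarith [sq_nonneg κ]
        positivity
      refine le_of_sub_nonneg (h2.trans_eq ?_)
      ring
  have := pos_root_unique_of_coeff (by positivity) (mul_nonneg (by linarith) (by linarith))
    (by linarith) hc hx hx' hx0 hx0'
  have h3 : ((l : ℝ) + k) * p = ((l : ℝ) + k) * p' := by linarith
  exact mul_left_cancel₀ (by linarith) h3

end Close

end WallachSO

namespace WallachSO

/-! ### Four metrics: sign changes of the quartic -/

section Four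

/-- The quartic is negative at the point where `u = k - l / 2`. The expression is concave in `m`,
and it is positive for `m = 0` and for `m = l`. -/
theorem shifted_pos_of_large {k l m : ℕ} (hl : 4 ≤ l) (hml : m ≤ l) (hlk : l < k)
    (hk : 2 * k + 2 * l ≤ l * l + 3) {u : ℝ} (hu : u = (k : ℝ) - l / 2) :
    0 < ((l : ℝ) + k - 2) * (((l : ℝ) + k) ^ 2 - u ^ 2) * (u - ((k : ℝ) - l)) ^ 2
      + 2 * u * (u - ((k : ℝ) - l)) * (m * (((l : ℝ) + k) ^ 2 - u ^ 2)
        - 4 * ((l : ℝ) + k) * ((l : ℝ) + k + m - 2))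
      + 8 * ((l : ℝ) * k - (m - 2) * ((l : ℝ) + k + m - 2)) * u ^ 2 := by
  obtain ⟨g, hg⟩ : ∃ g : ℝ → ℝ, ∀ z, g z
      = ((l : ℝ) + k - 2) * (((l : ℝ) + k) ^ 2 - u ^ 2) * (u - ((k : ℝ) - l)) ^ 2
      + 2 * u * (u - ((k : ℝ) - l)) * (z * (((l : ℝ) + k) ^ 2 - u ^ 2)
        - 4 * ((l : ℝ) + k) * ((l : ℝ) + k + z - 2))
      + 8 * ((l : ℝ) * k - (z - 2) * ((l : ℝ) + k + z - 2)) * u ^ 2 := ⟨_, fun _ => rfl⟩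
  rw [← hg]
  have hl' : (4 : ℝ) ≤ l := by exact_mod_cast hl
  have hml' : (m : ℝ) ≤ l := by exact_mod_cast hml
  have hm0 : (0 : ℝ) ≤ m := m.cast_nonneg
  have h0 : 0 < g 0 ∧ 0 < g l := by
    obtain ⟨S, hS⟩ : ∃ S : ℝ, S = (l : ℝ) * l + 3 - 2 * k - 2 * l := ⟨_, rfl⟩
    have hS0 : 0 ≤ S := by
      have : 2 * (k : ℝ) + 2 * l ≤ l * l + 3 := by exact_mod_cast hk
      linarith
    obtain ⟨L, rfl⟩ := Nat.exists_eq_add_of_le hl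
    obtain ⟨E, rfl⟩ := Nat.exists_eq_add_of_le hlk
    constructor
    · rw [hg, hu]; push_cast; ring_nf; positivity
    -- a multiple of the slack `S` in the assumption absorbs the negative coefficients
    · have h1 : 0 < 16 * g ((4 + L : ℕ) : ℝ) - S * (32 * (E : ℝ) ^ 2 * L + 8 * (E : ℝ) * L ^ 2
          + 400 * (E : ℝ) * L + 384 * (E : ℝ) + 296 * (L : ℝ) + 1344) := by
        rw [hg, hu, hS]; push_cast; ring_nf; positivity
      have h2 : 0 ≤ S * (32 * (E : ℝ) ^ 2 * L + 8 * (E : ℝ) * L ^ 2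
          + 400 * (E : ℝ) * L + 384 * (E : ℝ) + 296 * (L : ℝ) + 1344) := by positivity
      linarith
  have h1 : l * g m = (l - m) * g 0 + m * g l + 8 * u ^ 2 * (l * (m * (l - m))) := by
    rw [hg, hg, hg]; ring
  have h2 : 0 < (l : ℝ) * g m := by
    rw [h1]
    have h3 : 0 ≤ ((l : ℝ) - m) * g 0 := mul_nonneg (by linarith) h0.1.le
    have h4 : 0 ≤ 8 * u ^ 2 * ((l : ℝ) * (m * (l - m))) :=
      mul_nonneg (by positivity) (mul_nonneg (by linarith) (mul_nonneg hm0 (by linarith)))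
    rcases hm0.eq_or_lt with h5 | h5
    · rw [← h5]
      have : 0 < (l : ℝ) * g 0 := mul_pos (by linarith) h0.1
      linarith
    · have : 0 < (m : ℝ) * g l := mul_pos h5 h0.2
      linarith
  exact pos_of_mul_pos_right h2 (by linarith)

/-- Four solutions if `m` is large and `k ≠ l`: with `b = k + l`, `c = k l` and `e = k - l`, the
quartic is positive at `u / b` for the solution `u` of `(b + m - 2) (c - b) u = e c (b - 2)`, and
negative at `v / b` for `v = k - l / 2`. -/
theorem ncard_solutionSet_of_four {k l m : ℕ} (hm : 1 ≤ m) (hml : m ≤ l) (hlk : l < k)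
    (hmk : 2 * k + 2 * l ≤ m * m + 3) : (solutionSet (l : ℝ) k m).ncard = 4 := by
  have hkl : 2 * k + 2 * l ≤ l * l + 3 := hmk.trans (by nlinarith)
  have hl : 4 ≤ l := by
    by_contra hcon
    have : l ≤ 3 := by omega
    interval_cases l <;> omega
  have hm' : (1 : ℝ) ≤ m := by exact_mod_cast hm
  have hml' : (m : ℝ) ≤ l := by exact_mod_cast hml
  have hlk' : (l : ℝ) + 1 ≤ k := by exact_mod_cast hlk
  have hl' : (4 : ℝ) ≤ l := by exact_mod_cast hl
  have hmk' : 2 * (k : ℝ) + 2 * l ≤ m * m + 3 := by exact_mod_cast hmk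
  have hkl' : 2 * (k : ℝ) + 2 * l ≤ l * l + 3 := by exact_mod_cast hkl
  obtain ⟨b, hb⟩ : ∃ b : ℝ, b = (l : ℝ) + k := ⟨_, rfl⟩
  obtain ⟨c, hc⟩ : ∃ c : ℝ, c = (l : ℝ) * k := ⟨_, rfl⟩
  obtain ⟨e, he⟩ : ∃ e : ℝ, e = (k : ℝ) - l := ⟨_, rfl⟩
  obtain ⟨N, hN⟩ : ∃ N : ℝ, N = b + m - 2 := ⟨_, rfl⟩
  have hb0 : 0 < b := by linarith
  have hb2 : 0 < b - 2 := by linarith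
  have he0 : 0 < e := by linarith
  have hN0 : 0 < N := by linarith
  have hcb : 0 < c - b := by
    rw [hc, hb]; nlinarith
  have hc0 : 0 < c := by linarith
  obtain ⟨v, hv⟩ : ∃ v : ℝ, v = (k : ℝ) - l / 2 := ⟨_, rfl⟩
  -- the critical point of the quadratic function of `x / u` that bounds the quartic
  obtain ⟨u, hu⟩ : ∃ u, N * (c - b) * u = e * c * (b - 2) :=
    ⟨e * c * (b - 2) / (N * (c - b)), mul_div_cancel₀ _ (mul_pos hN0 hcb).ne'⟩
  have hu0 : 0 < u := pos_of_mul_pos_right (by rw [hu]; positivity) (mul_pos hN0 hcb).le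
  have huv : u < v := by
    refine lt_of_mul_lt_mul_left (a := N * (c - b)) ?_ (mul_pos hN0 hcb).le
    rw [hu]
    have h1 : 0 < c * l - b * (2 * k - l) := by
      have : c * l - b * (2 * k - l) = k * (l * l - 2 * k - l) + l * l := by
        rw [hb, hc]; ring
      rw [this]
      have : 0 < (k : ℝ) * ((l : ℝ) * l - 2 * k - l) := mul_pos (by linarith) (by linarith)
      positivity
    have h2 : 0 < (b - 2) * (c * l - b * (2 * k - l)) + m * (c - b) * (2 * k - l) := by
      have : 0 < 2 * (k : ℝ) - l := by linarith
      have : 0 < (m : ℝ) := by linarith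
      positivity
    have h3 : 2 * (N * (c - b) * v - e * c * (b - 2))
        = (b - 2) * (c * l - b * (2 * k - l)) + m * (c - b) * (2 * k - l) := by
      rw [hv, he, hN]; ring
    linarith
  -- the admissible interval is where the convex quadratic function `z² - 2 N z + b e` is negative; it
  -- contains `w < u < v`, where `w = e (b - 2) / N`
  have hQv : 1 * v ^ 2 + -(2 * N) * v + b * e < 0 := by
    have h1 : 1 * v ^ 2 + -(2 * N) * v + b * e
        = -(2 * (k - l)) * (l + m - 2) - l * (7 / 4 * l + m - 2) := by
      rw [hv, hN, hb, he]; ring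
    rw [h1]
    have h2 : 0 < (2 * ((k : ℝ) - l)) * (l + m - 2) := mul_pos (by linarith) (by linarith)
    have h3 : 0 < (l : ℝ) * (7 / 4 * l + m - 2) := mul_pos (by linarith) (by linarith)
    linarith
  have hQu : 1 * u ^ 2 + -(2 * N) * u + b * e < 0 := by
    obtain ⟨w, hw⟩ : ∃ w, N * w = e * (b - 2) := ⟨_, mul_div_cancel₀ _ hN0.ne'⟩
    have hw0 : 0 < w := pos_of_mul_pos_right (by rw [hw]; positivity) hN0.le
    have hwe : w < e := by
      refine lt_of_mul_lt_mul_left (a := N) ?_ hN0.le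
      rw [hw, mul_comm N e]
      exact mul_lt_mul_of_pos_left (by linarith) he0
    have hwu : w < u := by
      refine lt_of_mul_lt_mul_left (a := N * (c - b)) ?_ (mul_pos hN0 hcb).le
      have h1 : N * (c - b) * w = (c - b) * (e * (b - 2)) := by rw [← hw]; ring
      have h2 : 0 < b * (e * (b - 2)) := by positivity
      rw [hu, h1]
      linarith
    have hQw : 1 * w ^ 2 + -(2 * N) * w + b * e < 0 := by
      have h1 : w ^ 2 < e ^ 2 := pow_lt_pow_left₀ hwe hw0.le two_ne_zero
      have h2 : 0 < e * (b - 4 - e) := mul_pos he0 (by linarith)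
      linarith
    exact quadratic_neg_of_between one_pos hQw.le hQv.le hwu huv
  have hadm : ∀ z, 0 < z → 1 * z ^ 2 + -(2 * N) * z + b * e < 0 →
      IsAdmissible (l : ℝ) k m (z / b) := by
    intro z hz hQ
    refine Or.inl ⟨div_pos hz hb0, ?_⟩
    rw [← hb, ← he, ← hN]
    have h1 : b * (b * (z / b) ^ 2 - 2 * N * (z / b) + e)
        = 1 * z ^ 2 + -(2 * N) * z + b * e := by
      field_simp
      ring
    exact neg_of_mul_neg_right (by rw [h1]; exact hQ) hb0.le
  have hquart : ∀ z, b ^ 2 * quartic (l : ℝ) k m (z / b)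
      = -((b - 2) * (b ^ 2 - z ^ 2) * (z - e) ^ 2
        + 2 * z * (z - e) * (m * (b ^ 2 - z ^ 2) - 4 * b * N)
        + 8 * (c - (m - 2) * N) * z ^ 2) := by
    intro z
    have h1 := quartic_eq_shift (l : ℝ) k m (z / b)
    rwa [← hb, ← hc, ← he, ← hN, mul_div_cancel₀ _ hb0.ne'] at h1
  refine ncard_solutionSet_eq_four (by linarith) (by linarith) (by linarith) (by linarith)
    (by linarith) (by linarith) (div_pos hu0 hb0) ((div_lt_div_iff_of_pos_right hb0).mpr huv)
    (hadm u hu0 hQu) (hadm v (hu0.trans huv) hQv) ?_ ?_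
  · refine pos_of_mul_pos_right (a := b ^ 2) ?_ (sq_nonneg b)
    rw [hquart]
    obtain ⟨x, hx⟩ : ∃ x, x = u - e := ⟨_, rfl⟩
    obtain ⟨T, hT⟩ : ∃ T, T = m * c - b * N := ⟨_, rfl⟩
    obtain ⟨Y, hY⟩ : ∃ Y, Y = (b - 2) * x + 2 * m * u := ⟨_, rfl⟩
    have hxT : c * (b - 2) * x = -T * u := by
      rw [hx, hT]
      rw [hN] at hu ⊢
      linear_combination hu
    have hY0 : 0 < Y := by
      refine pos_of_mul_pos_right (a := c) ?_ hc0.le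
      have h1 : c * Y = (m * c + b * N) * u := by
        rw [hY]
        linear_combination hxT - u * hT
      rw [h1]
      have : (0 : ℝ) < m := by linarith
      positivity
    have hbe : b ^ 2 = 4 * c + e ^ 2 := by rw [hb, hc, he]; ring
    have h2 : 0 < c ^ 2 * (m * m - 2 * b + 4) + N ^ 2 * e ^ 2 := by
      have h3 : 0 < (m : ℝ) * m - 2 * b + 4 := by linarith
      positivity
    have h4 : 0 ≤ c * (b - 2) * (x ^ 2 * (u + e) * Y) := by positivity
    have h5 : 0 < 4 * u ^ 2 * (c ^ 2 * (m * m - 2 * b + 4) + N ^ 2 * e ^ 2) := by positivity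
    have hTe : T ^ 2 - 2 * (c - (m - 2) * N) * c * (b - 2)
        = c ^ 2 * (m * m - 2 * b + 4) + N ^ 2 * e ^ 2 := by
      rw [hT]
      have hm2 : (m : ℝ) = N - b + 2 := by linarith
      rw [hm2]
      linear_combination N ^ 2 * hbe
    -- completion of the square, where `b² - u² = 4 c - x (u + e)`
    have h6 : c * (b - 2) * ((b - 2) * (b ^ 2 - u ^ 2) * (u - e) ^ 2
        + 2 * u * (u - e) * (m * (b ^ 2 - u ^ 2) - 4 * b * N)
        + 8 * (c - (m - 2) * N) * u ^ 2)
        = -(c * (b - 2) * (x ^ 2 * (u + e) * Y))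
          - 4 * u ^ 2 * (c ^ 2 * (m * m - 2 * b + 4) + N ^ 2 * e ^ 2) := by
      rw [← hTe, ← hx, hY]
      linear_combination 4 * (c * (b - 2) * x + T * u) * hxT
        + c * (b - 2) * x * ((b - 2) * x + 2 * m * u) * (hbe + (u + e) * hx)
        - 8 * u * (c * (b - 2) * x) * hT
    have h7 : c * (b - 2) * ((b - 2) * (b ^ 2 - u ^ 2) * (u - e) ^ 2
        + 2 * u * (u - e) * (m * (b ^ 2 - u ^ 2) - 4 * b * N)
        + 8 * (c - (m - 2) * N) * u ^ 2) < 0 := by rw [h6]; linarith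
    have h8 := neg_of_mul_neg_right h7 (by positivity)
    linarith
  · refine neg_of_mul_neg_right (a := b ^ 2) ?_ (sq_nonneg b)
    rw [hquart]
    have h1 := shifted_pos_of_large hl hml hlk hkl hv
    rw [← hb, ← hc, ← he, ← hN] at h1
    linarith

end Four

end WallachSO

namespace WallachSO

/-! ### The number of Einstein metrics -/

/-- The hypothesis `h` is `2 k + 2 l - 4 < m²`, for integers. -/
theorem numUpToHomothety_eq_four {k l m : ℕ} (hlk : l ≤ k) (hml : m ≤ l) (hm : 1 ≤ m)
    (hl : 2 ≤ l) (h : 2 * k + 2 * l ≤ m * m + 3) :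
    numUpToHomothety (threeParameterEinsteinMetrics k l m) = 4 := by
  rw [numUpToHomothety_eq_solutionSet_rotate (by omega) (by omega) hm]
  rcases hlk.eq_or_lt with rfl | hlk
  · have hml2 : m * m ≤ l * l := Nat.mul_le_mul hml hml
    have hl3 : 3 ≤ l := by
      by_contra hcon
      have : l = 2 := by omega
      subst this
      omega
    have hm3 : 3 ≤ m := by
      by_contra hcon
      have : m ≤ 2 := by omega
      interval_cases m <;> omega
    have h' : 4 * (l : ℝ) ≤ m * m + 3 := by
      have : 4 * l ≤ m * m + 3 := by omega
      exact_mod_cast this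
    have hl' : (3 : ℝ) ≤ l := by exact_mod_cast hl3
    have hml' : (m : ℝ) ≤ l := by exact_mod_cast hml
    have hm' : (3 : ℝ) ≤ m := by exact_mod_cast hm3
    refine ncard_solutionSet_self_eq_four (by linarith) (by linarith) (by linarith) ?_
      (by linarith)
    nlinarith
  · exact ncard_solutionSet_of_four hm hml hlk h

/-- The hypothesis `h` is `m² < k + l`, for integers. The parameter that is normalized to `1` belongs to
the blocks of sizes `k`, `l` if these sizes are close together, and to those of sizes `l`, `m`
otherwise. -/
theorem numUpToHomothety_eq_two {k l m : ℕ} (hlk : l ≤ k) (hml : m ≤ l) (hm : 1 ≤ m)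
    (hl : 2 ≤ l) (h : m * m + 1 ≤ k + l) :
    numUpToHomothety (threeParameterEinsteinMetrics k l m) = 2 := by
  have hl' : (2 : ℝ) ≤ l := by exact_mod_cast hl
  have hml' : (m : ℝ) ≤ l := by exact_mod_cast hml
  have hm' : (1 : ℝ) ≤ m := by exact_mod_cast hm
  have h' : (m : ℝ) * m + 1 ≤ k + l := by exact_mod_cast h
  rcases hlk.eq_or_lt with rfl | hlk
  · rw [numUpToHomothety_eq_solutionSet_rotate (by omega) (by omega) hm]
    refine ncard_solutionSet_self_eq_two_of_gt (by linarith) (by linarith) (by nlinarith) ?_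
      (by linarith)
    by_cases hl4 : 4 ≤ l
    · have hl4' : (4 : ℝ) ≤ l := by exact_mod_cast hl4
      have h1 : 0 ≤ (l : ℝ) * l * (l - 4) := mul_nonneg (by positivity) (by linarith)
      have h2 : 0 ≤ (l : ℝ) * m * (l - 4) := mul_nonneg (by positivity) (by linarith)
      linarith
    · have hm2 : m ≤ 2 := by
        by_contra hcon
        have : 3 * 3 ≤ m * m := Nat.mul_le_mul (by omega) (by omega)
        omega
      interval_cases l <;> interval_cases m <;> first | omega | norm_num
  · have hlk' : (l : ℝ) + 1 ≤ k := by exact_mod_cast hlk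
    by_cases hk : k + 2 * l + 1 ≤ l * l
    · rw [numUpToHomothety_eq_solutionSet_rotate (by omega) (by omega) hm]
      refine ncard_solutionSet_of_small hm (hml.lt_of_ne ?_) hlk hk h
      rintro rfl
      omega
    · rw [numUpToHomothety_eq_solutionSet (by omega) (by omega) hm]
      rcases hml.eq_or_lt with rfl | hml
      · refine ncard_solutionSet_self_eq_two_of_lt (by linarith) (by linarith) (by nlinarith) ?_
        nlinarith
      · exact ncard_solutionSet_of_large hm hml hlk (by omega)

end WallachSO

theorem mainTheorem1 (k l m : ℕ) (hlk : l ≤ k) (hml : m ≤ l) (hm : 1 ≤ m) (hl : 2 ≤ l) :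
    (Real.sqrt (2 * (k : ℝ) + 2 * (l : ℝ) - 4) < (m : ℝ) →
      WallachSO.numUpToHomothety (WallachSO.threeParameterEinsteinMetrics k l m) = 4 ∧
      WallachSO.numUpToHomothety (WallachSO.invariantEinsteinMetrics k l m) = 4) ∧
    ((m : ℝ) < Real.sqrt ((k : ℝ) + (l : ℝ)) →
      WallachSO.numUpToHomothety (WallachSO.threeParameterEinsteinMetrics k l m) = 2 ∧
      (¬ (l = 2 ∧ (k = 2 ∨ m = 2)) →
        WallachSO.numUpToHomothety (WallachSO.invariantEinsteinMetrics k l m) = 2)) := by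
  constructor
  · intro h
    have hm0 : (0 : ℝ) < m := by exact_mod_cast hm
    have h1 := (Real.sqrt_lt' hm0).mp h
    have h2 : 2 * k + 2 * l ≤ m * m + 3 := by
      have : 2 * (k : ℝ) + 2 * l < m * m + 4 := by linarith
      have : 2 * k + 2 * l < m * m + 4 := by exact_mod_cast this
      omega
    have h3 := WallachSO.numUpToHomothety_eq_four hlk hml hm hl h2
    refine ⟨h3, ?_⟩
    rwa [WallachSO.invariantEinsteinMetrics_eq hlk hml hm hl]
    -- the assumption on `m` excludes `l = 2`
    rintro ⟨rfl, -⟩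
    have := Nat.mul_le_mul hml hml
    omega
  · intro h
    have h1 := (Real.lt_sqrt m.cast_nonneg).mp h
    have h2 : m * m + 1 ≤ k + l := by
      have : (m : ℝ) * m < k + l := by linarith
      have : m * m < k + l := by exact_mod_cast this
      omega
    have h3 := WallachSO.numUpToHomothety_eq_two hlk hml hm hl h2
    exact ⟨h3, fun h4 => by rwa [WallachSO.invariantEinsteinMetrics_eq hlk hml hm hl h4]⟩
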